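/- Let $m>0$, $\beta>0$, $\epsilon>0$ and $\mathcal H=L^2(\mathbb R^3;\mathbb C^4)$. Let $D=-i\,\vec\alpha\cdot\vec\partial+\gamma^0m$ be the free Dirac Hamiltonian on $\mathcal H$, with $\gamma^0,\alpha_1,\alpha_2,\alpha_3$ the standard $4\times4$ Dirac matrices. Let $A=(A^0,\vec A):\mathbb R\times\mathbb R^3\to\mathbb R^4$ be smooth, with spatial support in a fixed compact set, $A(t,\cdot)=0$ for $t<-\epsilon$, and $A(t,\cdot)$ independent of $t$ for $t>0$. Let $\slashed A(t)=A^0(t)+\vec\alpha\cdot\vec A(t)$ (a multiplication operator), $\dot{\slashed A}$ its time derivative, and $$V_t=\sum_{n\ge0}i^n\int_{t_1<\dots<t_n<t}e^{iDt_1}\slashed A(t_1)e^{iD(t_2-t_1)}\cdots\slashed A(t_n)e^{-iDt_n}\,dt_1\cdots dt_n,\qquad \mathcal K=\int_{-\epsilon}^0V_s\,e^{isD}\dot{\slashed A}(s)e^{-isD}\,V_s^{-1}\,ds .$$ Here the operator integrals (here and below) are taken in the strong sense, and $V_s^{-1}=V_s^*$, as $V_s$ is unitary. Put $F_\pm=\mp(1+e^{\pm\beta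 D})^{-1}$, $\mathcal K_{iu}=e^{-uD}\mathcal Ke^{uD}$, $\sigma(l)=\mathrm{sign}(l)$ and, for $\bar u\in[0,\beta]$, $$T(\bar u)=\frac1{1+e^{-\beta D}}+\sum_{n\ge1}(-1)^n\int_{(0,\bar u)^n}F_-\Big(\prod_{j=1}^{n-1}\mathcal K_{iu_j}F_{\sigma(u_j-u_{j+1})}\Big)\mathcal K_{iu_n}F_+\,du ,$$ where each exponential $e^{\pm u_jD}$ is composed with the adjacent Fermi factor, so that only bounded operators occur. For bounded $X$ and real $a$, $e^{-aD}Xe^{aD}$ denotes the (unique, if it exists) bounded operator $Y$ with $E_\Lambda YE_\Lambda=(e^{-aD}E_\Lambda)X(e^{aD}E_\Lambda)$ for all $\Lambda$, where $E_\Lambda$ is the spectral projection of $D$ for $[-\Lambda,\Lambda]$. Define the relative entropy operator $$\mathfrak S=\beta\int_0^1e^{\beta(u-1)D}\mathcal K_{i\beta(u-1)}\big(T(\beta u)-T(0)\big)e^{-\beta(u-1)D}\,du=\mathcal KB,\qquad B=\beta\int_0^1e^{-\beta(1-u)D}\big(T(\beta u)-T(0)\big)e^{\beta(1-u)D}\,du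 ,$$ and the relative entropy $\mathscr S_{0,K}=\mathrm{Tr}\,\mathfrak S$. Then: 1. The integrals in the definitions of $V_t$ and $\mathcal K$ converge strongly, and the series defining $V_t$ converges absolutely in operator norm; so $\mathcal K$ is a well-defined bounded operator. 2. If $\|\mathcal K\|<\beta^{-1}$, then for every $\bar u\in[0,\beta]$ the integrals in the definition of $T(\bar u)$ converge strongly and its series converges absolutely in operator norm; for $u\in(0,1)$ the bounded operator $e^{-\beta(1-u)D}(T(\beta u)-T(0))e^{\beta(1-u)D}$ exists and is unique; the integral defining $B$ converges strongly; and $\mathfrak S$ is bounded with $$\|\mathfrak S\|\le\frac{\beta^2\|\mathcal K\|^2}{1-\beta\|\mathcal K\|}.$$ 3. Suppose that $\mathcal K$ has in the Fourier domain (with $\hat f(p)=(2\pi)^{-3/2}\int e^{-ip\cdot x}f(x)\,dx$) a measurable matrix-valued integral kernel $\hat{\mathcal K}$, i.e. $\widehat{\mathcal Kf}(p)=\int\hat{\mathcal K}(p,q)\hat f(q)\,dq$ for all $f\in\mathcal H$ and almost every $p$, and that $|\hat{\mathcal K}(p,q)|\le H(p-q)$ for almost every $(p,q)$ (operator norm of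 matrices), where $H\in L^1(\mathbb R^3)\cap L^2(\mathbb R^3)$, $\|H\|_1<\beta^{-1}$ and $\|H\|_2<\beta^{-1}$. Then $\|\mathcal K\|<\beta^{-1}$ and $\mathfrak S$ is trace class, i.e. $\sum_i\langle e_i,|\mathfrak S|e_i\rangle<\infty$ for every orthonormal basis $(e_i)$. Consequently the relative entropy is finite: $\sum_i\langle e_i,\mathfrak Se_i\rangle$ converges absolutely to $\mathscr S_{0,K}$, for every orthonormal basis $(e_i)$. -/

import Mathlib

open MeasureTheory

noncomputable section

namespace DiracEntropy

/-! ### One-particle space and operators on it -/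

/-- Physical space (and momentum space). -/
abbrev E3 : Type := EuclideanSpace ℝ (Fin 3)

/-- Spinors. -/
abbrev Spinor : Type := EuclideanSpace ℂ (Fin 4)

/-- The one-particle Hilbert space `L²(ℝ³, ℂ⁴)`. -/
abbrev HSp : Type := Lp Spinor 2 (volume : Measure E3)

/-- Bounded operators on the one-particle Hilbert space. -/
abbrev BOp : Type := HSp →L[ℂ] HSp

open Classical in
/-- The operator of multiplication by an essentially bounded matrix-valued function `M`,
`(mulOp M f)(x) = M x (f x)` for almost every `x`. -/
def mulOp (M : E3 → (Spinor →L[ℂ] Spinor)) : BOp :=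
  if h : MemLp M ⊤ (volume : Measure E3) then
    (ContinuousLinearMap.id ℂ (Spinor →L[ℂ] Spinor)).holderL (volume : Measure E3) ⊤ 2 2
      (h.toLp M)
  else 0

theorem mulOp_coeFn {M : E3 → (Spinor →L[ℂ] Spinor)} (h : MemLp M ⊤ (volume : Measure E3))
    (f : HSp) : (mulOp M f : E3 → Spinor) =ᵐ[volume] fun x => M x (f x) := by
  rw [mulOp, dif_pos h]
  have h1 := (ContinuousLinearMap.id ℂ (Spinor →L[ℂ] Spinor)).coeFn_holder (r := 2) (h.toLp M) f
  filter_upwards [h1, h.coeFn_toLp] with x hx hx2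
  simp only [ContinuousLinearMap.holderL_apply_apply]
  rw [hx, hx2]
  rfl

/-- `L = ∫ Φ(s) dμ(s)` in the strong sense: `L f = ∫ Φ(s) f dμ(s)` for every vector `f`, the
integrals being convergent Bochner integrals in the Hilbert space. -/
def HasStrongIntegral {X : Type} [MeasurableSpace X] (μ : Measure X) (Φ : X → BOp) (L : BOp) :
    Prop :=
  ∀ f : HSp, Integrable (fun s => Φ s f) μ ∧ L f = ∫ s, Φ s f ∂μ

open Classical in
/-- The strong operator integral `∫ Φ(s) dμ(s)` (zero if it does not exist). -/
def strongIntegral {X : Type} [MeasurableSpace X] (μ : Measure X) (Φ : X → BOp) : BOp :=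
  if h : ∃ L, HasStrongIntegral μ Φ L then h.choose else 0

/-! ### The free Dirac Hamiltonian `D = -i α·∂ + β m` and its functional calculus -/

/-- The Dirac matrices `α₁, α₂, α₃` (standard representation). -/
def alphaMat : Fin 3 → Matrix (Fin 4) (Fin 4) ℂ :=
  ![!![0, 0, 0, 1; 0, 0, 1, 0; 0, 1, 0, 0; 1, 0, 0, 0],
    !![0, 0, 0, -Complex.I; 0, 0, Complex.I, 0; 0, -Complex.I, 0, 0; Complex.I, 0, 0, 0],
    !![0, 0, 1, 0; 0, 0, 0, -1; 1, 0, 0, 0; 0, -1, 0, 0]]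

/-- The Dirac matrix `β = γ⁰` (standard representation). -/
def gammaZero : Matrix (Fin 4) (Fin 4) ℂ :=
  !![1, 0, 0, 0; 0, 1, 0, 0; 0, 0, -1, 0; 0, 0, 0, -1]

/-- A `4 × 4` matrix as an operator on spinors. -/
def matOp (M : Matrix (Fin 4) (Fin 4) ℂ) : Spinor →L[ℂ] Spinor := Matrix.toEuclideanCLM (𝕜 := ℂ) M

/-- The matrix `D(p) = α·p + m γ⁰`. -/
def diracMat (m : ℝ) (p : E3) : Matrix (Fin 4) (Fin 4) ℂ :=
  ∑ j, (p j : ℂ) • alphaMat j + (m : ℂ) • gammaZero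

/-- The energy `ω(p) = √(p² + m²)`. -/
def omega (m : ℝ) (p : E3) : ℝ := Real.sqrt (‖p‖ ^ 2 + m ^ 2)

theorem diracMat_sq (m : ℝ) (p : E3) :
    diracMat m p * diracMat m p = ((omega m p ^ 2 : ℝ) : ℂ) • (1 : Matrix (Fin 4) (Fin 4) ℂ) := by
  have h : omega m p ^ 2 = p 0 ^ 2 + p 1 ^ 2 + p 2 ^ 2 + m ^ 2 := by
    rw [omega, Real.sq_sqrt (by positivity), EuclideanSpace.norm_sq_eq, Fin.sum_univ_three]
    simp
  rw [h]
  have hI := Complex.I_mul_I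
  ext i j
  fin_cases i <;> fin_cases j <;>
    simp [diracMat, alphaMat, gammaZero, Matrix.mul_apply, Fin.sum_univ_succ] <;>
    first
    | ring1
    | linear_combination (-(p 1 : ℂ) ^ 2) * hI

/-- The matrix `f(D(p))`. Since `D(p)² = ω(p)²`, the spectral projections of `D(p)` for the
eigenvalues `± ω(p)` are `(1 ± D(p)/ω(p))/2`. -/
def diracMatFn (m : ℝ) (f : ℝ → ℂ) (p : E3) : Matrix (Fin 4) (Fin 4) ℂ :=
  (f (omega m p) / 2) • (1 + ((omega m p : ℂ)⁻¹) • diracMat m p)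
    + (f (-omega m p) / 2) • (1 - ((omega m p : ℂ)⁻¹) • diracMat m p)

/-- The bounded operator `f(D)`, for `f` bounded and measurable on the spectrum of `D`: the Fourier
multiplier with symbol `f(D(p))`. The Fourier transform of Mathlib is taken with respect to
`exp(-2πi x·ξ)`, so that the momentum is `p = 2πξ`. -/
def diracOp (m : ℝ) (f : ℝ → ℂ) : BOp :=
  ((Lp.fourierTransformₗᵢ E3 Spinor).symm.toContinuousLinearEquiv : BOp) *
    mulOp (fun ξ => matOp (diracMatFn m f ((2 * Real.pi) • ξ))) *
    ((Lp.fourierTransformₗᵢ E3 Spinor).toContinuousLinearEquiv : BOp)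

/-- `e^{itD}`. -/
def freeEvol (m t : ℝ) : BOp := diracOp m (fun x => Complex.exp (Complex.I * t * x))

/-- `e^{aD} E_Λ`, with `E_Λ` the spectral projection of `D` for the interval `[-Λ, Λ]`. -/
def expCut (m Λ a : ℝ) : BOp := diracOp m (fun x => if |x| ≤ Λ then (Real.exp (a * x) : ℂ) else 0)

/-! ### The external potential and the interaction `𝒦` -/

/-- A potential `(A⁰, A¹, A², A³)` which is smooth, of compact spatial support, vanishing for times
`t < -ε` and constant in time for `t > 0`. -/
structure IsSwitchedPotential (ε : ℝ) (A : ℝ → E3 → Fin 4 → ℝ) : Prop where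
  smooth : ContDiff ℝ (⊤ : ℕ∞) (fun z : ℝ × E3 => A z.1 z.2)
  compact_support : ∃ C : Set E3, IsCompact C ∧ ∀ t, ∀ x ∉ C, A t x = 0
  vanish : ∀ t < -ε, A t = 0
  constant : ∀ s t, 0 < s → 0 < t → A s = A t

/-- `A̸ = A⁰ + α·A⃗` as an operator of multiplication. -/
def slashOp (a : E3 → Fin 4 → ℝ) : BOp :=
  mulOp (fun x => matOp ((a x 0 : ℂ) • (1 : Matrix (Fin 4) (Fin 4) ℂ)
    + ∑ j : Fin 3, (a x j.succ : ℂ) • alphaMat j))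

/-- The potential in the interaction picture, `e^{itD} A̸(t) e^{-itD}`. -/
def slashInt (m : ℝ) (A : ℝ → E3 → Fin 4 → ℝ) (t : ℝ) : BOp :=
  freeEvol m t * slashOp (A t) * freeEvol m (-t)

/-- The time derivative of the potential. -/
def dotPot (A : ℝ → E3 → Fin 4 → ℝ) (t : ℝ) (x : E3) (μ : Fin 4) : ℝ :=
  deriv (fun s => A s x μ) t

/-- The `n`-th order term of the Dyson series,
`iⁿ ∫_{t₁ < ⋯ < tₙ < t} e^{iDt₁} A̸(t₁) e^{iD(t₂-t₁)} ⋯ A̸(tₙ) e^{-iDtₙ}`, as an iterated integral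
(the last integration is over the latest time `tₙ`). -/
def dyson (m : ℝ) (A : ℝ → E3 → Fin 4 → ℝ) : ℕ → ℝ → BOp
  | 0, _ => 1
  | n + 1, t => strongIntegral (volume.restrict (Set.Iio t))
      (fun s => Complex.I • (dyson m A n s * slashInt m A s))

/-- The unitary operator `V_t(A)`. -/
def Vop (m : ℝ) (A : ℝ → E3 → Fin 4 → ℝ) (t : ℝ) : BOp := ∑' n, dyson m A n t

/-- The integrand `V_s(A) e^{isD} Ȧ̸(s) e^{-isD} V_s(A)⁻¹` of the interaction; `V_s(A)` is unitary,
its inverse is its adjoint. -/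
def interactionIntegrand (m : ℝ) (A : ℝ → E3 → Fin 4 → ℝ) (s : ℝ) : BOp :=
  Vop m A s * slashInt m (dotPot A) s * ContinuousLinearMap.adjoint (Vop m A s)

/-- `𝒦 = ∫_{-ε}^0 V_s(A) e^{isD} Ȧ̸(s) e^{-isD} V_s(A)⁻¹ ds`. -/
def interaction (m ε : ℝ) (A : ℝ → E3 → Fin 4 → ℝ) : BOp :=
  strongIntegral (volume.restrict (Set.Ioo (-ε) 0)) (interactionIntegrand m A)

/-- The Fourier transform with the convention `(2π)^{-3/2} ∫ e^{-ip·x} f(x) dx`. -/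
def momentumRep (f : HSp) (p : E3) : Spinor :=
  ((2 * Real.pi) ^ (-(3 / 2) : ℝ) : ℝ) •
    ((Lp.fourierTransformₗᵢ E3 Spinor f : HSp) : E3 → Spinor) ((2 * Real.pi)⁻¹ • p)

/-- `Khat` is the (matrix-valued) integral kernel of `K` in the Fourier domain. -/
def IsFourierKernel (K : BOp) (Khat : E3 → E3 → (Spinor →L[ℂ] Spinor)) : Prop :=
  AEStronglyMeasurable (fun z : E3 × E3 => Khat z.1 z.2) volume ∧
  ∀ f : HSp, ∀ᵐ p : E3,
    Integrable (fun q => Khat p q (momentumRep f q)) ∧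
      momentumRep (K f) p = ∫ q, Khat p q (momentumRep f q)

/-! ### The series `T(ū)` -/

/-- The Fermi factor `F₊ = -1/(1 + e^{βD})` as a function on the spectrum. -/
def fermiPlus (β x : ℝ) : ℝ := -1 / (1 + Real.exp (β * x))

/-- The Fermi factor `F₋ = 1/(1 + e^{-βD})` as a function on the spectrum. -/
def fermiMinus (β x : ℝ) : ℝ := 1 / (1 + Real.exp (-β * x))

/-- The Fermi factor `F_{σ(l)}` for the sign of `l`. -/
def fermiSign (β l x : ℝ) : ℝ := if 0 < l then fermiPlus β x else fermiMinus β x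

/-- The integrand `F₋ (∏_{j=1}^{N-1} 𝒦_{iu_j} F_{σ(u_j - u_{j+1})}) 𝒦_{iu_N} F₊` with `N = n + 1` and
`𝒦_{iu} = e^{-uD} 𝒦 e^{uD}`, each exponential being composed with the adjacent Fermi factor. -/
def TIntegrand (m β : ℝ) (K : BOp) (n : ℕ) (u : Fin (n + 1) → ℝ) : BOp :=
  diracOp m (fun x => (fermiMinus β x * Real.exp (-(u 0) * x) : ℝ)) *
    (List.ofFn fun j : Fin n => K * diracOp m (fun x =>
      (Real.exp (u j.castSucc * x) * fermiSign β (u j.castSucc - u j.succ) x *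
        Real.exp (-(u j.succ) * x) : ℝ))).prod *
    K * diracOp m (fun x => (Real.exp (u (Fin.last n) * x) * fermiPlus β x : ℝ))

/-- Lebesgue measure on the cube `(0, ū)^k`. -/
def cubeMeasure (k : ℕ) (ub : ℝ) : Measure (Fin k → ℝ) :=
  volume.restrict (Set.univ.pi fun _ => Set.Ioo 0 ub)

/-- The integral of `TIntegrand` over the cube `(0, ū)^N`, `N = n + 1`. -/
def TIntegral (m β : ℝ) (K : BOp) (n : ℕ) (ub : ℝ) : BOp :=
  strongIntegral (cubeMeasure (n + 1) ub) (TIntegrand m β K n)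

/-- `T(ū) = 1/(1+e^{-βD}) + ∑_{N>0} (-1)^N ∫_{(0,ū)^N} ⋯`, with `N = n + 1`. -/
def TOp (m β : ℝ) (K : BOp) (ub : ℝ) : BOp :=
  diracOp m (fun x => (fermiMinus β x : ℝ)) + ∑' n : ℕ, (-1 : ℂ) ^ (n + 1) • TIntegral m β K n ub

/-! ### The relative entropy operator -/

/-- `Y` is the bounded operator given by `e^{-aD} X e^{aD}`: for all cutoffs `Λ`,
`E_Λ Y E_Λ = (e^{-aD} E_Λ) X (e^{aD} E_Λ)`. There is at most one such bounded operator, because the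
spectral projections `E_Λ` of `D` tend strongly to the identity. -/
def IsConj (m a : ℝ) (X Y : BOp) : Prop :=
  ∀ Λ : ℝ, expCut m Λ 0 * Y * expCut m Λ 0 = expCut m Λ (-a) * X * expCut m Λ a

open Classical in
/-- The bounded operator `e^{-aD} X e^{aD}` (zero if there is none). -/
def conjOp (m a : ℝ) (X : BOp) : BOp :=
  if h : ∃ Y, IsConj m a X Y then h.choose else 0

/-- The integrand `β e^{-β(1-u)D} (T(βu) - T(0)) e^{β(1-u)D}` of the operator `B`. -/
def BIntegrand (m β : ℝ) (K : BOp) (u : ℝ) : BOp :=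
  (β : ℂ) • conjOp m (β * (1 - u)) (TOp m β K (β * u) - TOp m β K 0)

/-- `B = β ∫_0^1 e^{-β(1-u)D} (T(βu) - T(0)) e^{β(1-u)D} du`. -/
def Bop (m β : ℝ) (K : BOp) : BOp :=
  strongIntegral (volume.restrict (Set.Ioo 0 1)) (BIntegrand m β K)

/-- The relative entropy operator
`𝔖 = β ∫_0^1 e^{β(u-1)D} 𝒦_{iβ(u-1)} (T(βu) - T(0)) e^{-β(u-1)D} du = 𝒦 B`, where
`e^{β(u-1)D} 𝒦_{iβ(u-1)} = 𝒦 e^{β(u-1)D}` because `𝒦_{iv} = e^{-vD} 𝒦 e^{vD}`. -/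
def entropyOp (m β : ℝ) (K : BOp) : BOp := K * Bop m β K

/-- `S` is trace class: `∑ᵢ ⟨eᵢ, |S| eᵢ⟩ < ∞` for every orthonormal basis, `|S| = (S*S)^{1/2}`. -/
def IsTraceClass {V : Type} [NormedAddCommGroup V] [InnerProductSpace ℂ V] [CompleteSpace V]
    (S : V →L[ℂ] V) : Prop :=
  ∀ (ι : Type) (e : HilbertBasis ι ℂ V),
    Summable fun i => RCLike.re (inner ℂ (e i) (CFC.abs S (e i)))

/-- The trace, computed in one orthonormal basis. -/
def opTrace {V : Type} [NormedAddCommGroup V] [InnerProductSpace ℂ V] [CompleteSpace V]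
    (S : V →L[ℂ] V) : ℂ :=
  ∑' i, inner ℂ ((exists_hilbertBasis ℂ V).choose_spec.choose i)
    (S ((exists_hilbertBasis ℂ V).choose_spec.choose i))

/-- The relative entropy `𝒮_{0,K} = Tr 𝔖`. -/
def relativeEntropy (m β : ℝ) (K : BOp) : ℂ := opTrace (entropyOp m β K)

end DiracEntropy

end

/-! The proof rests on writing everything in the Schrödinger picture. Conjugating the Dyson terms
back by the free evolution gives retarded integrals `lagInt`, in which the time `s` occurs only in
the argument of the potential. Differentiation in `s` therefore never produces the unbounded
operator `D`, and the sum `lagV` is smooth in operator norm. Hence 𝒦 = ∫ e^{isD} X(s) e^{-isD} ds,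
where X = V Ȧ̸ V* (V = `lagV`) is norm-smooth and supported in [-ε, 0].

Two facts about 𝒦 follow, collected in `IsTameInteraction`. The first is that 𝒦 D⁻⁴ is trace class.
For a smooth compactly supported matrix field b, the operator b D⁻² is Hilbert–Schmidt because ω⁻²
is square integrable in three dimensions. The Leibniz rule for m² - Δ gives b D⁻² = D⁻² b' with b'
bounded, so with a cutoff χ equal to 1 on the support, b D⁻⁴ = (χ D⁻²)(b' D⁻²) is a product of two
Hilbert–Schmidt operators. Since D⁻⁴ commutes with the free evolution, it can be moved through the
whole Dyson series (`lagV_intertwine`). The same holds for all derivatives of X.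

The second fact is that the blocks of 𝒦 between the negative and positive spectral subspaces of D
are trace class. Let F_X(τ) be the off-diagonal block damped by e^{-τ|D|} on both sides. Its
τ-derivative is a commutator with D, and integration by parts in s turns it into i F_{X'}(τ).
Taylor's formula expresses F_X(0) as the integral over τ > 0 of a constant times τ⁴ F_{X⁽⁵⁾}(τ). The
trace norm of F_{X⁽⁵⁾}(τ) is O(τ⁻⁴ e^{-mτ}), so the integral converges in trace norm.

In 𝔖 = 𝒦B, the n-th term is an integral of a chain of n + 2 factors 𝒦 alternating with n + 2
contractions that are functions of D. On the half-line D > 0 each contraction has an exponential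
rate, possibly negative, and these rates sum to β; the same is true on D < 0. So on each half-line
some contraction decays at rate at least β/(n + 2) and supplies a factor D⁻⁴. Following one spectral
projection along the chain, either this contraction is reached, where 𝒦D⁻⁴ gives the trace norm, or
the projection changes at some 𝒦, where an off-diagonal block gives it. The resulting bound is a
polynomial in n times ‖𝒦‖^{n+1}, which is summable against β^{n+1} when β‖𝒦‖ < 1
(`traceNormLe_chain`, `traceNormLe_mul_shiftedIntegrand`).

The operator norm statements come from the same chains, all functions of D in them being
contractions; conjugation with e^{aD} merely shifts the two outer exponents. The kernel bound yields
‖𝒦‖ ≤ ‖H‖₁ < 1/β by Young's inequality. -/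

noncomputable section

namespace DiracEntropy
open Filter Topology ENNReal

/-! ### Multiplication operators -/

/-- Matrices acting on spinors. -/
abbrev SOp : Type := Spinor →L[ℂ] Spinor

theorem HSp_norm_sq (f : HSp) : ‖f‖ ^ 2 = ∫ x, ‖f x‖ ^ 2 := by
  have h := L2.inner_def (𝕜 := ℂ) f f
  rw [inner_self_eq_norm_sq_to_K] at h
  have h2 : ∀ x, inner ℂ (f x) (f x) = ((‖f x‖ ^ 2 : ℝ) : ℂ) := fun x => by
    rw [inner_self_eq_norm_sq_to_K]; push_cast; rfl
  simp_rw [h2] at h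
  rw [integral_complex_ofReal] at h
  have h3 : ((‖f‖ ^ 2 : ℝ) : ℂ) = ((∫ x, ‖f x‖ ^ 2 : ℝ) : ℂ) := by
    rw [← h]; push_cast; rfl
  exact Complex.ofReal_injective h3

theorem HSp_integrable_norm_sq (f : HSp) : Integrable (fun x => ‖f x‖ ^ 2) :=
  (memLp_two_iff_integrable_sq_norm (Lp.aestronglyMeasurable f)).1 (Lp.memLp f)

theorem memLp_symbol {M : E3 → SOp} (hM : AEStronglyMeasurable M volume) {C : ℝ}
    (hC : ∀ x, ‖M x‖ ≤ C) : MemLp M ⊤ (volume : Measure E3) :=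
  memLp_top_of_bound hM C (ae_of_all _ hC)

theorem HSp_norm_le_of_ae {f g : HSp} {C : ℝ}
    (h : ∀ᵐ x, ‖f x‖ ≤ C * ‖g x‖) : ‖f‖ ≤ C * ‖g‖ := by
  exact Lp.norm_le_mul_norm_of_ae_le_mul h

theorem norm_mulOp_le_ae {M : E3 → SOp} {C : ℝ} (hC : 0 ≤ C) (h : ∀ᵐ x, ‖M x‖ ≤ C) :
    ‖mulOp M‖ ≤ C := by
  by_cases hM : MemLp M ⊤ (volume : Measure E3)
  · refine ContinuousLinearMap.opNorm_le_bound _ hC fun f => ?_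
    refine HSp_norm_le_of_ae ?_
    filter_upwards [mulOp_coeFn hM f, h] with x hx hx2
    rw [hx]
    exact (ContinuousLinearMap.le_opNorm _ _).trans (by gcongr)
  · rw [mulOp, dif_neg hM, norm_zero]; exact hC

theorem norm_mulOp_le {M : E3 → SOp} {C : ℝ} (hC : 0 ≤ C) (h : ∀ x, ‖M x‖ ≤ C) :
    ‖mulOp M‖ ≤ C := norm_mulOp_le_ae hC (ae_of_all _ h)

theorem mulOp_eq_of_ae {M : E3 → SOp} (hM : MemLp M ⊤ (volume : Measure E3)) {T : BOp}
    (h : ∀ f : HSp, ∀ᵐ x, T f x = M x (f x)) : T = mulOp M := by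
  ext1 f
  refine Lp.ext ?_
  filter_upwards [h f, mulOp_coeFn hM f] with x h1 h2
  rw [h1, h2]

theorem mulOp_add {M N : E3 → SOp} (hM : MemLp M ⊤ (volume : Measure E3))
    (hN : MemLp N ⊤ (volume : Measure E3)) :
    mulOp (fun x => M x + N x) = mulOp M + mulOp N := by
  have h0 : MemLp (fun x => M x + N x) ⊤ (volume : Measure E3) := by
    have h := MemLp.sub hM (MemLp.neg hN)
    rw [sub_neg_eq_add] at h
    exact h
  refine (mulOp_eq_of_ae h0 fun f => ?_).symm
  filter_upwards [mulOp_coeFn hM f, mulOp_coeFn hN f, Lp.coeFn_add (mulOp M f) (mulOp N f)]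
    with x h1 h2 h3
  rw [add_apply, h3, Pi.add_apply, h1, h2]; rfl

theorem mulOp_smul {M : E3 → SOp} (hM : MemLp M ⊤ (volume : Measure E3)) (c : ℂ) :
    mulOp (fun x => c • M x) = c • mulOp M := by
  refine (mulOp_eq_of_ae (hM.const_smul c) fun f => ?_).symm
  filter_upwards [mulOp_coeFn hM f, Lp.coeFn_smul c (mulOp M f)] with x h1 h3
  rw [smul_apply, h3, Pi.smul_apply, h1]; rfl

theorem mulOp_sub {M N : E3 → SOp} (hM : MemLp M ⊤ (volume : Measure E3))
    (hN : MemLp N ⊤ (volume : Measure E3)) :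
    mulOp (fun x => M x - N x) = mulOp M - mulOp N := by
  refine (mulOp_eq_of_ae (hM.sub hN) fun f => ?_).symm
  filter_upwards [mulOp_coeFn hM f, mulOp_coeFn hN f, Lp.coeFn_sub (mulOp M f) (mulOp N f)]
    with x h1 h2 h3
  rw [sub_apply, h3, Pi.sub_apply, h1, h2]; rfl

theorem memLp_symbol_mul {M N : E3 → SOp} (hM : MemLp M ⊤ (volume : Measure E3))
    (hN : MemLp N ⊤ (volume : Measure E3)) :
    MemLp (fun x => M x * N x) ⊤ (volume : Measure E3) := by
  have := hN.mul (p := ⊤) (q := ⊤) (r := ⊤) hM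
  exact this

theorem mulOp_mul {M N : E3 → SOp} (hM : MemLp M ⊤ (volume : Measure E3))
    (hN : MemLp N ⊤ (volume : Measure E3)) :
    mulOp M * mulOp N = mulOp (fun x => M x * N x) := by
  refine mulOp_eq_of_ae (memLp_symbol_mul hM hN) fun f => ?_
  filter_upwards [mulOp_coeFn hM (mulOp N f), mulOp_coeFn hN f] with x h1 h2
  rw [mul_apply_eq_comp, h1, h2]; rfl

theorem mulOp_one : mulOp (fun _ => (1 : SOp)) = 1 := by
  refine (mulOp_eq_of_ae (memLp_top_const _) fun f => ?_).symm
  exact ae_of_all _ fun x => rfl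

theorem mulOp_zero : mulOp (fun _ => (0 : SOp)) = 0 := by
  refine (mulOp_eq_of_ae (memLp_top_const _) fun f => ?_).symm
  exact ae_of_all _ fun x => by simp

theorem memLp_symbol_adjoint {M : E3 → SOp} (hM : MemLp M ⊤ (volume : Measure E3)) :
    MemLp (fun x => ContinuousLinearMap.adjoint (M x)) ⊤ (volume : Measure E3) := by
  refine MemLp.of_le hM ?_ (ae_of_all _ fun x => ?_)
  · exact (ContinuousLinearMap.adjoint (𝕜 := ℂ) (E := Spinor)
      (F := Spinor)).continuous.comp_aestronglyMeasurable hM.1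
  · exact (LinearIsometryEquiv.norm_map _ _).le

theorem mulOp_adjoint {M : E3 → SOp} (hM : MemLp M ⊤ (volume : Measure E3)) :
    ContinuousLinearMap.adjoint (mulOp M)
      = mulOp (fun x => ContinuousLinearMap.adjoint (M x)) := by
  symm
  rw [ContinuousLinearMap.eq_adjoint_iff]
  intro f g
  rw [L2.inner_def, L2.inner_def]
  refine integral_congr_ae ?_
  filter_upwards [mulOp_coeFn hM g, mulOp_coeFn (memLp_symbol_adjoint hM) f] with x h1 h2
  rw [h1, h2, ContinuousLinearMap.adjoint_inner_left]

/-- Dominated convergence for ∫ |(M_u - N) f|² with majorant C²|f|²: uniformly bounded symbols that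
converge pointwise converge strongly, though in general not in norm. -/
theorem tendsto_mulOp {X : Type*} {l : Filter X} [l.IsCountablyGenerated]
    {M : X → E3 → SOp} {N : E3 → SOp} {C : ℝ}
    (hM : ∀ u, MemLp (M u) ⊤ (volume : Measure E3)) (hN : MemLp N ⊤ (volume : Measure E3))
    (hC : ∀ᶠ u in l, ∀ x, ‖M u x - N x‖ ≤ C)
    (h : ∀ x, Tendsto (fun u => M u x) l (𝓝 (N x))) (f : HSp) :
    Tendsto (fun u => mulOp (M u) f) l (𝓝 (mulOp N f)) := by
  rw [tendsto_iff_norm_sub_tendsto_zero]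
  have key : ∀ u, ‖mulOp (M u) f - mulOp N f‖ ^ 2 = ∫ x, ‖(M u x - N x) (f x)‖ ^ 2 := fun u => by
    rw [HSp_norm_sq]
    refine integral_congr_ae ?_
    filter_upwards [mulOp_coeFn (hM u) f, mulOp_coeFn hN f,
      Lp.coeFn_sub (mulOp (M u) f) (mulOp N f)] with x h1 h2 h3
    rw [h3, Pi.sub_apply, h1, h2, sub_apply]
  have hlim : Tendsto (fun u => ‖mulOp (M u) f - mulOp N f‖ ^ 2) l (𝓝 0) := by
    simp_rw [key]
    have : (0 : ℝ) = ∫ _ : E3, (0 : ℝ) := by simp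
    rw [this]
    refine tendsto_integral_filter_of_dominated_convergence (fun x => C ^ 2 * ‖f x‖ ^ 2)
      (Eventually.of_forall fun u => ?_) ?_ ((HSp_integrable_norm_sq f).const_mul _)
      (ae_of_all _ fun x => ?_)
    · have h1 : AEStronglyMeasurable (fun x => (M u x - N x) (f x)) volume := by
        exact (ContinuousLinearMap.id ℂ SOp).aestronglyMeasurable_comp₂
          ((hM u).1.sub hN.1) (Lp.aestronglyMeasurable f)
      exact h1.norm.pow 2
    · filter_upwards [hC] with u hu
      refine ae_of_all _ fun x => ?_
      rw [Real.norm_of_nonneg (by positivity), ← mul_pow]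
      gcongr
      exact (ContinuousLinearMap.le_opNorm _ _).trans (by gcongr; exact hu x)
    · have h1 : Tendsto (fun u => (M u x - N x) (f x)) l (𝓝 ((N x - N x) (f x))) := by
        exact ((ContinuousLinearMap.apply ℂ Spinor (f x)).continuous.tendsto _).comp
          ((h x).sub_const _)
      have h2 := (h1.norm).pow 2
      simpa using h2
  have h3 := hlim.sqrt
  simp only [Real.sqrt_zero] at h3
  refine h3.congr fun u => ?_
  rw [Real.sqrt_sq (norm_nonneg _)]

/-! ### Fourier multipliers -/

/-- The Fourier transform as a unitary operator. -/
def fourierU : HSp ≃ₗᵢ[ℂ] HSp := Lp.fourierTransformₗᵢ E3 Spinor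

/-- The operator `M(p)`, `p = 2πξ` being the momentum. -/
def fourierMul (M : E3 → SOp) : BOp :=
  (fourierU.symm.toContinuousLinearEquiv : BOp) * mulOp (fun ξ => M ((2 * Real.pi) • ξ)) *
    (fourierU.toContinuousLinearEquiv : BOp)

theorem fourierMul_apply (M : E3 → SOp) (f : HSp) :
    fourierMul M f = fourierU.symm (mulOp (fun ξ => M ((2 * Real.pi) • ξ)) (fourierU f)) := rfl

theorem diracOp_eq (m : ℝ) (f : ℝ → ℂ) :
    diracOp m f = fourierMul fun p => matOp (diracMatFn m f p) := rfl

/-- A bounded measurable matrix-valued function of the momentum. -/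
structure IsSymbol (M : E3 → SOp) : Prop where
  meas : StronglyMeasurable M
  bdd : ∃ C, ∀ p, ‖M p‖ ≤ C

namespace IsSymbol

variable {M N : E3 → SOp}

theorem memLp (hM : IsSymbol M) :
    MemLp (fun ξ : E3 => M ((2 * Real.pi) • ξ)) ⊤ (volume : Measure E3) := by
  obtain ⟨C, hC⟩ := hM.bdd
  exact memLp_symbol ((hM.meas.comp_measurable (measurable_const_smul _)).aestronglyMeasurable)
    fun x => hC _

end IsSymbol

theorem fourierMul_mul {M N : E3 → SOp} (hM : IsSymbol M) (hN : IsSymbol N) :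
    fourierMul M * fourierMul N = fourierMul fun p => M p * N p := by
  ext1 f
  simp only [mul_apply_eq_comp, fourierMul_apply, LinearIsometryEquiv.apply_symm_apply]
  rw [← mulOp_mul hM.memLp hN.memLp]; rfl

theorem fourierMul_add {M N : E3 → SOp} (hM : IsSymbol M) (hN : IsSymbol N) :
    fourierMul (fun p => M p + N p) = fourierMul M + fourierMul N := by
  ext1 f
  simp only [add_apply, fourierMul_apply]
  rw [mulOp_add hM.memLp hN.memLp, add_apply, map_add]

theorem fourierMul_smul {M : E3 → SOp} (hM : IsSymbol M) (c : ℂ) :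
    fourierMul (fun p => c • M p) = c • fourierMul M := by
  ext1 f
  simp only [smul_apply, fourierMul_apply]
  rw [mulOp_smul hM.memLp, smul_apply, map_smul]

theorem fourierMul_one : fourierMul (fun _ => (1 : SOp)) = 1 := by
  ext1 f
  rw [fourierMul_apply, mulOp_one, one_apply_eq_self, LinearIsometryEquiv.symm_apply_apply]
  rfl

theorem norm_fourierMul_le {M : E3 → SOp} {C : ℝ} (hC : 0 ≤ C) (h : ∀ x, ‖M x‖ ≤ C) :
    ‖fourierMul M‖ ≤ C := by
  refine ContinuousLinearMap.opNorm_le_bound _ hC fun f => ?_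
  rw [fourierMul_apply, LinearIsometryEquiv.norm_map]
  refine (ContinuousLinearMap.le_opNorm _ _).trans ?_
  rw [LinearIsometryEquiv.norm_map]
  gcongr
  exact norm_mulOp_le hC fun x => h _

theorem fourierMul_adjoint {M : E3 → SOp} (hM : IsSymbol M) :
    ContinuousLinearMap.adjoint (fourierMul M)
      = fourierMul (fun x => ContinuousLinearMap.adjoint (M x)) := by
  symm
  rw [ContinuousLinearMap.eq_adjoint_iff]
  intro f g
  rw [fourierMul_apply, fourierMul_apply, ← mulOp_adjoint hM.memLp,
    ← LinearIsometryEquiv.inner_map_map fourierU, LinearIsometryEquiv.apply_symm_apply,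
    ContinuousLinearMap.adjoint_inner_left, ← LinearIsometryEquiv.inner_map_map fourierU f,
    LinearIsometryEquiv.apply_symm_apply]

theorem tendsto_fourierMul {X : Type*} {l : Filter X} [l.IsCountablyGenerated]
    {M : X → E3 → SOp} {N : E3 → SOp} {C : ℝ}
    (hM : ∀ u, IsSymbol (M u)) (hN : IsSymbol N)
    (hC : ∀ᶠ u in l, ∀ x, ‖M u x - N x‖ ≤ C)
    (h : ∀ x, Tendsto (fun u => M u x) l (𝓝 (N x))) (f : HSp) :
    Tendsto (fun u => fourierMul (M u) f) l (𝓝 (fourierMul N f)) := by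
  simp only [fourierMul_apply]
  refine (fourierU.symm.continuous.tendsto _).comp ?_
  exact tendsto_mulOp (fun u => (hM u).memLp) hN.memLp
    (hC.mono fun u hu x => hu _) (fun x => h _) _

end DiracEntropy

namespace DiracEntropy
open Filter Topology ENNReal

/-! ### Functions of the Dirac operator -/

theorem omega_ge (m : ℝ) (p : E3) : m ≤ omega m p := by
  rw [omega]
  refine Real.le_sqrt_of_sq_le ?_
  nlinarith [sq_nonneg ‖p‖]

theorem omega_pos {m : ℝ} (hm : 0 < m) (p : E3) : 0 < omega m p := hm.trans_le (omega_ge m p)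

theorem omega_sq (m : ℝ) (p : E3) : omega m p ^ 2 = ‖p‖ ^ 2 + m ^ 2 :=
  Real.sq_sqrt (by positivity)

theorem continuous_omega (m : ℝ) : Continuous (omega m) := by
  unfold omega
  fun_prop

theorem matOp_add (M N : Matrix (Fin 4) (Fin 4) ℂ) : matOp (M + N) = matOp M + matOp N :=
  map_add (Matrix.toEuclideanCLM (𝕜 := ℂ) (n := Fin 4)) M N

theorem matOp_sub (M N : Matrix (Fin 4) (Fin 4) ℂ) : matOp (M - N) = matOp M - matOp N :=
  map_sub (Matrix.toEuclideanCLM (𝕜 := ℂ) (n := Fin 4)) M N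

theorem matOp_smul (c : ℂ) (M : Matrix (Fin 4) (Fin 4) ℂ) : matOp (c • M) = c • matOp M :=
  map_smul (Matrix.toEuclideanCLM (𝕜 := ℂ) (n := Fin 4)) c M

theorem matOp_mul (M N : Matrix (Fin 4) (Fin 4) ℂ) : matOp (M * N) = matOp M * matOp N :=
  map_mul (Matrix.toEuclideanCLM (𝕜 := ℂ) (n := Fin 4)) M N

theorem matOp_one : matOp 1 = 1 := map_one (Matrix.toEuclideanCLM (𝕜 := ℂ) (n := Fin 4))

theorem matOp_adjoint (M : Matrix (Fin 4) (Fin 4) ℂ) :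
    ContinuousLinearMap.adjoint (matOp M) = matOp M.conjTranspose :=
  (map_star (Matrix.toEuclideanCLM (𝕜 := ℂ) (n := Fin 4)) M).symm

theorem continuous_matOp : Continuous matOp :=
  (Matrix.toEuclideanCLM (𝕜 := ℂ) (n := Fin 4)).toAlgEquiv.toLinearMap.continuous_of_finiteDimensional

theorem alphaMat_isHermitian (j : Fin 3) : (alphaMat j).conjTranspose = alphaMat j := by
  ext a b
  fin_cases j <;> fin_cases a <;> fin_cases b <;> simp [alphaMat, Matrix.conjTranspose]

theorem gammaZero_isHermitian : gammaZero.conjTranspose = gammaZero := by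
  ext a b
  fin_cases a <;> fin_cases b <;> simp [gammaZero, Matrix.conjTranspose]

/-- The sign `D(p)/ω(p)` of the Dirac symbol. -/
def diracSign (m : ℝ) (p : E3) : SOp := matOp (((omega m p : ℂ)⁻¹) • diracMat m p)

theorem diracSign_mul_self {m : ℝ} (hm : 0 < m) (p : E3) :
    diracSign m p * diracSign m p = 1 := by
  have h : (omega m p : ℂ) ≠ 0 := by exact_mod_cast (omega_pos hm p).ne'
  rw [diracSign, ← matOp_mul, smul_mul_smul_comm, diracMat_sq, smul_smul, ← matOp_one]
  congr 1
  push_cast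
  field_simp
  simp

theorem diracSign_adjoint (m : ℝ) (p : E3) :
    ContinuousLinearMap.adjoint (diracSign m p) = diracSign m p := by
  rw [diracSign, matOp_adjoint, diracMat]
  simp [Matrix.conjTranspose_sum, alphaMat_isHermitian, gammaZero_isHermitian]

theorem continuous_diracSign {m : ℝ} (hm : 0 < m) : Continuous (diracSign m) := by
  refine continuous_matOp.comp (Continuous.fun_smul ?_ ?_)
  · refine Continuous.inv₀ (Complex.continuous_ofReal.comp (continuous_omega m)) fun p => ?_
    exact_mod_cast (omega_pos hm p).ne'
  · unfold diracMat
    refine Continuous.fun_add (continuous_finsetSum _ fun j _ => ?_) continuous_const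
    exact Continuous.fun_smul (by fun_prop) continuous_const

theorem matOp_diracMatFn (m : ℝ) (f : ℝ → ℂ) (p : E3) :
    matOp (diracMatFn m f p) = (f (omega m p) / 2) • (1 + diracSign m p)
      + (f (-omega m p) / 2) • (1 - diracSign m p) := by
  rw [diracMatFn, matOp_add, matOp_smul, matOp_smul, matOp_add, matOp_sub, matOp_one, diracSign]

/-- Measurable functions which are bounded on the spectrum of `D`. -/
structure IsSpecFn (m : ℝ) (f : ℝ → ℂ) : Prop where
  meas : Measurable f
  bdd : ∃ C, ∀ x, m ≤ |x| → ‖f x‖ ≤ C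

section
variable {m : ℝ} {f g : ℝ → ℂ}

/-- D(p)/ω(p) is a self-adjoint involution, so every spinor splits orthogonally into eigenvectors on
which f(D(p)) is multiplication by f(±ω(p)). Pythagoras then gives the sharp constant, the supremum
of |f| on the spectrum. Sharpness matters because the Fermi factors must be contractions. -/
theorem norm_matOp_diracMatFn_le (hm : 0 < m) {C : ℝ} (hC : ∀ x, m ≤ |x| → ‖f x‖ ≤ C) (p : E3) :
    ‖matOp (diracMatFn m f p)‖ ≤ C := by
  have hω := omega_ge m p
  have h1 : ‖f (omega m p)‖ ≤ C := hC _ (hω.trans (le_abs_self _))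
  have h2 : ‖f (-omega m p)‖ ≤ C := hC _ (hω.trans (by rw [abs_neg]; exact le_abs_self _))
  have hC0 : 0 ≤ C := (norm_nonneg _).trans h1
  refine ContinuousLinearMap.opNorm_le_bound _ hC0 fun v => ?_
  set Q := diracSign m p with hQ
  have hQQ : ∀ w, Q (Q w) = w := fun w => by
    have := congrArg (fun T : SOp => T w) (diracSign_mul_self hm p)
    exact this
  have hadj : ∀ x y : Spinor, inner ℂ (Q x) y = inner ℂ x (Q y) := fun x y => by
    conv_lhs => rw [hQ, ← diracSign_adjoint, ContinuousLinearMap.adjoint_inner_left]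
  set a := (1 / 2 : ℂ) • (v + Q v) with ha
  set b := (1 / 2 : ℂ) • (v - Q v) with hb
  have hab : inner ℂ a b = 0 := by
    rw [ha, hb, inner_smul_left, inner_smul_right, inner_add_left, inner_sub_right, inner_sub_right,
      hadj v v, hadj v (Q v), hQQ]
    ring
  have hv : v = a + b := by rw [ha, hb]; module
  have hval : matOp (diracMatFn m f p) v = f (omega m p) • a + f (-omega m p) • b := by
    rw [matOp_diracMatFn, ha, hb, ← hQ]
    simp only [add_apply, smul_apply, sub_apply, one_apply_eq_self]
    module
  have hab2 : inner ℂ (f (omega m p) • a) (f (-omega m p) • b) = 0 := by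
    rw [inner_smul_left, inner_smul_right, hab]; ring
  have e1 : ‖v‖ * ‖v‖ = ‖a‖ * ‖a‖ + ‖b‖ * ‖b‖ := by
    conv_lhs => rw [hv]
    exact norm_add_sq_eq_norm_sq_add_norm_sq_of_inner_eq_zero a b hab
  have e2 := norm_add_sq_eq_norm_sq_add_norm_sq_of_inner_eq_zero _ _ hab2
  rw [hval]
  refine abs_le_of_sq_le_sq' ?_ (by positivity) |>.2
  rw [sq, e2, mul_pow, sq ‖v‖, e1, norm_smul _ a, norm_smul _ b]
  clear_value a b
  have h3 : ‖f (omega m p)‖ ^ 2 ≤ C ^ 2 := by gcongr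
  have h4 : ‖f (-omega m p)‖ ^ 2 ≤ C ^ 2 := by gcongr
  nlinarith [mul_nonneg (sub_nonneg.2 h3) (sq_nonneg ‖a‖),
    mul_nonneg (sub_nonneg.2 h4) (sq_nonneg ‖b‖)]

theorem isSymbol_diracMatFn (hm : 0 < m) (hf : IsSpecFn m f) :
    IsSymbol fun p => matOp (diracMatFn m f p) := by
  obtain ⟨C, hC⟩ := hf.bdd
  refine ⟨?_, C, norm_matOp_diracMatFn_le hm hC⟩
  simp_rw [matOp_diracMatFn]
  have h1 := (continuous_diracSign hm)
  have h2 := (continuous_omega m).measurable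
  refine StronglyMeasurable.fun_add (StronglyMeasurable.fun_smul ?_ ?_) (StronglyMeasurable.fun_smul ?_ ?_)
  · exact ((hf.meas.comp h2).div_const 2).stronglyMeasurable
  · exact (continuous_const.add h1).stronglyMeasurable
  · exact ((hf.meas.comp h2.neg).div_const 2).stronglyMeasurable
  · exact (continuous_const.sub h1).stronglyMeasurable

/-- The mass gap: ω(p) ≥ m, so values on (-m, m) are irrelevant. This is what permits division by
powers of `x` below. -/
theorem diracOp_congr (h : ∀ x, m ≤ |x| → f x = g x) : diracOp m f = diracOp m g := by
  rw [diracOp_eq, diracOp_eq]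
  congr 1
  ext1 p
  have hω := omega_ge m p
  rw [matOp_diracMatFn, matOp_diracMatFn, h _ (hω.trans (le_abs_self _)),
    h (-omega m p) (hω.trans (by rw [abs_neg]; exact le_abs_self _))]

theorem norm_diracOp_le (hm : 0 < m) {C : ℝ} (hC : ∀ x, m ≤ |x| → ‖f x‖ ≤ C) :
    ‖diracOp m f‖ ≤ C := by
  have hC0 : 0 ≤ C := (norm_nonneg _).trans (hC m (le_abs_self m))
  rw [diracOp_eq]
  exact norm_fourierMul_le hC0 (norm_matOp_diracMatFn_le hm hC)

namespace IsSpecFn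

theorem mul (hf : IsSpecFn m f) (hg : IsSpecFn m g) : IsSpecFn m fun x => f x * g x := by
  obtain ⟨C, hC⟩ := hf.bdd
  obtain ⟨C', hC'⟩ := hg.bdd
  exact ⟨hf.meas.mul hg.meas, C * C', fun p hp => (norm_mul_le _ _).trans
    (mul_le_mul (hC p hp) (hC' p hp) (norm_nonneg _) ((norm_nonneg _).trans (hC p hp)))⟩

theorem add (hf : IsSpecFn m f) (hg : IsSpecFn m g) : IsSpecFn m fun x => f x + g x := by
  obtain ⟨C, hC⟩ := hf.bdd
  obtain ⟨C', hC'⟩ := hg.bdd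
  exact ⟨hf.meas.add hg.meas, C + C', fun p hp => norm_add_le_of_le (hC p hp) (hC' p hp)⟩

theorem const_smul (hf : IsSpecFn m f) (c : ℂ) : IsSpecFn m fun x => c * f x := by
  obtain ⟨C, hC⟩ := hf.bdd
  refine ⟨hf.meas.const_mul c, ‖c‖ * C, fun p hp => ?_⟩
  rw [norm_mul]
  exact mul_le_mul_of_nonneg_left (hC p hp) (norm_nonneg _)

end IsSpecFn

theorem diracOp_mul (hm : 0 < m) (hf : IsSpecFn m f) (hg : IsSpecFn m g) :
    diracOp m f * diracOp m g = diracOp m fun x => f x * g x := by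
  rw [diracOp_eq, diracOp_eq, diracOp_eq,
    fourierMul_mul (isSymbol_diracMatFn hm hf) (isSymbol_diracMatFn hm hg)]
  congr 1
  ext1 p
  have h := diracSign_mul_self hm p
  rw [matOp_diracMatFn, matOp_diracMatFn, matOp_diracMatFn]
  simp only [add_mul, mul_add, smul_mul_smul_comm, sub_mul, mul_sub, h, mul_one, one_mul]
  module

theorem diracOp_comm (hm : 0 < m) (hf : IsSpecFn m f) (hg : IsSpecFn m g) :
    diracOp m f * diracOp m g = diracOp m g * diracOp m f := by
  rw [diracOp_mul hm hf hg, diracOp_mul hm hg hf]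
  simp_rw [mul_comm]

theorem diracOp_add (hm : 0 < m) (hf : IsSpecFn m f) (hg : IsSpecFn m g) :
    diracOp m (fun x => f x + g x) = diracOp m f + diracOp m g := by
  rw [diracOp_eq, diracOp_eq, diracOp_eq,
    ← fourierMul_add (isSymbol_diracMatFn hm hf) (isSymbol_diracMatFn hm hg)]
  congr 1
  ext1 p
  simp only [matOp_diracMatFn]
  module

theorem diracOp_const_mul (hm : 0 < m) (hf : IsSpecFn m f) (c : ℂ) :
    diracOp m (fun x => c * f x) = c • diracOp m f := by
  rw [diracOp_eq, diracOp_eq, ← fourierMul_smul (isSymbol_diracMatFn hm hf)]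
  congr 1
  ext1 p
  simp only [matOp_diracMatFn]
  module

theorem diracOp_sub (hm : 0 < m) (hf : IsSpecFn m f) (hg : IsSpecFn m g) :
    diracOp m (fun x => f x - g x) = diracOp m f - diracOp m g := by
  have h := diracOp_add hm hf (hg.const_smul (-1))
  rw [diracOp_const_mul hm hg] at h
  simpa [sub_eq_add_neg] using h

theorem diracOp_one (m : ℝ) : diracOp m (fun _ => 1) = 1 := by
  rw [diracOp_eq, ← fourierMul_one]
  congr 1
  ext1 p
  rw [matOp_diracMatFn]
  ext1 v
  simp only [add_apply, smul_apply, sub_apply, one_apply_eq_self]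
  module

theorem diracOp_adjoint (hm : 0 < m) (hf : IsSpecFn m f) :
    ContinuousLinearMap.adjoint (diracOp m f) = diracOp m fun x => starRingEnd ℂ (f x) := by
  rw [diracOp_eq, diracOp_eq, fourierMul_adjoint (isSymbol_diracMatFn hm hf)]
  congr 1
  ext1 p
  rw [matOp_diracMatFn, matOp_diracMatFn]
  have h1 : ContinuousLinearMap.adjoint (1 : SOp) = 1 := star_one SOp
  simp only [map_add, map_sub, map_smulₛₗ, diracSign_adjoint, h1, map_div₀, Complex.conj_ofNat]

theorem tendsto_diracOp (hm : 0 < m) {X : Type*} {l : Filter X} [l.IsCountablyGenerated]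
    {F : X → ℝ → ℂ} {C : ℝ} (hF : ∀ u, IsSpecFn m (F u)) (hf : IsSpecFn m f)
    (hC : ∀ᶠ u in l, ∀ x, m ≤ |x| → ‖F u x‖ ≤ C)
    (h : ∀ x, m ≤ |x| → Tendsto (fun u => F u x) l (𝓝 (f x))) (v : HSp) :
    Tendsto (fun u => diracOp m (F u) v) l (𝓝 (diracOp m f v)) := by
  obtain ⟨C', hC'⟩ := hf.bdd
  simp only [diracOp_eq]
  refine tendsto_fourierMul (C := C + C') (fun u => isSymbol_diracMatFn hm (hF u))
    (isSymbol_diracMatFn hm hf) (hC.mono fun u hu p => ?_) (fun p => ?_) v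
  · exact norm_sub_le_of_le (norm_matOp_diracMatFn_le hm hu p) (norm_matOp_diracMatFn_le hm hC' p)
  · simp only [matOp_diracMatFn]
    have hω := omega_ge m p
    have h1 := h _ (hω.trans (le_abs_self _))
    have h2 := h (-omega m p) (hω.trans (by rw [abs_neg]; exact le_abs_self _))
    exact ((h1.div_const 2).smul_const _).add ((h2.div_const 2).smul_const _)

theorem continuous_diracOp (hm : 0 < m) {X : Type*} [TopologicalSpace X] [FirstCountableTopology X]
    {F : X → ℝ → ℂ} {C : ℝ} (hF : ∀ u, Measurable (F u))
    (hC : ∀ u, ∀ x, m ≤ |x| → ‖F u x‖ ≤ C)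
    (h : ∀ x, m ≤ |x| → Continuous fun u => F u x) (v : HSp) :
    Continuous fun u => diracOp m (F u) v := by
  refine continuous_iff_continuousAt.2 fun u => ?_
  exact tendsto_diracOp hm (fun u => ⟨hF u, C, hC u⟩) ⟨hF u, C, hC u⟩
    (Eventually.of_forall hC) (fun x hx => (h x hx).continuousAt) v

/-- Differentiation of `diracOp m (F t)` in operator norm. -/
theorem hasDerivAt_diracOp (hm : 0 < m) {F : ℝ → ℝ → ℂ} {F' : ℝ → ℂ} {t C δ : ℝ} (hδ : 0 < δ)
    (hF : ∀ u, IsSpecFn m (F u)) (hF' : IsSpecFn m F')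
    (h : ∀ u, |u - t| < δ → ∀ x, m ≤ |x| → ‖F u x - F t x - (u - t) * F' x‖ ≤ C * (u - t) ^ 2) :
    HasDerivAt (fun u => diracOp m (F u)) (diracOp m F') t := by
  rw [hasDerivAt_iff_isLittleO]
  have hO : (fun u => diracOp m (F u) - diracOp m (F t) - (u - t) • diracOp m F')
      =O[𝓝 t] fun u => (u - t) ^ 2 := by
    refine Asymptotics.IsBigO.of_bound C ?_
    filter_upwards [Metric.ball_mem_nhds t hδ] with u hu
    have hu' : |u - t| < δ := by simpa [Real.dist_eq] using hu
    have e : diracOp m (F u) - diracOp m (F t) - (u - t) • diracOp m F'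
        = diracOp m fun x => F u x - F t x - (u - t) * F' x := by
      have hs : IsSpecFn m (fun x => F u x - F t x) := by
        simpa [sub_eq_add_neg] using (hF u).add ((hF t).const_smul (-1))
      rw [diracOp_sub hm hs (hF'.const_smul ((u : ℂ) - t)), diracOp_sub hm (hF u) (hF t),
        diracOp_const_mul hm hF']
      congr 1
      have : ((u : ℂ) - t) = ((u - t : ℝ) : ℂ) := by push_cast; rfl
      rw [this]; rfl
    rw [e, Real.norm_of_nonneg (sq_nonneg (u - t))]
    exact norm_diracOp_le hm (h u hu')
  refine hO.trans_isLittleO ?_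
  have h2 : Tendsto (fun u => u - t) (𝓝 t) (𝓝 0) := by
    have : Tendsto (fun u => u - t) (𝓝 t) (𝓝 (t - t)) := (continuous_id.sub continuous_const).tendsto t
    simpa using this
  exact (Asymptotics.isLittleO_pow_id (n := 2) one_lt_two).comp_tendsto h2

end

/-! ### The free evolution -/

section
variable {m : ℝ}

theorem norm_exp_I_mul (t x : ℝ) : ‖Complex.exp (Complex.I * t * x)‖ = 1 := by
  rw [show Complex.I * t * x = ((t * x : ℝ) : ℂ) * Complex.I by push_cast; ring]
  exact Complex.norm_exp_ofReal_mul_I _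

theorem isSpecFn_freeEvol (m t : ℝ) : IsSpecFn m fun x => Complex.exp (Complex.I * t * x) :=
  ⟨by fun_prop, 1, fun x _ => (norm_exp_I_mul t x).le⟩

theorem freeEvol_add (hm : 0 < m) (s t : ℝ) : freeEvol m (s + t) = freeEvol m s * freeEvol m t := by
  rw [freeEvol, freeEvol, freeEvol, diracOp_mul hm (isSpecFn_freeEvol m s) (isSpecFn_freeEvol m t)]
  refine diracOp_congr fun x _ => ?_
  rw [← Complex.exp_add]
  congr 1
  push_cast
  ring

theorem freeEvol_zero (m : ℝ) : freeEvol m 0 = 1 := by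
  rw [freeEvol, ← diracOp_one m]; congr 1; ext x; simp

theorem freeEvol_mul_neg (hm : 0 < m) (t : ℝ) : freeEvol m t * freeEvol m (-t) = 1 := by
  rw [← freeEvol_add hm, add_neg_cancel, freeEvol_zero]

theorem freeEvol_neg_mul (hm : 0 < m) (t : ℝ) : freeEvol m (-t) * freeEvol m t = 1 := by
  rw [← freeEvol_add hm, neg_add_cancel, freeEvol_zero]

theorem freeEvol_adjoint (hm : 0 < m) (t : ℝ) :
    ContinuousLinearMap.adjoint (freeEvol m t) = freeEvol m (-t) := by
  rw [freeEvol, freeEvol, diracOp_adjoint hm (isSpecFn_freeEvol m t)]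
  refine diracOp_congr fun x _ => ?_
  rw [← Complex.exp_conj]
  congr 1
  simp

theorem norm_freeEvol_le (hm : 0 < m) (t : ℝ) : ‖freeEvol m t‖ ≤ 1 :=
  norm_diracOp_le hm fun x _ => (norm_exp_I_mul t x).le

theorem continuous_freeEvol_apply (hm : 0 < m) (v : HSp) : Continuous fun t => freeEvol m t v :=
  continuous_diracOp hm (fun t => (isSpecFn_freeEvol m t).meas)
    (fun t x _ => (norm_exp_I_mul t x).le) (fun x _ => by fun_prop) v

end

end DiracEntropy

namespace DiracEntropy
open Filter Topology

/-! ### Trace norm and Hilbert–Schmidt norm bounds -/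

section TraceNorm
variable {V : Type} [NormedAddCommGroup V] [InnerProductSpace ℂ V]

/-- Finite families satisfying Bessel's inequality. -/
def IsBessel {ι : Type} (s : Finset ι) (x : ι → V) : Prop :=
  ∀ v, ∑ i ∈ s, ‖inner ℂ (x i) v‖ ^ 2 ≤ ‖v‖ ^ 2

/-- The trace norm of `S` is at most `C`. -/
def TraceNormLe (S : V →L[ℂ] V) (C : ℝ) : Prop :=
  ∀ (ι : Type) (s : Finset ι) (x y : ι → V), IsBessel s x → IsBessel s y →
    ∑ i ∈ s, ‖inner ℂ (x i) (S (y i))‖ ≤ C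

/-- The Hilbert–Schmidt norm of `S` is at most `C`. -/
def HSNormLe (S : V →L[ℂ] V) (C : ℝ) : Prop :=
  0 ≤ C ∧ ∀ (ι : Type) (s : Finset ι) (x : ι → V), IsBessel s x → ∑ i ∈ s, ‖S (x i)‖ ^ 2 ≤ C ^ 2

theorem Orthonormal.isBessel {ι : Type} {x : ι → V} (hx : Orthonormal ℂ x) (s : Finset ι) :
    IsBessel s x := fun v => hx.sum_inner_products_le v

/-- Invariance under contractions is the reason for using Bessel families in place of orthonormal
ones: it makes the ideal property of the trace norm immediate. -/
theorem IsBessel.map [CompleteSpace V] {ι : Type} {s : Finset ι} {x : ι → V} (hx : IsBessel s x)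
    {A : V →L[ℂ] V} (hA : ‖A‖ ≤ 1) : IsBessel s fun i => A (x i) := fun v => by
  simp_rw [← ContinuousLinearMap.adjoint_inner_right]
  refine (hx _).trans ?_
  have : ‖ContinuousLinearMap.adjoint A v‖ ≤ 1 * ‖v‖ := by
    refine (ContinuousLinearMap.le_opNorm _ _).trans ?_
    gcongr
    rw [LinearIsometryEquiv.norm_map]
    exact hA
  rw [one_mul] at this
  gcongr

namespace TraceNormLe

variable {S T : V →L[ℂ] V} {C D a : ℝ}

theorem nonneg (h : TraceNormLe S C) : 0 ≤ C := by
  have := h ℕ ∅ 0 0 (fun v => by simp) (fun v => by simp)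
  simpa using this

theorem mono (h : TraceNormLe S C) (hCD : C ≤ D) : TraceNormLe S D :=
  fun ι s x y hx hy => (h ι s x y hx hy).trans hCD

theorem zero (hC : 0 ≤ C) : TraceNormLe (0 : V →L[ℂ] V) C := fun ι s x y _ _ => by simpa using hC

theorem add (hS : TraceNormLe S C) (hT : TraceNormLe T D) : TraceNormLe (S + T) (C + D) :=
  fun ι s x y hx hy => by
    refine le_trans ?_ (add_le_add (hS ι s x y hx hy) (hT ι s x y hx hy))
    rw [← Finset.sum_add_distrib]
    refine Finset.sum_le_sum fun i _ => ?_
    rw [add_apply, inner_add_right]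
    exact norm_add_le _ _

theorem smul (hS : TraceNormLe S C) (c : ℂ) : TraceNormLe (c • S) (‖c‖ * C) :=
  fun ι s x y hx hy => by
    refine le_trans (le_of_eq ?_) (mul_le_mul_of_nonneg_left (hS ι s x y hx hy) (norm_nonneg c))
    rw [Finset.mul_sum]
    refine Finset.sum_congr rfl fun i _ => ?_
    rw [smul_apply, inner_smul_right, norm_mul]

theorem neg (hS : TraceNormLe S C) : TraceNormLe (-S) C := by
  simpa using hS.smul (-1)

theorem sub (hS : TraceNormLe S C) (hT : TraceNormLe T D) : TraceNormLe (S - T) (C + D) := by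
  rw [sub_eq_add_neg]; exact hS.add hT.neg

theorem sum {ι : Type} (s : Finset ι) {S : ι → V →L[ℂ] V} {C : ι → ℝ}
    (h : ∀ i ∈ s, TraceNormLe (S i) (C i)) : TraceNormLe (∑ i ∈ s, S i) (∑ i ∈ s, C i) := by
  classical
  induction s using Finset.induction_on with
  | empty => simpa using zero le_rfl
  | insert i s hi ih =>
    rw [Finset.sum_insert hi, Finset.sum_insert hi]
    exact (h i (Finset.mem_insert_self _ _)).add
      (ih fun j hj => h j (Finset.mem_insert_of_mem hj))

/-- Lower semicontinuity under weak convergence: only finitely many matrix elements enter each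
inequality. -/
theorem of_tendsto {X : Type*} {l : Filter X} [l.NeBot] {F : X → V →L[ℂ] V} {c : X → ℝ}
    (h : ∀ᶠ u in l, TraceNormLe (F u) (c u))
    (hS : ∀ x y, Tendsto (fun u => inner ℂ x (F u y)) l (𝓝 (inner ℂ x (S y))))
    (hc : Tendsto c l (𝓝 C)) : TraceNormLe S C := fun ι s x y hx hy => by
  refine le_of_tendsto_of_tendsto (tendsto_finsetSum s fun i _ => (hS (x i) (y i)).norm) hc ?_
  filter_upwards [h] with u hu
  exact hu ι s x y hx hy

/-- Minkowski's inequality for weak integrals. Working with finite sums of matrix elements avoids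
any measurability question for the trace norm itself. -/
theorem of_integral {X : Type*} [MeasurableSpace X] {μ : Measure X} {F : X → V →L[ℂ] V} {c : X → ℝ}
    (h : ∀ᵐ u ∂μ, TraceNormLe (F u) (c u)) (hc : Integrable c μ)
    (hF : ∀ x y, Integrable (fun u => inner ℂ x (F u y)) μ)
    (hS : ∀ x y, inner ℂ x (S y) = ∫ u, inner ℂ x (F u y) ∂μ) :
    TraceNormLe S (∫ u, c u ∂μ) := fun ι s x y hx hy => by
  calc ∑ i ∈ s, ‖inner ℂ (x i) (S (y i))‖
      ≤ ∑ i ∈ s, ∫ u, ‖inner ℂ (x i) (F u (y i))‖ ∂μ := by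
        refine Finset.sum_le_sum fun i _ => ?_
        rw [hS]
        exact norm_integral_le_integral_norm _
    _ = ∫ u, ∑ i ∈ s, ‖inner ℂ (x i) (F u (y i))‖ ∂μ :=
        (integral_finsetSum _ fun i _ => (hF _ _).norm).symm
    _ ≤ ∫ u, c u ∂μ := by
        refine integral_mono_ae (integrable_finsetSum _ fun i _ => (hF _ _).norm) hc ?_
        filter_upwards [h] with u hu
        exact hu ι s x y hx hy

/-- For a > 0 the operator T/a is a contraction, so the vectors (T/a) yᵢ again form a Bessel family.
-/
theorem mul_right [CompleteSpace V] (hS : TraceNormLe S C) (hT : ‖T‖ ≤ a) :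
    TraceNormLe (S * T) (C * a) := fun ι s x y hx hy => by
  rcases (norm_nonneg T |>.trans hT).eq_or_lt' with ha | ha
  · have : T = 0 := norm_le_zero_iff.1 (ha ▸ hT)
    simp [this, ha]
  · have h1 : ‖((a : ℂ)⁻¹) • T‖ ≤ 1 := by
      rw [norm_smul, norm_inv, Complex.norm_of_nonneg ha.le, inv_mul_le_one₀ ha]
      exact hT
    have h2 := hS ι s x _ hx (hy.map h1)
    have h3 : ∀ i, ‖inner ℂ (x i) ((S * T) (y i))‖
        = ‖inner ℂ (x i) (S ((((a : ℂ)⁻¹) • T) (y i)))‖ * a := fun i => by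
      rw [smul_apply, map_smul, inner_smul_right, norm_mul, norm_inv, Complex.norm_of_nonneg ha.le,
        mul_apply_eq_comp]
      field_simp
    simp_rw [h3, ← Finset.sum_mul]
    gcongr

theorem adjoint [CompleteSpace V] (hS : TraceNormLe S C) :
    TraceNormLe (ContinuousLinearMap.adjoint S) C := fun ι s x y hx hy => by
  refine le_trans (le_of_eq (Finset.sum_congr rfl fun i _ => ?_)) (hS ι s y x hy hx)
  rw [ContinuousLinearMap.adjoint_inner_right, ← inner_conj_symm, RCLike.norm_conj]

theorem mul_left [CompleteSpace V] (hS : TraceNormLe S C) (hT : ‖T‖ ≤ a) :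
    TraceNormLe (T * S) (a * C) := by
  have h := (hS.adjoint.mul_right (T := ContinuousLinearMap.adjoint T) (a := a)
    (by rwa [LinearIsometryEquiv.norm_map])).adjoint
  have e : ContinuousLinearMap.adjoint (ContinuousLinearMap.adjoint S *
      ContinuousLinearMap.adjoint T) = T * S := by
    have := star_mul (star S) (star T)
    rw [star_star, star_star] at this
    exact this
  rw [e, mul_comm] at h
  exact h

end TraceNormLe

namespace HSNormLe

variable {S T : V →L[ℂ] V} {C D a : ℝ}

theorem mul_left (hS : HSNormLe S C) (hT : ‖T‖ ≤ a) : HSNormLe (T * S) (a * C) := by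
  have ha := (norm_nonneg T).trans hT
  refine ⟨mul_nonneg ha hS.1, fun ι s x hx => ?_⟩
  rw [mul_pow]
  refine le_trans ?_ (mul_le_mul_of_nonneg_left (hS.2 ι s x hx) (sq_nonneg a))
  rw [Finset.mul_sum]
  refine Finset.sum_le_sum fun i _ => ?_
  rw [← mul_pow]
  gcongr
  rw [mul_apply_eq_comp]
  exact (ContinuousLinearMap.le_opNorm _ _).trans (by gcongr)

theorem add (hS : HSNormLe S C) (hT : HSNormLe T D) : HSNormLe (S + T) (C + D) := by
  refine ⟨add_nonneg hS.1 hT.1, fun ι s x hx => ?_⟩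
  have h1 := hS.2 ι s x hx
  have h2 := hT.2 ι s x hx
  have h3 : ∑ i ∈ s, ‖S (x i)‖ * ‖T (x i)‖ ≤ C * D := by
    have := Finset.sum_mul_sq_le_sq_mul_sq s (fun i => ‖S (x i)‖) (fun i => ‖T (x i)‖)
    refine abs_le_of_sq_le_sq' ?_ (mul_nonneg hS.1 hT.1) |>.2
    rw [mul_pow]
    exact this.trans (mul_le_mul h1 h2 (by positivity) (sq_nonneg _))
  calc ∑ i ∈ s, ‖(S + T) (x i)‖ ^ 2
      ≤ ∑ i ∈ s, (‖S (x i)‖ ^ 2 + 2 * (‖S (x i)‖ * ‖T (x i)‖) + ‖T (x i)‖ ^ 2) := by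
        refine Finset.sum_le_sum fun i _ => ?_
        rw [add_apply]
        have := norm_add_le (S (x i)) (T (x i))
        nlinarith [norm_nonneg (S (x i) + T (x i)), norm_nonneg (S (x i)), norm_nonneg (T (x i))]
    _ ≤ (C + D) ^ 2 := by
        rw [Finset.sum_add_distrib, Finset.sum_add_distrib, ← Finset.mul_sum]
        nlinarith

theorem smul (hS : HSNormLe S C) (c : ℂ) : HSNormLe (c • S) (‖c‖ * C) := by
  refine ⟨mul_nonneg (norm_nonneg _) hS.1, fun ι s x hx => ?_⟩
  rw [mul_pow]
  refine le_trans (le_of_eq ?_) (mul_le_mul_of_nonneg_left (hS.2 ι s x hx) (sq_nonneg ‖c‖))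
  rw [Finset.mul_sum]
  refine Finset.sum_congr rfl fun i _ => ?_
  rw [smul_apply, norm_smul, mul_pow]

theorem zero : HSNormLe (0 : V →L[ℂ] V) 0 := ⟨le_rfl, fun ι s x _ => by simp⟩

theorem sum {ι : Type} (s : Finset ι) {S : ι → V →L[ℂ] V} {C : ι → ℝ}
    (h : ∀ i ∈ s, HSNormLe (S i) (C i)) : HSNormLe (∑ i ∈ s, S i) (∑ i ∈ s, C i) := by
  classical
  induction s using Finset.induction_on with
  | empty => simpa using zero
  | insert i s hi ih =>
    rw [Finset.sum_insert hi, Finset.sum_insert hi]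
    exact (h i (Finset.mem_insert_self _ _)).add
      (ih fun j hj => h j (Finset.mem_insert_of_mem hj))

theorem hasSum_norm_inner_sq [CompleteSpace V] {ι : Type} (b : HilbertBasis ι ℂ V) (v : V) :
    HasSum (fun i => ‖inner ℂ (b i) v‖ ^ 2) (‖v‖ ^ 2) := by
  have h := b.hasSum_inner_mul_inner v v
  have h2 : ∀ i, inner ℂ v (b i) * inner ℂ (b i) v = ((‖inner ℂ (b i) v‖ ^ 2 : ℝ) : ℂ) := fun i => by
    rw [← inner_conj_symm, RCLike.conj_mul]
    push_cast; rfl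
  simp_rw [h2, inner_self_eq_norm_sq_to_K] at h
  have h3 : (((‖v‖ : ℝ) : ℂ)) ^ 2 = ((‖v‖ ^ 2 : ℝ) : ℂ) := (Complex.ofReal_pow _ _).symm
  exact Complex.hasSum_ofReal.1 (h3 ▸ h)

/-- Expand S* xᵢ in a Hilbert basis b. After exchanging the sums, Bessel's inequality for x bounds
the j-th term by ‖S bⱼ‖², and b itself is a Bessel family. -/
theorem adjoint [CompleteSpace V] (hS : HSNormLe S C) :
    HSNormLe (ContinuousLinearMap.adjoint S) C := by
  refine ⟨hS.1, fun ι s x hx => ?_⟩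
  obtain ⟨w, b, -⟩ := exists_hilbertBasis ℂ V
  have h : HasSum (fun j => ∑ i ∈ s, ‖inner ℂ (b j) (ContinuousLinearMap.adjoint S (x i))‖ ^ 2)
      (∑ i ∈ s, ‖ContinuousLinearMap.adjoint S (x i)‖ ^ 2) :=
    hasSum_sum fun i _ => hasSum_norm_inner_sq b _
  refine hasSum_le_of_sum_le h fun t => ?_
  refine le_trans (Finset.sum_le_sum fun j _ => ?_) (hS.2 w t b (Orthonormal.isBessel b.orthonormal t))
  simp_rw [ContinuousLinearMap.adjoint_inner_right]
  refine le_trans (le_of_eq (Finset.sum_congr rfl fun i _ => ?_)) (hx (S (b j)))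
  rw [← inner_conj_symm, RCLike.norm_conj]

theorem mul_right [CompleteSpace V] (hS : HSNormLe S C) (hT : ‖T‖ ≤ a) :
    HSNormLe (S * T) (C * a) := by
  have h := (hS.adjoint.mul_left (T := ContinuousLinearMap.adjoint T) (a := a)
    (by rwa [LinearIsometryEquiv.norm_map])).adjoint
  have e : ContinuousLinearMap.adjoint (ContinuousLinearMap.adjoint T *
      ContinuousLinearMap.adjoint S) = S * T := by
    have := star_mul (star T) (star S)
    rw [star_star, star_star] at this
    exact this
  rw [e, mul_comm] at h
  exact h

/-- Write ⟨x, STy⟩ = ⟨S*x, Ty⟩ and apply Cauchy–Schwarz, first to the vectors and then to the sum.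
-/
theorem mul [CompleteSpace V] (hS : HSNormLe S C) (hT : HSNormLe T D) :
    TraceNormLe (S * T) (C * D) := fun ι s x y hx hy => by
  have h1 := hS.adjoint.2 ι s x hx
  have h2 := hT.2 ι s y hy
  have := Finset.sum_mul_sq_le_sq_mul_sq s (fun i => ‖ContinuousLinearMap.adjoint S (x i)‖)
    (fun i => ‖T (y i)‖)
  refine le_trans (Finset.sum_le_sum fun i _ => ?_) (abs_le_of_sq_le_sq' (this.trans (b := _) ?_)
    (mul_nonneg hS.1 hT.1) |>.2)
  · rw [mul_apply_eq_comp, ← ContinuousLinearMap.adjoint_inner_left]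
    exact norm_inner_le_norm _ _
  · rw [mul_pow]
    exact mul_le_mul h1 h2 (by positivity) (sq_nonneg _)

end HSNormLe

/-- The diagonal of `S` in every Hilbert basis sums to `τ`. -/
def HasTrace (S : V →L[ℂ] V) (τ : ℂ) : Prop :=
  ∀ (ι : Type) (e : HilbertBasis ι ℂ V), HasSum (fun i => inner ℂ (e i) (S (e i))) τ

theorem HasTrace.add {S T : V →L[ℂ] V} {τ τ' : ℂ} (hS : HasTrace S τ) (hT : HasTrace T τ') :
    HasTrace (S + T) (τ + τ') := fun ι e => by
  simpa only [add_apply, inner_add_right] using (hS ι e).add (hT ι e)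

theorem HasTrace.smul {S : V →L[ℂ] V} {τ : ℂ} (hS : HasTrace S τ) (c : ℂ) : HasTrace (c • S) (c * τ) := fun ι e => by
  simpa only [smul_apply, inner_smul_right] using (hS ι e).mul_left c

end TraceNorm

/-! ### Trace class operators -/

section TraceClass
variable {V : Type} [NormedAddCommGroup V] [InnerProductSpace ℂ V] [CompleteSpace V]
  {S : V →L[ℂ] V} {C : ℝ}

/-- A substitute for the polar decomposition: U = (|S| + δ)⁻¹ S* satisfies US = (|S| + δ)⁻¹|S|²,
which differs from |S| by δ|S|(|S| + δ)⁻¹. -/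
theorem exists_abs_approx (S : V →L[ℂ] V) {δ : ℝ} (hδ : 0 < δ) :
    ∃ U : V →L[ℂ] V, ‖U‖ ≤ 1 ∧ ‖U * S - CFC.abs S‖ ≤ δ := by
  set a := CFC.abs S with ha
  have ha0 : 0 ≤ a := CFC.abs_nonneg S
  have hsa : IsSelfAdjoint a := ha0.isSelfAdjoint
  have haa : a * a = star S * S := CFC.abs_mul_abs S
  have hcont : Continuous fun x : ℝ => (|x| + δ)⁻¹ :=
    (continuous_abs.add continuous_const).inv₀ fun x =>
      (add_pos_of_nonneg_of_pos (abs_nonneg x) hδ).ne'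
  set r := cfc (fun x : ℝ => (|x| + δ)⁻¹) a with hr
  have hrsa : IsSelfAdjoint r := cfc_predicate _ a
  have hra : r * a = cfc (fun x : ℝ => (|x| + δ)⁻¹ * x) a := by
    rw [cfc_mul (fun x : ℝ => (|x| + δ)⁻¹) (fun x => x) a
      hcont.continuousOn continuousOn_id, cfc_id' ℝ a]
  have hra1 : ‖r * a‖ ≤ 1 := by
    rw [hra]
    refine norm_cfc_le zero_le_one fun x _ => ?_
    rw [norm_mul, norm_inv, Real.norm_eq_abs, Real.norm_eq_abs, abs_of_nonneg (by positivity),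
      inv_mul_le_one₀ (by positivity)]
    linarith
  refine ⟨r * star S, ?_, ?_⟩
  -- By the C*-identity, both sides are the norm of r S*S r, since S*S = |S|².
  · have h1 : ‖r * star S‖ * ‖r * star S‖ = ‖r * a‖ * ‖r * a‖ := by
      rw [← CStarRing.norm_self_mul_star, ← CStarRing.norm_self_mul_star, star_mul, star_mul,
        star_star, hrsa.star_eq, hsa.star_eq, mul_assoc, mul_assoc, ← mul_assoc (star S),
        ← mul_assoc a, haa]
    nlinarith [norm_nonneg (r * star S), norm_nonneg (r * a)]
  · have h2 : r * star S * S - a = cfc (fun x : ℝ => (|x| + δ)⁻¹ * x * x - x) a := by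
      have hc2 : Continuous fun x : ℝ => (|x| + δ)⁻¹ * x := hcont.mul continuous_id
      rw [mul_assoc, ← haa, ← mul_assoc, hra,
        cfc_sub (fun x : ℝ => (|x| + δ)⁻¹ * x * x) (fun x => x) a
          (hc2.mul continuous_id).continuousOn continuousOn_id,
        cfc_mul (fun x : ℝ => (|x| + δ)⁻¹ * x) (fun x => x) a hc2.continuousOn continuousOn_id,
        cfc_id' ℝ a]
    rw [h2]
    refine norm_cfc_le hδ.le fun x hx => ?_
    have hx0 : 0 ≤ x := spectrum_nonneg_of_nonneg ha0 hx
    rw [abs_of_nonneg hx0]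
    have : (x + δ)⁻¹ * x * x - x = -(δ * ((x + δ)⁻¹ * x)) := by field_simp; ring
    rw [this, norm_neg, Real.norm_of_nonneg (by positivity)]
    have h3 : (x + δ)⁻¹ * x ≤ 1 := by
      rw [inv_mul_le_one₀ (by positivity)]; linarith
    nlinarith

theorem TraceNormLe.abs (h : TraceNormLe S C) : TraceNormLe (CFC.abs S) C := by
  choose U hU hU' using fun n : ℕ => exists_abs_approx S (δ := 1 / ((n : ℝ) + 1)) (by positivity)
  have hlim : Tendsto (fun n => U n * S) atTop (𝓝 (CFC.abs S)) := by
    rw [tendsto_iff_norm_sub_tendsto_zero]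
    exact squeeze_zero (fun _ => norm_nonneg _) hU' tendsto_one_div_add_atTop_nhds_zero_nat
  refine TraceNormLe.of_tendsto (l := atTop) (c := fun _ => C)
    (Eventually.of_forall fun n => by simpa using h.mul_left (hU n)) (fun x y => ?_)
    tendsto_const_nhds
  have : Continuous fun T : V →L[ℂ] V => inner ℂ x (T y) := by fun_prop
  exact (this.tendsto _).comp hlim

theorem TraceNormLe.isTraceClass (h : TraceNormLe S C) : IsTraceClass S := by
  intro ι e
  have hpos : (CFC.abs S).IsPositive :=
    (ContinuousLinearMap.nonneg_iff_isPositive _).1 (CFC.abs_nonneg S)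
  refine summable_of_sum_le (c := C) (fun i => hpos.re_inner_nonneg_right _) fun u => ?_
  exact le_trans (Finset.sum_le_sum fun i _ => (RCLike.re_le_norm _))
    (h.abs ι u e e (Orthonormal.isBessel e.orthonormal u) (Orthonormal.isBessel e.orthonormal u))

theorem HasTrace.opTrace_eq {τ : ℂ} (hS : HasTrace S τ) : opTrace S = τ :=
  (hS _ (exists_hilbertBasis ℂ V).choose_spec.choose).tsum_eq

/-- Parseval in e followed by Bessel in f. For self-adjoint Q, using it in both directions shows
that ∑ ‖Q eᵢ‖² does not depend on the basis. -/
theorem tsum_norm_sq_adjoint_le {ι κ : Type} (e : HilbertBasis ι ℂ V) (f : HilbertBasis κ ℂ V)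
    (Q : V →L[ℂ] V) (he : Summable fun i => ‖Q (e i)‖ ^ 2)
    (hf : Summable fun j => ‖ContinuousLinearMap.adjoint Q (f j)‖ ^ 2) :
    ∑' j, ‖ContinuousLinearMap.adjoint Q (f j)‖ ^ 2 ≤ ∑' i, ‖Q (e i)‖ ^ 2 := by
  refine hf.tsum_le_of_sum_le fun t => ?_
  have h : HasSum (fun i => ∑ j ∈ t, ‖inner ℂ (e i) (ContinuousLinearMap.adjoint Q (f j))‖ ^ 2)
      (∑ j ∈ t, ‖ContinuousLinearMap.adjoint Q (f j)‖ ^ 2) :=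
    hasSum_sum fun i _ => HSNormLe.hasSum_norm_inner_sq e _
  refine hasSum_le (fun i => ?_) h he.hasSum
  simp_rw [ContinuousLinearMap.adjoint_inner_right]
  refine le_trans (le_of_eq (Finset.sum_congr rfl fun j _ => ?_))
    (Orthonormal.isBessel f.orthonormal t (Q (e i)))
  rw [← inner_conj_symm, RCLike.norm_conj]

/-- With Q = √P the diagonal entries are ‖Q eᵢ‖², so the trace is the squared Hilbert–Schmidt norm
of Q, which is the same in every basis. -/
theorem TraceNormLe.exists_hasTrace_of_nonneg {P : V →L[ℂ] V} (h : TraceNormLe P C) (hP : 0 ≤ P) :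
    ∃ τ, HasTrace P τ := by
  set Q := CFC.sqrt P with hQ
  have hQQ : Q * Q = P := CFC.sqrt_mul_sqrt_self P hP
  have hQsa : ContinuousLinearMap.adjoint Q = Q := (CFC.sqrt_nonneg P).isSelfAdjoint.star_eq
  have hdiag : ∀ v, inner ℂ v (P v) = ((‖Q v‖ ^ 2 : ℝ) : ℂ) := fun v => by
    rw [← hQQ, mul_apply_eq_comp]
    conv_lhs => rw [← hQsa, ContinuousLinearMap.adjoint_inner_right, hQsa]
    rw [inner_self_eq_norm_sq_to_K]
    push_cast; rfl
  have hsum : ∀ (ι : Type) (e : HilbertBasis ι ℂ V), Summable fun i => ‖Q (e i)‖ ^ 2 := fun ι e => by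
    refine summable_of_sum_le (c := C) (fun i => sq_nonneg _) fun u => ?_
    refine le_trans (le_of_eq (Finset.sum_congr rfl fun i _ => ?_))
      (h ι u e e (Orthonormal.isBessel e.orthonormal u) (Orthonormal.isBessel e.orthonormal u))
    rw [hdiag, Complex.norm_of_nonneg (by positivity)]
  obtain ⟨w, b, -⟩ := exists_hilbertBasis ℂ V
  refine ⟨((∑' i, ‖Q (b i)‖ ^ 2 : ℝ) : ℂ), fun ι e => ?_⟩
  simp_rw [hdiag]
  have h1 := tsum_norm_sq_adjoint_le b e Q (hsum _ b) (by rw [hQsa]; exact hsum _ e)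
  have h2 := tsum_norm_sq_adjoint_le e b Q (hsum _ e) (by rw [hQsa]; exact hsum _ b)
  rw [hQsa] at h1 h2
  rw [le_antisymm h2 h1]
  have h3 := (hsum _ e).hasSum
  exact_mod_cast h3

/-- A is half the difference of the positive operators |A| + A and |A| - A, both of finite trace
norm. -/
theorem TraceNormLe.exists_hasTrace_of_isSelfAdjoint {A : V →L[ℂ] V} (h : TraceNormLe A C)
    (hA : IsSelfAdjoint A) : ∃ τ, HasTrace A τ := by
  have h1 : 0 ≤ CFC.abs A + A := by
    rw [CFC.abs_add_self A]; exact nsmul_nonneg (CFC.posPart_nonneg A) 2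
  have h2 : 0 ≤ CFC.abs A - A := by
    rw [CFC.abs_sub_self A]; exact nsmul_nonneg (CFC.negPart_nonneg A) 2
  obtain ⟨τ₁, h3⟩ := (h.abs.add h).exists_hasTrace_of_nonneg h1
  obtain ⟨τ₂, h4⟩ := (h.abs.sub h).exists_hasTrace_of_nonneg h2
  refine ⟨(1 / 2) * τ₁ + (-1 / 2) * τ₂, ?_⟩
  have h5 := (h3.smul (1 / 2)).add (h4.smul (-1 / 2))
  convert h5 using 1
  module

theorem TraceNormLe.exists_hasTrace (h : TraceNormLe S C) : ∃ τ, HasTrace S τ := by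
  have hs : TraceNormLe (star S) C := h.adjoint
  have h1 : IsSelfAdjoint ((1 / 2 : ℂ) • (S + star S)) := by
    rw [IsSelfAdjoint, star_smul, star_add, star_star, add_comm]
    simp
  have h2 : IsSelfAdjoint ((-Complex.I / 2 : ℂ) • (S - star S)) := by
    rw [IsSelfAdjoint, star_smul, star_sub, star_star, ← neg_sub S, smul_neg, ← neg_smul]
    congr 1
    simp [neg_div]
  obtain ⟨τ₁, h3⟩ := ((h.add hs).smul (1 / 2)).exists_hasTrace_of_isSelfAdjoint h1
  obtain ⟨τ₂, h4⟩ := ((h.sub hs).smul (-Complex.I / 2)).exists_hasTrace_of_isSelfAdjoint h2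
  refine ⟨τ₁ + Complex.I * τ₂, ?_⟩
  have h5 := h3.add (h4.smul Complex.I)
  convert h5 using 1
  rw [smul_smul, show Complex.I * (-Complex.I / 2) = 1 / 2 by
    rw [mul_div_assoc', mul_neg, Complex.I_mul_I]; norm_num]
  module

theorem TraceNormLe.hasSum_opTrace (h : TraceNormLe S C) : HasTrace S (opTrace S) := by
  obtain ⟨τ, hτ⟩ := h.exists_hasTrace
  rw [hτ.opTrace_eq]
  exact hτ

end TraceClass

end DiracEntropy

namespace DiracEntropy
open Filter Topology

/-! ### Strong operator integrals -/

/-- Separability is needed for the joint measurability of (s, g) ↦ Φ(s) g in `StrMeas.mul`. -/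
instance : SecondCountableTopology HSp := by
  have : Fact ((2 : ENNReal) ≠ ⊤) := ⟨ENNReal.ofNat_ne_top⟩
  infer_instance

section StrongIntegral
variable {X : Type} [MeasurableSpace X] {μ : Measure X} {Φ Ψ : X → BOp} {L : BOp}

namespace HasStrongIntegral

theorem unique {L' : BOp} (h : HasStrongIntegral μ Φ L) (h' : HasStrongIntegral μ Φ L') :
    L = L' := by
  ext1 f
  rw [(h f).2, (h' f).2]

theorem strongIntegral_eq (h : HasStrongIntegral μ Φ L) : strongIntegral μ Φ = L := by
  have h' : ∃ L, HasStrongIntegral μ Φ L := ⟨L, h⟩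
  rw [strongIntegral, dif_pos h']
  exact h'.choose_spec.unique h

theorem mul_left (h : HasStrongIntegral μ Φ L) (A : BOp) :
    HasStrongIntegral μ (fun s => A * Φ s) (A * L) := fun f =>
  ⟨A.integrable_comp (h f).1, by
    rw [mul_apply_eq_comp, (h f).2]
    exact (A.integral_comp_comm (h f).1).symm⟩

theorem mul_right (h : HasStrongIntegral μ Φ L) (A : BOp) :
    HasStrongIntegral μ (fun s => Φ s * A) (L * A) := fun f => h (A f)

theorem smul (h : HasStrongIntegral μ Φ L) (c : ℂ) :
    HasStrongIntegral μ (fun s => c • Φ s) (c • L) := fun f =>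
  ⟨(h f).1.smul c, by
    rw [smul_apply, (h f).2, ← integral_smul]
    rfl⟩

theorem add {L' : BOp} (h : HasStrongIntegral μ Φ L) (h' : HasStrongIntegral μ Ψ L') :
    HasStrongIntegral μ (fun s => Φ s + Ψ s) (L + L') := fun f =>
  ⟨(h f).1.add (h' f).1, by
    rw [add_apply, (h f).2, (h' f).2, ← integral_add (h f).1 (h' f).1]
    rfl⟩

theorem congr (h : HasStrongIntegral μ Φ L) (h' : ∀ᵐ s ∂μ, Φ s = Ψ s) :
    HasStrongIntegral μ Ψ L := fun f => by
  have h2 : (fun s => Φ s f) =ᵐ[μ] fun s => Ψ s f := by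
    filter_upwards [h'] with s hs
    rw [hs]
  exact ⟨(h f).1.congr h2, (h f).2.trans (integral_congr_ae h2)⟩

theorem norm_le {c : X → ℝ} (h : HasStrongIntegral μ Φ L) (hc : Integrable c μ)
    (hb : ∀ᵐ s ∂μ, ‖Φ s‖ ≤ c s) : ‖L‖ ≤ ∫ s, c s ∂μ := by
  refine ContinuousLinearMap.opNorm_le_bound _ (integral_nonneg_of_ae ?_) fun f => ?_
  · filter_upwards [hb] with s hs
    exact (norm_nonneg _).trans hs
  · rw [(h f).2, ← integral_mul_const]
    refine norm_integral_le_of_norm_le (hc.mul_const _) ?_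
    filter_upwards [hb] with s hs
    exact (ContinuousLinearMap.le_opNorm _ _).trans (by gcongr)

theorem inner_eq (h : HasStrongIntegral μ Φ L) (x y : HSp) :
    inner ℂ x (L y) = ∫ s, inner ℂ x (Φ s y) ∂μ := by
  rw [(h y).2, integral_inner (h y).1]

theorem traceNormLe {c : X → ℝ} (h : HasStrongIntegral μ Φ L) (hc : Integrable c μ)
    (hb : ∀ᵐ s ∂μ, TraceNormLe (Φ s) (c s)) : TraceNormLe L (∫ s, c s ∂μ) :=
  TraceNormLe.of_integral hb hc (fun x y => (h y).1.const_inner x) fun x y => h.inner_eq x y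

end HasStrongIntegral

theorem exists_hasStrongIntegral {c : X → ℝ} (hm : ∀ f, AEStronglyMeasurable (fun s => Φ s f) μ)
    (hc : Integrable c μ) (hb : ∀ᵐ s ∂μ, ‖Φ s‖ ≤ c s) :
    HasStrongIntegral μ Φ (strongIntegral μ Φ) := by
  have hint : ∀ f, Integrable (fun s => Φ s f) μ := fun f => by
    refine (hc.mul_const ‖f‖).mono' (hm f) ?_
    filter_upwards [hb] with s hs
    exact (ContinuousLinearMap.le_opNorm _ _).trans (by gcongr)
  have h : ∃ L, HasStrongIntegral μ Φ L := by
    refine ⟨LinearMap.mkContinuous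
      { toFun := fun f => ∫ s, Φ s f ∂μ
        map_add' := fun f g => by simp_rw [map_add]; exact integral_add (hint f) (hint g)
        map_smul' := fun c f => by simp_rw [map_smul]; exact integral_smul c _ }
      (∫ s, c s ∂μ) fun f => ?_, fun f => ⟨hint f, rfl⟩⟩
    change ‖∫ s, Φ s f ∂μ‖ ≤ _
    rw [← integral_mul_const]
    refine norm_integral_le_of_norm_le (hc.mul_const _) ?_
    filter_upwards [hb] with s hs
    exact (ContinuousLinearMap.le_opNorm _ _).trans (by gcongr)
  rw [h.choose_spec.strongIntegral_eq]
  exact h.choose_spec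

/-- Strong measurability of an operator-valued function, in the strong operator topology. -/
def StrMeas (Φ : X → BOp) : Prop := ∀ f, StronglyMeasurable fun s => Φ s f

namespace StrMeas

/-- A Carathéodory argument: Φ(s) g is continuous in g and measurable in s, hence jointly
measurable, and g may be replaced by Ψ(s) f. -/
theorem mul (hΦ : StrMeas Φ) (hΨ : StrMeas Ψ) : StrMeas fun s => Φ s * Ψ s := fun f => by
  borelize HSp
  have h := stronglyMeasurable_uncurry_of_continuous_of_stronglyMeasurable
    (u := fun (g : HSp) (s : X) => Φ s g) (fun s => (Φ s).continuous) hΦ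
  exact h.comp_measurable ((hΨ f).measurable.prodMk measurable_id)

theorem const (A : BOp) : StrMeas fun _ : X => A := fun _ => stronglyMeasurable_const

theorem comp {Y : Type} [MeasurableSpace Y] (hΦ : StrMeas Φ) {g : Y → X} (hg : Measurable g) :
    StrMeas fun y => Φ (g y) := fun f => (hΦ f).comp_measurable hg

theorem of_continuous [TopologicalSpace X] [OpensMeasurableSpace X]
    [SecondCountableTopology X] (h : ∀ f, Continuous fun s => Φ s f) : StrMeas Φ := fun f =>
  (h f).stronglyMeasurable

theorem of_norm_continuous [TopologicalSpace X] [OpensMeasurableSpace X]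
    [SecondCountableTopology X] (h : Continuous Φ) : StrMeas Φ :=
  of_continuous fun _ => h.clm_apply continuous_const

theorem ite {p : X → Prop} [DecidablePred p] (hp : MeasurableSet {x | p x}) (hΦ : StrMeas Φ)
    (hΨ : StrMeas Ψ) : StrMeas fun x => if p x then Φ x else Ψ x := fun f => by
  have e : (fun x => (if p x then Φ x else Ψ x) f) = fun x => if p x then Φ x f else Ψ x f := by
    funext x
    by_cases h : p x <;> simp [h]
  rw [e]
  exact StronglyMeasurable.ite hp (hΦ f) (hΨ f)

end StrMeas

end StrongIntegral

end DiracEntropy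

namespace DiracEntropy
open Filter Topology
open scoped ContDiff

/-! ### The Dyson series in the Schrödinger picture -/

/-- Smooth curves of operators which vanish before time `-ε`. -/
structure IsSwitchedCurve (ε : ℝ) (Z : ℝ → BOp) : Prop where
  smooth : ContDiff ℝ ∞ Z
  vanish : ∀ s < -ε, Z s = 0

section
variable {m ε : ℝ} {Z Y a : ℝ → BOp}

namespace IsSwitchedCurve

theorem deriv (hZ : IsSwitchedCurve ε Z) : IsSwitchedCurve ε (deriv Z) := by
  refine ⟨(contDiff_infty_iff_deriv.1 hZ.smooth).2, fun s hs => ?_⟩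
  have h : Z =ᶠ[𝓝 s] fun _ => 0 := by
    filter_upwards [Iio_mem_nhds hs] with u hu using hZ.vanish u hu
  rw [h.deriv_eq, deriv_const]

theorem iteratedDeriv (hZ : IsSwitchedCurve ε Z) (k : ℕ) :
    IsSwitchedCurve ε (iteratedDeriv k Z) := by
  induction k with
  | zero => simpa using hZ
  | succ k ih => rw [iteratedDeriv_succ]; exact ih.deriv

theorem mul_left (hZ : IsSwitchedCurve ε Z) (hY : ContDiff ℝ ∞ Y) :
    IsSwitchedCurve ε fun s => Y s * Z s :=
  ⟨hY.mul hZ.smooth, fun s hs => by rw [hZ.vanish s hs, mul_zero]⟩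

theorem exists_bound (hZ : IsSwitchedCurve ε Z) (T : ℝ) :
    ∃ C, 0 ≤ C ∧ ∀ s ≤ T, ‖Z s‖ ≤ C := by
  obtain ⟨C, hC⟩ := isCompact_Icc (a := -ε) (b := T) |>.exists_bound_of_continuousOn
    hZ.smooth.continuous.continuousOn
  refine ⟨max C 0, le_max_right _ _, fun s hs => ?_⟩
  by_cases h : s < -ε
  · rw [hZ.vanish s h, norm_zero]; exact le_max_right _ _
  · exact (hC s ⟨not_lt.1 h, hs⟩).trans (le_max_left _ _)

theorem differentiable (hZ : IsSwitchedCurve ε Z) : Differentiable ℝ Z :=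
  hZ.smooth.differentiable (by simp)

end IsSwitchedCurve

/-- The integrand of the retarded integral. -/
def lagIntegrand (m : ℝ) (Z : ℝ → BOp) (s τ : ℝ) : BOp :=
  freeEvol m (-τ) * Z (s - τ) * freeEvol m τ

/-- The retarded integral `∫_0^∞ e^{-iτD} Z(s-τ) e^{iτD} dτ`. -/
def lagInt (m : ℝ) (Z : ℝ → BOp) (s : ℝ) : BOp :=
  strongIntegral (volume.restrict (Set.Ioi 0)) (lagIntegrand m Z s)

theorem strMeas_freeEvol (hm : 0 < m) : StrMeas fun t => freeEvol m t :=
  StrMeas.of_continuous fun f => continuous_freeEvol_apply hm f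

theorem norm_conj_freeEvol_le (hm : 0 < m) (s t : ℝ) (A : BOp) :
    ‖freeEvol m s * A * freeEvol m t‖ ≤ ‖A‖ := by
  refine (norm_mul_le _ _).trans ?_
  have h1 := (norm_mul_le (freeEvol m s) A)
  have h2 := norm_freeEvol_le hm s
  have h3 := norm_freeEvol_le hm t
  have h4 := norm_nonneg A
  have h5 := norm_nonneg (freeEvol m t)
  nlinarith [norm_nonneg (freeEvol m s * A), norm_nonneg (freeEvol m s)]

theorem norm_lagIntegrand_le (hm : 0 < m) (s τ : ℝ) : ‖lagIntegrand m Z s τ‖ ≤ ‖Z (s - τ)‖ :=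
  norm_conj_freeEvol_le hm _ _ _

theorem strMeas_lagIntegrand (hm : 0 < m) (hZ : Continuous Z) (s : ℝ) :
    StrMeas (lagIntegrand m Z s) :=
  (((strMeas_freeEvol hm).comp measurable_neg).mul
    (StrMeas.of_norm_continuous (hZ.comp (continuous_const.sub continuous_id)))).mul
    (strMeas_freeEvol hm)

theorem integrable_lag_norm (hZ : IsSwitchedCurve ε Z) (s : ℝ) :
    Integrable (fun τ => ‖Z (s - τ)‖) (volume.restrict (Set.Ioi 0)) := by
  obtain ⟨C, hC0, hC⟩ := hZ.exists_bound s
  have h1 : Integrable ((Set.Icc 0 (s + ε)).indicator fun _ => C)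
      (volume.restrict (Set.Ioi (0 : ℝ))) :=
    ((integrable_indicator_iff measurableSet_Icc).2
      (integrableOn_const isCompact_Icc.measure_lt_top.ne enorm_ne_top)).restrict
  refine h1.mono' ?_ ?_
  · exact (hZ.smooth.continuous.comp (continuous_const.sub continuous_id)).norm.aestronglyMeasurable
  · filter_upwards [ae_restrict_mem measurableSet_Ioi] with τ hτ
    rw [norm_norm]
    by_cases h : s - τ < -ε
    · rw [hZ.vanish _ h, norm_zero]; exact Set.indicator_nonneg (fun _ _ => hC0) _
    · rw [Set.indicator_of_mem (show τ ∈ Set.Icc 0 (s + ε) from ⟨le_of_lt hτ, by linarith⟩)]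
      exact hC _ (by have : (0:ℝ) < τ := hτ; linarith)

theorem hasStrongIntegral_lagInt (hm : 0 < m) (hZ : IsSwitchedCurve ε Z) (s : ℝ) :
    HasStrongIntegral (volume.restrict (Set.Ioi 0)) (lagIntegrand m Z s) (lagInt m Z s) :=
  exists_hasStrongIntegral
    (fun f => (strMeas_lagIntegrand hm hZ.smooth.continuous s f).aestronglyMeasurable)
    (integrable_lag_norm hZ s) (ae_of_all _ fun τ => norm_lagIntegrand_le hm s τ)

theorem lagInt_of_lt (hZ : IsSwitchedCurve ε Z) {s : ℝ} (hs : s < -ε) : lagInt m Z s = 0 := by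
  refine HasStrongIntegral.strongIntegral_eq fun f => ?_
  have h : (fun τ => lagIntegrand m Z s τ f) =ᵐ[volume.restrict (Set.Ioi 0)] fun _ => 0 := by
    filter_upwards [ae_restrict_mem measurableSet_Ioi] with τ hτ
    have hτ' : (0 : ℝ) < τ := hτ
    rw [lagIntegrand, hZ.vanish _ (by linarith)]
    simp
  refine ⟨(integrable_zero _ _ _).congr h.symm, ?_⟩
  rw [integral_congr_ae h]
  simp

/-- Two applications of the mean value inequality, with C a bound for the second derivative on (-∞,
T]. Such a bound exists because the curve vanishes before -ε, and it is uniform in the delay τ. -/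
theorem norm_taylor_le (hZ : IsSwitchedCurve ε Z) {s T : ℝ} (hs : s < T) :
    ∃ C, 0 ≤ C ∧ ∀ u < T, ∀ τ > 0, ‖Z (u - τ) - Z (s - τ) - (u - s) • deriv Z (s - τ)‖
      ≤ C * (u - s) ^ 2 := by
  obtain ⟨C, hC0, hC⟩ := hZ.deriv.deriv.exists_bound T
  refine ⟨C, hC0, fun u hu τ hτ => ?_⟩
  have hlip : ∀ x ≤ T, ∀ y ≤ T, ‖deriv Z x - deriv Z y‖ ≤ C * |x - y| := fun x hx y hy => by
    have := (convex_Iic T).norm_image_sub_le_of_norm_deriv_le (f := deriv Z) (C := C)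
      (fun r _ => hZ.deriv.differentiable r) (fun r hr => hC r hr) (show y ∈ Set.Iic T from hy)
      (show x ∈ Set.Iic T from hx)
    simpa [Real.norm_eq_abs] using this
  have hconv : Convex ℝ (Set.uIcc (s - τ) (u - τ)) := convex_uIcc _ _
  have hsub : ∀ r ∈ Set.uIcc (s - τ) (u - τ), r ≤ T ∧ |r - (s - τ)| ≤ |u - s| := fun r hr => by
    refine ⟨?_, ?_⟩
    · exact (Set.mem_uIcc.1 hr).elim (fun h => by linarith [h.2]) fun h => by linarith [h.2]
    · have := Set.abs_sub_left_of_mem_uIcc hr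
      rwa [show u - τ - (s - τ) = u - s by ring] at this
  have h := hconv.norm_image_sub_le_of_norm_hasDerivWithin_le
    (f := fun r => Z r - r • deriv Z (s - τ)) (f' := fun r => deriv Z r - deriv Z (s - τ))
    (C := C * |u - s|) (x := s - τ) (y := u - τ) (fun r _ => ?_) (fun r hr => ?_)
    Set.left_mem_uIcc Set.right_mem_uIcc
  · have e : Z (u - τ) - Z (s - τ) - (u - s) • deriv Z (s - τ)
        = Z (u - τ) - (u - τ) • deriv Z (s - τ) - (Z (s - τ) - (s - τ) • deriv Z (s - τ)) := by
      module
    rw [e]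
    refine h.trans (le_of_eq ?_)
    rw [show u - τ - (s - τ) = u - s by ring, Real.norm_eq_abs, mul_assoc, abs_mul_abs_self, sq]
  · have h1 := (hZ.differentiable r).hasDerivAt.fun_sub
      ((hasDerivAt_id r).smul_const (deriv Z (s - τ)))
    simpa using h1.hasDerivWithinAt
  · refine (hlip r (hsub r hr).1 (s - τ) (by linarith)).trans ?_
    exact mul_le_mul_of_nonneg_left (hsub r hr).2 hC0

/-- The free evolutions in the retarded integral depend on τ alone, so the derivative in s falls on
Z and no factor D appears. In the interaction picture this would fail in operator norm. -/
theorem hasDerivAt_lagInt (hm : 0 < m) (hZ : IsSwitchedCurve ε Z) (s : ℝ) :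
    HasDerivAt (lagInt m Z) (lagInt m (deriv Z) s) s := by
  obtain ⟨C, hC0, hC⟩ := norm_taylor_le hZ (lt_add_one s)
  rw [hasDerivAt_iff_isLittleO]
  have hO : (fun u => lagInt m Z u - lagInt m Z s - (u - s) • lagInt m (deriv Z) s)
      =O[𝓝 s] fun u => (u - s) ^ 2 := by
    -- For u < s + 1 the integrand vanishes as soon as τ > s + 1 + ε, so the remainder C (u - s)² is
    -- integrated over an interval of at most this length.
    refine Asymptotics.IsBigO.of_bound (C * (max 0 (s + 1 + ε))) ?_
    filter_upwards [Iio_mem_nhds (lt_add_one s)] with u hu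
    have hu' : u < s + 1 := hu
    have hI : HasStrongIntegral (volume.restrict (Set.Ioi 0))
        (fun τ => lagIntegrand m Z u τ + ((-1 : ℂ) • lagIntegrand m Z s τ +
          (-(u - s : ℝ) : ℂ) • lagIntegrand m (deriv Z) s τ))
        (lagInt m Z u + ((-1 : ℂ) • lagInt m Z s + (-(u - s : ℝ) : ℂ) • lagInt m (deriv Z) s)) :=
      (hasStrongIntegral_lagInt hm hZ u).add (((hasStrongIntegral_lagInt hm hZ s).smul _).add
        ((hasStrongIntegral_lagInt hm hZ.deriv s).smul _))
    have e1 : lagInt m Z u - lagInt m Z s - (u - s) • lagInt m (deriv Z) s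
        = lagInt m Z u + ((-1 : ℂ) • lagInt m Z s +
          (-(u - s : ℝ) : ℂ) • lagInt m (deriv Z) s) := by
      rw [← Complex.ofReal_neg, Complex.coe_smul]
      module
    rw [e1]
    have hint : Integrable ((Set.Icc 0 (s + 1 + ε)).indicator fun _ => C * (u - s) ^ 2)
        (volume.restrict (Set.Ioi (0 : ℝ))) :=
      ((integrable_indicator_iff measurableSet_Icc).2
        (integrableOn_const isCompact_Icc.measure_lt_top.ne enorm_ne_top)).restrict
    refine (hI.norm_le hint ?_).trans ?_
    · filter_upwards [ae_restrict_mem measurableSet_Ioi] with τ hτ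
      have hτ' : (0 : ℝ) < τ := hτ
      have e2 : lagIntegrand m Z u τ + ((-1 : ℂ) • lagIntegrand m Z s τ +
          (-(u - s : ℝ) : ℂ) • lagIntegrand m (deriv Z) s τ)
          = freeEvol m (-τ) * (Z (u - τ) - Z (s - τ) - (u - s) • deriv Z (s - τ))
            * freeEvol m τ := by
        rw [← Complex.ofReal_neg, Complex.coe_smul]
        simp only [lagIntegrand, mul_sub, sub_mul, mul_smul_comm, smul_mul_assoc]
        module
      rw [e2]
      refine (norm_conj_freeEvol_le hm _ _ _).trans ?_
      by_cases h : s + 1 - τ < -ε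
      · rw [hZ.vanish _ (by linarith), hZ.vanish _ (by linarith), hZ.deriv.vanish _ (by linarith)]
        simp only [sub_zero, smul_zero, norm_zero]
        exact Set.indicator_nonneg (fun _ _ => mul_nonneg hC0 (sq_nonneg _)) _
      · rw [Set.indicator_of_mem (show τ ∈ Set.Icc 0 (s + 1 + ε) from ⟨hτ'.le, by linarith⟩)]
        exact hC u hu' τ hτ'
    · rw [integral_indicator measurableSet_Icc, setIntegral_const, Measure.real,
        Measure.restrict_apply measurableSet_Icc, smul_eq_mul,
        Real.norm_of_nonneg (sq_nonneg (u - s))]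
      have hvol : (volume (Set.Icc 0 (s + 1 + ε) ∩ Set.Ioi 0)).toReal ≤ max 0 (s + 1 + ε) := by
        refine (ENNReal.toReal_mono (by simp) (measure_mono Set.inter_subset_left)).trans ?_
        rw [Real.volume_Icc, sub_zero, ENNReal.toReal_ofReal', max_comm]
      calc _ ≤ max 0 (s + 1 + ε) * (C * (u - s) ^ 2) := by gcongr
        _ = _ := by ring
  refine hO.trans_isLittleO ?_
  have h2 : Tendsto (fun u => u - s) (𝓝 s) (𝓝 0) := by
    have : Tendsto (fun u => u - s) (𝓝 s) (𝓝 (s - s)) :=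
      (continuous_id.sub continuous_const).tendsto s
    simpa using this
  exact (Asymptotics.isLittleO_pow_id (n := 2) one_lt_two).comp_tendsto h2

theorem deriv_lagInt (hm : 0 < m) (hZ : IsSwitchedCurve ε Z) :
    deriv (lagInt m Z) = lagInt m (deriv Z) :=
  funext fun s => (hasDerivAt_lagInt hm hZ s).deriv

theorem iteratedDeriv_lagInt (hm : 0 < m) (hZ : IsSwitchedCurve ε Z) (k : ℕ) :
    iteratedDeriv k (lagInt m Z) = lagInt m (iteratedDeriv k Z) := by
  induction k with
  | zero => simp
  | succ k ih => rw [iteratedDeriv_succ, ih, deriv_lagInt hm (hZ.iteratedDeriv k), iteratedDeriv_succ]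

theorem isSwitchedCurve_lagInt (hm : 0 < m) (hZ : IsSwitchedCurve ε Z) :
    IsSwitchedCurve ε (lagInt m Z) := by
  refine ⟨contDiff_infty.2 fun n => ?_, fun s hs => lagInt_of_lt hZ hs⟩
  induction n generalizing Z with
  | zero =>
    exact contDiff_zero.2 (continuous_iff_continuousAt.2 fun s =>
      (hasDerivAt_lagInt hm hZ s).continuousAt)
  | succ n ih =>
    push_cast
    refine contDiff_succ_iff_deriv.2 ⟨fun s => (hasDerivAt_lagInt hm hZ s).differentiableAt,
      by simp, ?_⟩
    rw [deriv_lagInt hm hZ]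
    exact ih hZ.deriv

end

end DiracEntropy

namespace DiracEntropy
open Filter Topology
open scoped ContDiff Nat

/-! ### The Dyson series in the Schrödinger picture: factorial bounds, smoothness and intertwining.
-/

section
variable {m ε : ℝ} {a : ℝ → BOp}

/-- The terms `e^{-isD} V^{(n)}_s e^{isD}` of the Dyson series in the Schrödinger picture. -/
def lagDyson (m : ℝ) (a : ℝ → BOp) : ℕ → ℝ → BOp
  | 0, _ => 1
  | n + 1, s => Complex.I • lagInt m (fun r => lagDyson m a n r * a r) s

theorem lagDyson_zero (m : ℝ) (a : ℝ → BOp) : lagDyson m a 0 = fun _ => 1 := rfl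

theorem lagDyson_succ (m : ℝ) (a : ℝ → BOp) (n : ℕ) :
    lagDyson m a (n + 1) = fun s => Complex.I • lagInt m (fun r => lagDyson m a n r * a r) s := rfl

theorem contDiff_lagDyson (hm : 0 < m) (ha : IsSwitchedCurve ε a) (n : ℕ) :
    ContDiff ℝ ∞ (lagDyson m a n) := by
  induction n with
  | zero => exact contDiff_const
  | succ n ih =>
    exact (isSwitchedCurve_lagInt hm (ha.mul_left ih)).smooth.const_smul Complex.I

/-- The bound `(c (s + ε)₊)ⁿ / n!`. -/
def dysonBound (c ε : ℝ) (n : ℕ) (s : ℝ) : ℝ := (c * max (s + ε) 0) ^ n / n !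

theorem dysonBound_nonneg {c : ℝ} (hc : 0 ≤ c) (n : ℕ) (s : ℝ) : 0 ≤ dysonBound c ε n s := by
  unfold dysonBound
  positivity

theorem dysonBound_mono {c : ℝ} (hc : 0 ≤ c) (n : ℕ) {s t : ℝ} (h : s ≤ t) :
    dysonBound c ε n s ≤ dysonBound c ε n t := by
  unfold dysonBound
  gcongr

theorem summable_dysonBound (c ε s : ℝ) : Summable fun n => dysonBound c ε n s :=
  Real.summable_pow_div_factorial _

/-- One more retarded integration reproduces the factorial bound with n raised by one; this is the
induction step of the Dyson estimates. The indicator records that the integrand vanishes for τ > s +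
ε. -/
theorem dysonBound_integral (c : ℝ) (n : ℕ) (s : ℝ) :
    Integrable ((Set.Iic (s + ε)).indicator fun τ => c * dysonBound c ε n (s - τ))
      (volume.restrict (Set.Ioi 0)) ∧
    ∫ τ in Set.Ioi 0, (Set.Iic (s + ε)).indicator (fun τ => c * dysonBound c ε n (s - τ)) τ
      = dysonBound c ε (n + 1) s := by
  have hcont : Continuous fun τ => c * dysonBound c ε n (s - τ) := by
    unfold dysonBound
    fun_prop
  constructor
  · rw [integrable_indicator_iff measurableSet_Iic, IntegrableOn,
      Measure.restrict_restrict measurableSet_Iic, Set.inter_comm, Set.Ioi_inter_Iic]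
    exact (hcont.continuousOn.integrableOn_compact isCompact_Icc).mono_set Set.Ioc_subset_Icc_self
  · rw [setIntegral_indicator measurableSet_Iic, Set.Ioi_inter_Iic]
    rcases le_total (s + ε) 0 with h | h
    · rw [Set.Ioc_eq_empty (by simpa using h), setIntegral_empty, dysonBound, max_eq_right h]
      simp
    · rw [← intervalIntegral.integral_of_le h]
      have e : ∀ τ ∈ Set.uIcc 0 (s + ε), c * dysonBound c ε n (s - τ)
          = (c ^ (n + 1) / n !) * (s + ε - τ) ^ n := fun τ hτ => by
        rw [Set.uIcc_of_le h] at hτ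
        rw [dysonBound, max_eq_left (by linarith [hτ.2]), mul_pow]
        ring
      rw [intervalIntegral.integral_congr e, intervalIntegral.integral_const_mul,
        intervalIntegral.integral_comp_sub_left (fun x => x ^ n) (s + ε), integral_pow,
        dysonBound, max_eq_left h, Nat.factorial_succ, mul_pow, sub_self, sub_zero]
      have : (n ! : ℝ) ≠ 0 := by positivity
      push_cast
      field_simp
      ring

/-- The Leibniz rule for the k-th derivative costs a factor ∑ᵢ C(k, i) = 2ᵏ ≤ 2ᴺ. Treating all
orders k ≤ N with the single constant 2ᴺM lets the induction on n close. -/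
theorem norm_iteratedDeriv_lagDyson_le (hm : 0 < m) (ha : IsSwitchedCurve ε a) {N : ℕ} {T M : ℝ}
    (hM0 : 0 ≤ M) (hM : ∀ k ≤ N, ∀ s ≤ T, ‖iteratedDeriv k a s‖ ≤ M) (n : ℕ) :
    ∀ k ≤ N, ∀ s ≤ T, ‖iteratedDeriv k (lagDyson m a n) s‖ ≤ dysonBound (2 ^ N * M) ε n s := by
  induction n with
  | zero =>
    intro k _ s _
    rw [lagDyson_zero, dysonBound, iteratedDeriv_const]
    split_ifs
    · have : ‖(1 : BOp)‖ ≤ 1 := ContinuousLinearMap.norm_id_le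
      simpa only [pow_zero, Nat.factorial_zero, Nat.cast_one, div_one]
    · simp
  | succ n ih =>
    intro k hk s hs
    set Z : ℝ → BOp := fun r => lagDyson m a n r * a r with hZ
    have hZs : IsSwitchedCurve ε Z := ha.mul_left (contDiff_lagDyson hm ha n)
    have hZb : ∀ r ≤ T, ‖iteratedDeriv k Z r‖ ≤ 2 ^ N * M * dysonBound (2 ^ N * M) ε n r := by
      intro r hr
      have h1 := norm_iteratedFDeriv_mul_le (𝕜 := ℝ) (n := k) (N := ∞)
        (contDiff_lagDyson hm ha n) ha.smooth r (by exact_mod_cast le_top)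
      rw [norm_iteratedFDeriv_eq_norm_iteratedDeriv] at h1
      refine h1.trans ?_
      have hB := dysonBound_nonneg (ε := ε) (c := 2 ^ N * M) (by positivity) n r
      calc _ ≤ ∑ i ∈ Finset.range (k + 1), (k.choose i : ℝ) *
              (M * dysonBound (2 ^ N * M) ε n r) := by
            refine Finset.sum_le_sum fun i hi => ?_
            have hi' : i ≤ k := Nat.lt_succ_iff.1 (Finset.mem_range.1 hi)
            rw [norm_iteratedFDeriv_eq_norm_iteratedDeriv, norm_iteratedFDeriv_eq_norm_iteratedDeriv,
              mul_assoc, mul_comm M]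
            gcongr
            · exact ih i (hi'.trans hk) r hr
            · exact hM _ ((Nat.sub_le _ _).trans hk) r hr
        _ = 2 ^ k * (M * dysonBound (2 ^ N * M) ε n r) := by
            rw [← Finset.sum_mul]
            congr 1
            exact_mod_cast Nat.sum_range_choose k
        _ ≤ 2 ^ N * (M * dysonBound (2 ^ N * M) ε n r) := by
            gcongr
            exact one_le_two
        _ = _ := by ring
    have e : iteratedDeriv k (lagDyson m a (n + 1)) s
        = Complex.I • lagInt m (iteratedDeriv k Z) s := by
      rw [lagDyson_succ, ← iteratedDeriv_lagInt hm hZs]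
      exact iteratedDeriv_fun_const_smul_field Complex.I _
    rw [e, norm_smul, Complex.norm_I, one_mul]
    obtain ⟨h1, h2⟩ := dysonBound_integral (ε := ε) (2 ^ N * M) n s
    rw [← h2]
    refine (hasStrongIntegral_lagInt hm (hZs.iteratedDeriv k) s).norm_le h1 ?_
    filter_upwards [ae_restrict_mem measurableSet_Ioi] with τ hτ
    have hτ' : (0 : ℝ) < τ := hτ
    refine (norm_lagIntegrand_le hm s τ).trans ?_
    by_cases h : τ ≤ s + ε
    · rw [Set.indicator_of_mem (show τ ∈ Set.Iic (s + ε) from h)]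
      exact hZb _ (by linarith)
    · rw [(hZs.iteratedDeriv k).vanish _ (by linarith), norm_zero,
        Set.indicator_of_notMem (show τ ∉ Set.Iic (s + ε) from h)]

theorem exists_iteratedDeriv_bound (ha : IsSwitchedCurve ε a) (N : ℕ) (T : ℝ) :
    ∃ M, 0 ≤ M ∧ ∀ k ≤ N, ∀ s ≤ T, ‖iteratedDeriv k a s‖ ≤ M := by
  choose C hC0 hC using fun k => (ha.iteratedDeriv k).exists_bound T
  refine ⟨∑ k ∈ Finset.range (N + 1), C k, Finset.sum_nonneg fun k _ => hC0 k, fun k hk s hs => ?_⟩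
  exact (hC k s hs).trans (Finset.single_le_sum (fun i _ => hC0 i)
    (Finset.mem_range.2 (Nat.lt_succ_of_le hk)))

theorem summable_norm_iteratedDeriv_lagDyson (hm : 0 < m) (ha : IsSwitchedCurve ε a) (k : ℕ)
    (s : ℝ) : Summable fun n => ‖iteratedDeriv k (lagDyson m a n) s‖ := by
  obtain ⟨M, hM0, hM⟩ := exists_iteratedDeriv_bound ha k s
  exact (summable_dysonBound (2 ^ k * M) ε s).of_nonneg_of_le (fun _ => norm_nonneg _)
    fun n => norm_iteratedDeriv_lagDyson_le hm ha hM0 hM n k le_rfl s le_rfl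

theorem summable_norm_lagDyson (hm : 0 < m) (ha : IsSwitchedCurve ε a) (s : ℝ) :
    Summable fun n => ‖lagDyson m a n s‖ := by
  simpa using summable_norm_iteratedDeriv_lagDyson hm ha 0 s

/-- The sum `e^{-isD} V_s e^{isD}` of the Dyson series in the Schrödinger picture. -/
def lagV (m : ℝ) (a : ℝ → BOp) (s : ℝ) : BOp := ∑' n, lagDyson m a n s

theorem hasDerivAt_tsum_iteratedDeriv (hm : 0 < m) (ha : IsSwitchedCurve ε a) (k : ℕ) (s : ℝ) :
    HasDerivAt (fun r => ∑' n, iteratedDeriv k (lagDyson m a n) r)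
      (∑' n, iteratedDeriv (k + 1) (lagDyson m a n) s) s := by
  obtain ⟨M, hM0, hM⟩ := exists_iteratedDeriv_bound ha (k + 1) (s + 1)
  refine hasDerivAt_tsum_of_isPreconnected (t := Set.Iio (s + 1))
    (summable_dysonBound (2 ^ (k + 1) * M) ε (s + 1)) isOpen_Iio isPreconnected_Iio
    (fun n y _ => ?_) (fun n y hy => ?_) (Set.mem_Iio.2 (lt_add_one s))
    (summable_norm_iteratedDeriv_lagDyson hm ha k s).of_norm (Set.mem_Iio.2 (lt_add_one s))
  · rw [iteratedDeriv_succ]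
    exact (((contDiff_lagDyson hm ha n).differentiable_iteratedDeriv k
      (by exact_mod_cast ENat.natCast_lt_top k)) y).hasDerivAt
  · have hy' : y < s + 1 := hy
    exact (norm_iteratedDeriv_lagDyson_le hm ha hM0 hM n (k + 1) le_rfl y hy'.le).trans
      (dysonBound_mono (by positivity) n hy'.le)

theorem contDiff_lagV (hm : 0 < m) (ha : IsSwitchedCurve ε a) : ContDiff ℝ ∞ (lagV m a) := by
  have h : ∀ N k : ℕ, ContDiff ℝ N (fun r => ∑' n, iteratedDeriv k (lagDyson m a n) r) := by
    intro N
    induction N with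
    | zero => exact fun k => contDiff_zero.2 (continuous_iff_continuousAt.2 fun s =>
        (hasDerivAt_tsum_iteratedDeriv hm ha k s).continuousAt)
    | succ N ih =>
      intro k
      push_cast
      refine contDiff_succ_iff_deriv.2
        ⟨fun s => (hasDerivAt_tsum_iteratedDeriv hm ha k s).differentiableAt, by simp, ?_⟩
      rw [funext fun s => (hasDerivAt_tsum_iteratedDeriv hm ha k s).deriv]
      exact ih (k + 1)
  refine contDiff_infty.2 fun N => ?_
  have e : lagV m a = fun r => ∑' n, iteratedDeriv 0 (lagDyson m a n) r := by
    funext r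
    simp [lagV]
  rw [e]
  exact h N 0

/-- A relation Ra = bR passes through each retarded integral when R commutes with the free
evolution, hence through the whole Dyson series. It is applied with R = D⁻⁴. -/
theorem lagInt_intertwine (hm : 0 < m) {Z Y : ℝ → BOp} {R : BOp}
    (hZ : IsSwitchedCurve ε Z) (hY : IsSwitchedCurve ε Y)
    (hR : ∀ t, R * freeEvol m t = freeEvol m t * R) (h : ∀ s, R * Z s = Y s * R) (s : ℝ) :
    R * lagInt m Z s = lagInt m Y s * R := by
  have h1 := (hasStrongIntegral_lagInt hm hZ s).mul_left R
  have h2 := (hasStrongIntegral_lagInt hm hY s).mul_right R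
  refine h1.unique (h2.congr (ae_of_all _ fun τ => ?_))
  simp only [lagIntegrand]
  rw [mul_assoc, ← hR, ← mul_assoc, mul_assoc _ (Y _), ← h, ← mul_assoc, ← mul_assoc, ← mul_assoc,
    hR]

theorem lagDyson_intertwine (hm : 0 < m) {b : ℝ → BOp} {R : BOp} (ha : IsSwitchedCurve ε a)
    (hb : IsSwitchedCurve ε b) (hR : ∀ t, R * freeEvol m t = freeEvol m t * R)
    (h : ∀ s, R * a s = b s * R) (n : ℕ) (s : ℝ) :
    R * lagDyson m a n s = lagDyson m b n s * R := by
  induction n generalizing s with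
  | zero => simp [lagDyson]
  | succ n ih =>
    rw [lagDyson_succ, lagDyson_succ, mul_smul_comm, smul_mul_assoc]
    congr 1
    refine lagInt_intertwine hm (ha.mul_left (contDiff_lagDyson hm ha n))
      (hb.mul_left (contDiff_lagDyson hm hb n)) hR (fun r => ?_) s
    rw [← mul_assoc, ih, mul_assoc, h, mul_assoc]

theorem lagV_intertwine (hm : 0 < m) {b : ℝ → BOp} {R : BOp} (ha : IsSwitchedCurve ε a)
    (hb : IsSwitchedCurve ε b) (hR : ∀ t, R * freeEvol m t = freeEvol m t * R)
    (h : ∀ s, R * a s = b s * R) (s : ℝ) : R * lagV m a s = lagV m b s * R := by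
  have h1 : Summable fun n => lagDyson m a n s := (summable_norm_lagDyson hm ha s).of_norm
  have h2 : Summable fun n => lagDyson m b n s := (summable_norm_lagDyson hm hb s).of_norm
  rw [lagV, lagV, ← h1.tsum_mul_left, ← h2.tsum_mul_right]
  exact tsum_congr fun n => lagDyson_intertwine hm ha hb hR h n s

/-! ### Comparison with the interaction picture -/

theorem integrableOn_Iio_comp_sub {F : ℝ → HSp} {t : ℝ}
    (h : IntegrableOn (fun τ => F (t - τ)) (Set.Ioi 0)) :
    IntegrableOn F (Set.Iio t) ∧ ∫ s in Set.Iio t, F s = ∫ τ in Set.Ioi 0, F (t - τ) := by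
  have hp : MeasurePreserving (fun τ : ℝ => t - τ) volume volume :=
    Measure.measurePreserving_sub_left _ t
  have hemb : MeasurableEmbedding fun τ : ℝ => t - τ :=
    (MeasurableEquiv.subLeft t).measurableEmbedding
  have hpre : (fun τ : ℝ => t - τ) ⁻¹' Set.Iio t = Set.Ioi 0 := by
    ext τ; simp
  constructor
  · rw [← hp.integrableOn_comp_preimage hemb, hpre]
    exact h
  · rw [← hp.setIntegral_preimage_emb hemb, hpre]

/-- The substitution s = t - τ turns the interaction picture integral into the retarded one. The
formula and the existence of the next integral are coupled, because `dyson` is a `strongIntegral`,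
whose value is meaningful only once convergence is known. -/
theorem dyson_eq_and_hasStrongIntegral (hm : 0 < m) {A : ℝ → E3 → Fin 4 → ℝ}
    (ha : IsSwitchedCurve ε fun s => slashOp (A s)) (n : ℕ) :
    (∀ t, dyson m A n t = freeEvol m t * lagDyson m (fun s => slashOp (A s)) n t * freeEvol m (-t)) ∧
    ∀ t, HasStrongIntegral (volume.restrict (Set.Iio t))
      (fun s => Complex.I • (dyson m A n s * slashInt m A s))
      (freeEvol m t * lagDyson m (fun s => slashOp (A s)) (n + 1) t * freeEvol m (-t)) := by
  have key : ∀ n, (∀ t, dyson m A n t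
        = freeEvol m t * lagDyson m (fun s => slashOp (A s)) n t * freeEvol m (-t)) →
      ∀ t, HasStrongIntegral (volume.restrict (Set.Iio t))
        (fun s => Complex.I • (dyson m A n s * slashInt m A s))
        (freeEvol m t * lagDyson m (fun s => slashOp (A s)) (n + 1) t * freeEvol m (-t)) := by
    intro n hn t
    set Z : ℝ → BOp := fun s => lagDyson m (fun s => slashOp (A s)) n s * slashOp (A s)
    have hZ : IsSwitchedCurve ε Z := ha.mul_left (contDiff_lagDyson hm ha n)
    have h1 := (((hasStrongIntegral_lagInt hm hZ t).smul Complex.I).mul_left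
      (freeEvol m t)).mul_right (freeEvol m (-t))
    have e1 : ∀ s, Complex.I • (dyson m A n s * slashInt m A s)
        = Complex.I • (freeEvol m s * Z s * freeEvol m (-s)) := fun s => by
      rw [hn, slashInt]
      congr 1
      simp only [Z, mul_assoc]
      rw [← mul_assoc (freeEvol m (-s)) (freeEvol m s), freeEvol_neg_mul hm, one_mul]
    have e2 : ∀ τ, freeEvol m t * (Complex.I • lagIntegrand m Z t τ) * freeEvol m (-t)
        = Complex.I • (freeEvol m (t - τ) * Z (t - τ) * freeEvol m (-(t - τ))) := fun τ => by
      rw [lagIntegrand, sub_eq_add_neg t τ, freeEvol_add hm, show -(t + -τ) = τ + -t by ring,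
        freeEvol_add hm τ]
      simp only [mul_smul_comm, smul_mul_assoc, mul_assoc]
    intro f
    obtain ⟨h2, h3⟩ := h1 f
    simp only [e2] at h2 h3
    obtain ⟨h4, h5⟩ := integrableOn_Iio_comp_sub (t := t)
      (F := fun s => (Complex.I • (freeEvol m s * Z s * freeEvol m (-s))) f) h2
    simp only [e1]
    exact ⟨h4, by rw [h5, ← h3]; rfl⟩
  suffices h : ∀ t, dyson m A n t
      = freeEvol m t * lagDyson m (fun s => slashOp (A s)) n t * freeEvol m (-t) from
    ⟨h, key n h⟩
  induction n with
  | zero =>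
    intro t
    rw [dyson, lagDyson, mul_one, freeEvol_mul_neg hm]
  | succ n ih =>
    intro t
    rw [dyson]
    exact (key n ih t).strongIntegral_eq

theorem Vop_eq (hm : 0 < m) {A : ℝ → E3 → Fin 4 → ℝ}
    (ha : IsSwitchedCurve ε fun s => slashOp (A s)) (t : ℝ) :
    Vop m A t = freeEvol m t * lagV m (fun s => slashOp (A s)) t * freeEvol m (-t) := by
  have h1 : Summable fun n => lagDyson m (fun s => slashOp (A s)) n t :=
    (summable_norm_lagDyson hm ha t).of_norm
  rw [Vop, lagV, ← h1.tsum_mul_left, ← (h1.mul_left _).tsum_mul_right]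
  exact tsum_congr fun n => (dyson_eq_and_hasStrongIntegral hm ha n).1 t

theorem summable_norm_dyson (hm : 0 < m) {A : ℝ → E3 → Fin 4 → ℝ}
    (ha : IsSwitchedCurve ε fun s => slashOp (A s)) (t : ℝ) :
    Summable fun n => ‖dyson m A n t‖ := by
  refine (summable_norm_lagDyson hm ha t).of_nonneg_of_le (fun _ => norm_nonneg _) fun n => ?_
  rw [(dyson_eq_and_hasStrongIntegral hm ha n).1 t]
  exact norm_conj_freeEvol_le hm _ _ _

end

end DiracEntropy

namespace DiracEntropy
open Filter Topology
open scoped ContDiff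

/-! ### Smooth matrix fields -/

theorem coe_smul_symbol (r : ℝ) (M : SOp) : (r : ℂ) • M = r • M := by
  ext v i
  simp

/-- Smooth matrix-valued functions on spacetime with spatial support in a fixed compact set. -/
structure IsField (B : ℝ × E3 → SOp) : Prop where
  smooth : ContDiff ℝ ∞ B
  supp : ∃ C : Set E3, IsCompact C ∧ ∀ t, ∀ x ∉ C, B (t, x) = 0

/-- Multiplication by the field at time `s`. -/
def fieldOp (B : ℝ × E3 → SOp) (s : ℝ) : BOp := mulOp fun x => B (s, x)

/-- The derivative of a field in the direction `v`. -/
def dirDeriv (v : ℝ × E3) (B : ℝ × E3 → SOp) (z : ℝ × E3) : SOp := fderiv ℝ B z v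

namespace IsField
variable {B : ℝ × E3 → SOp}

theorem dir (hB : IsField B) (v : ℝ × E3) : IsField (dirDeriv v B) := by
  obtain ⟨C, hC, h0⟩ := hB.supp
  refine ⟨(hB.smooth.fderiv_right (m := ∞) (by simp)).clm_apply contDiff_const, C, hC,
    fun t x hx => ?_⟩
  have h : B =ᶠ[𝓝 (t, x)] fun _ => 0 := by
    have : (Prod.snd ⁻¹' Cᶜ : Set (ℝ × E3)) ∈ 𝓝 (t, x) :=
      (hC.isClosed.isOpen_compl.preimage continuous_snd).mem_nhds hx
    filter_upwards [this] with z hz using h0 z.1 z.2 hz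
  rw [dirDeriv, h.fderiv_eq]
  simp

theorem exists_bound (hB : IsField B) (a b : ℝ) :
    ∃ M, 0 ≤ M ∧ ∀ s ∈ Set.Icc a b, ∀ x, ‖B (s, x)‖ ≤ M := by
  obtain ⟨C, hC, h0⟩ := hB.supp
  obtain ⟨M, hM⟩ := (isCompact_Icc (a := a) (b := b)).prod hC |>.exists_bound_of_continuousOn
    hB.smooth.continuous.continuousOn
  refine ⟨max M 0, le_max_right _ _, fun s hs x => ?_⟩
  by_cases hx : x ∈ C
  · exact (hM (s, x) ⟨hs, hx⟩).trans (le_max_left _ _)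
  · rw [h0 s x hx, norm_zero]; exact le_max_right _ _

theorem memLp (hB : IsField B) (s : ℝ) : MemLp (fun x => B (s, x)) ⊤ (volume : Measure E3) := by
  obtain ⟨M, -, hM⟩ := hB.exists_bound s s
  exact memLp_symbol (hB.smooth.continuous.comp (by fun_prop)).aestronglyMeasurable
    fun x => hM s ⟨le_rfl, le_rfl⟩ x

theorem hasDerivAt (hB : IsField B) (s : ℝ) (x : E3) :
    HasDerivAt (fun t => B (t, x)) (dirDeriv (1, 0) B (s, x)) s := by
  have h1 : HasFDerivAt B (fderiv ℝ B (s, x)) (s, x) :=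
    (hB.smooth.differentiable (by simp) _).hasFDerivAt
  have h2 : HasDerivAt (fun t : ℝ => (t, x)) ((1 : ℝ), (0 : E3)) s :=
    (hasDerivAt_id s).prodMk (hasDerivAt_const s x)
  exact h1.comp_hasDerivAt s h2

/-- Differentiability in operator norm needs a Taylor remainder that is uniform in x. It comes from
the second time derivative, which is bounded on a compact time interval because the spatial support
is compact. -/
theorem hasDerivAt_fieldOp (hB : IsField B) (s : ℝ) :
    HasDerivAt (fieldOp B) (fieldOp (dirDeriv (1, 0) B) s) s := by
  have hB' := hB.dir (1, 0)
  obtain ⟨M, hM0, hM⟩ := (hB'.dir (1, 0)).exists_bound (s - 1) (s + 1)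
  have key : ∀ u ∈ Set.Icc (s - 1) (s + 1), ∀ x,
      ‖B (u, x) - B (s, x) - (u - s) • dirDeriv (1, 0) B (s, x)‖ ≤ M * (u - s) ^ 2 := by
    intro u hu x
    have hsub : Set.uIcc s u ⊆ Set.Icc (s - 1) (s + 1) :=
      Set.uIcc_subset_Icc ⟨by linarith, by linarith⟩ hu
    have h1 : ∀ v ∈ Set.uIcc s u,
        ‖dirDeriv (1, 0) B (v, x) - dirDeriv (1, 0) B (s, x)‖ ≤ M * |u - s| := fun v hv => by
      have := Convex.norm_image_sub_le_of_norm_hasDerivWithin_le (𝕜 := ℝ)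
        (f := fun t => dirDeriv (1, 0) B (t, x)) (s := Set.uIcc s u) (C := M)
        (fun t _ => (hB'.hasDerivAt t x).hasDerivWithinAt)
        (fun t ht => hM t (hsub ht) x) (convex_uIcc s u) Set.left_mem_uIcc hv
      refine this.trans (mul_le_mul_of_nonneg_left ?_ hM0)
      rw [Real.norm_eq_abs]
      exact Set.abs_sub_left_of_mem_uIcc hv
    have h2 := Convex.norm_image_sub_le_of_norm_hasDerivWithin_le (𝕜 := ℝ)
        (f := fun t => B (t, x) - (t - s) • dirDeriv (1, 0) B (s, x)) (s := Set.uIcc s u)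
        (C := M * |u - s|)
        (fun t _ => ((hB.hasDerivAt t x).fun_sub
          (((hasDerivAt_id t).sub_const s).smul_const _)).hasDerivWithinAt)
        (fun t ht => by simpa using h1 t ht) (convex_uIcc s u) Set.left_mem_uIcc
        Set.right_mem_uIcc
    have e0 : (s - s) • dirDeriv (1, 0) B (s, x) = 0 := by
      ext v i; simp
    rw [e0, sub_zero, Real.norm_eq_abs, mul_assoc, ← sq, sq_abs] at h2
    rwa [sub_right_comm]
  rw [hasDerivAt_iff_isLittleO]
  refine Asymptotics.IsBigO.trans_isLittleO (g := fun u => (u - s) ^ 2) ?_ ?_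
  · refine Asymptotics.IsBigO.of_bound M ?_
    filter_upwards [Icc_mem_nhds (show s - 1 < s by linarith) (show s < s + 1 by linarith)]
      with u hu
    have e : fieldOp B u - fieldOp B s - (u - s) • fieldOp (dirDeriv (1, 0) B) s
        = mulOp fun x => (B (u, x) - B (s, x)) - ((u - s : ℝ) : ℂ) • dirDeriv (1, 0) B (s, x) := by
      have hs : MemLp (fun x => ((u - s : ℝ) : ℂ) • dirDeriv (1, 0) B (s, x)) ⊤
          (volume : Measure E3) := (hB'.memLp s).const_smul ((u - s : ℝ) : ℂ)
      have hd : MemLp (fun x => B (u, x) - B (s, x)) ⊤ (volume : Measure E3) :=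
        (hB.memLp u).sub (hB.memLp s)
      rw [mulOp_sub hd hs,
        mulOp_smul (hB'.memLp s), mulOp_sub (hB.memLp u) (hB.memLp s), Complex.coe_smul]
      rfl
    rw [e, Real.norm_eq_abs, abs_of_nonneg (sq_nonneg _)]
    refine norm_mulOp_le (by positivity) fun x => ?_
    rw [coe_smul_symbol]
    exact key u hu x
  · have := Asymptotics.isLittleO_pow_sub_sub s (m := 2) (by norm_num)
    simpa using this

theorem contDiff_fieldOp (hB : IsField B) : ContDiff ℝ ∞ (fieldOp B) := by
  have key : ∀ (n : ℕ) (B : ℝ × E3 → SOp), IsField B → ContDiff ℝ n (fieldOp B) := by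
    intro n
    induction n with
    | zero =>
      intro B hB
      exact contDiff_zero.2
        (continuous_iff_continuousAt.2 fun s => (hB.hasDerivAt_fieldOp s).continuousAt)
    | succ n ih =>
      intro B hB
      push_cast
      rw [contDiff_succ_iff_deriv]
      refine ⟨fun s => (hB.hasDerivAt_fieldOp s).differentiableAt, by simp, ?_⟩
      rw [show deriv (fieldOp B) = fieldOp (dirDeriv (1, 0) B) from
        funext fun s => (hB.hasDerivAt_fieldOp s).deriv]
      exact ih _ (hB.dir _)
  exact contDiff_infty.2 fun n => key n B hB

theorem deriv_fieldOp (hB : IsField B) : deriv (fieldOp B) = fieldOp (dirDeriv (1, 0) B) :=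
  funext fun s => (hB.hasDerivAt_fieldOp s).deriv

end IsField

/-! ### The field of a potential -/

/-- `a ↦ a⁰ + α·a` as a continuous linear map. -/
def slashCLM : (Fin 4 → ℝ) →L[ℝ] SOp :=
  ContinuousLinearMap.smulRight (ContinuousLinearMap.proj 0) (1 : SOp) +
    ∑ j : Fin 3, ContinuousLinearMap.smulRight (ContinuousLinearMap.proj j.succ)
      (matOp (alphaMat j))

theorem slashCLM_apply (a : Fin 4 → ℝ) :
    slashCLM a = matOp ((a 0 : ℂ) • (1 : Matrix (Fin 4) (Fin 4) ℂ)
    + ∑ j : Fin 3, (a j.succ : ℂ) • alphaMat j) := by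
  have h : matOp (∑ j : Fin 3, (a j.succ : ℂ) • alphaMat j)
      = ∑ j : Fin 3, (a j.succ : ℂ) • matOp (alphaMat j) := by
    simp only [Fin.sum_univ_three, matOp_add, matOp_smul]
  rw [matOp_add, h, matOp_smul, matOp_one]
  simp only [coe_smul_symbol]
  simp [slashCLM]

theorem slashCLM_adjoint (a : Fin 4 → ℝ) :
    ContinuousLinearMap.adjoint (slashCLM a) = slashCLM a := by
  rw [slashCLM_apply, matOp_adjoint]
  congr 1
  simp [Matrix.conjTranspose_add, Matrix.conjTranspose_smul, Fin.sum_univ_three,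
    alphaMat_isHermitian]

theorem slashOp_eq (a : E3 → Fin 4 → ℝ) : slashOp a = mulOp fun x => slashCLM (a x) := by
  simp only [slashOp, slashCLM_apply]

namespace IsSwitchedPotential
variable {ε : ℝ} {A : ℝ → E3 → Fin 4 → ℝ}

theorem isField (hA : IsSwitchedPotential ε A) : IsField fun z => slashCLM (A z.1 z.2) := by
  obtain ⟨C, hC, h0⟩ := hA.compact_support
  exact ⟨slashCLM.contDiff.comp hA.smooth, C, hC, fun t x hx => by simp [h0 t x hx]⟩

theorem slashOp_eq_fieldOp (A : ℝ → E3 → Fin 4 → ℝ) (s : ℝ) :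
    slashOp (A s) = fieldOp (fun z => slashCLM (A z.1 z.2)) s := slashOp_eq _

theorem slashOp_dotPot (hA : IsSwitchedPotential ε A) (s : ℝ) :
    slashOp (dotPot A s) = fieldOp (dirDeriv (1, 0) fun z => slashCLM (A z.1 z.2)) s := by
  rw [slashOp_eq, fieldOp]
  congr 1
  ext1 x
  have h1 : DifferentiableAt ℝ (fun t => A t x) s := by
    have h := hA.smooth.differentiable (by simp) (s, x)
    exact h.comp s (f := fun t : ℝ => (t, x)) (by fun_prop)
  have h2 : dotPot A s x = deriv (fun t => A t x) s := by
    ext μ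
    rw [dotPot, deriv_pi (fun i => differentiableAt_pi.1 h1 i)]
  have h3 := (slashCLM.hasFDerivAt.comp_hasDerivAt s h1.hasDerivAt)
  rw [h2]
  exact h3.unique (hA.isField.hasDerivAt s x)

theorem isSwitchedCurve (hA : IsSwitchedPotential ε A) :
    IsSwitchedCurve ε fun s => slashOp (A s) := by
  have e : (fun s => slashOp (A s)) = fieldOp fun z => slashCLM (A z.1 z.2) :=
    funext fun s => slashOp_eq_fieldOp A s
  refine ⟨e ▸ hA.isField.contDiff_fieldOp, fun s hs => ?_⟩
  rw [slashOp_eq, hA.vanish s hs]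
  simpa using mulOp_zero

theorem deriv_slashOp (hA : IsSwitchedPotential ε A) (s : ℝ) :
    deriv (fun s => slashOp (A s)) s = slashOp (dotPot A s) := by
  have e : (fun s => slashOp (A s)) = fieldOp fun z => slashCLM (A z.1 z.2) :=
    funext fun s => slashOp_eq_fieldOp A s
  rw [hA.slashOp_dotPot, e, hA.isField.deriv_fieldOp]

theorem slashOp_adjoint (a : E3 → Fin 4 → ℝ) (h : MemLp (fun x => slashCLM (a x)) ⊤ (volume : Measure E3)) :
    ContinuousLinearMap.adjoint (slashOp a) = slashOp a := by
  rw [slashOp_eq, mulOp_adjoint h]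
  simp only [slashCLM_adjoint]

end IsSwitchedPotential

end DiracEntropy

namespace DiracEntropy
open Filter Topology
open scoped ContDiff SchwartzMap FourierTransform LineDeriv

/-! ### Commuting multiplication operators with `D⁻²` -/

/-- The unit vectors of space. -/
def unitVec (j : Fin 3) : E3 := EuclideanSpace.single j 1

section
variable {m : ℝ}

/-- The symbol of a scalar function of the momentum. -/
def scalarSymbol (g : E3 → ℂ) (p : E3) : SOp := g p • (1 : SOp)

/-- `D⁻² = (m² - Δ)⁻¹`. -/
def resolvent (m : ℝ) : BOp := fourierMul (scalarSymbol fun p => ((omega m p ^ 2 : ℝ) : ℂ)⁻¹)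

/-- `∂ⱼ D⁻²`. -/
def derivResolvent (m : ℝ) (j : Fin 3) : BOp :=
  fourierMul (scalarSymbol fun p => Complex.I * p j * ((omega m p ^ 2 : ℝ) : ℂ)⁻¹)

theorem isSymbol_scalarSymbol {g : E3 → ℂ} (hg : Continuous g) {C : ℝ} (hC : ∀ p, ‖g p‖ ≤ C) :
    IsSymbol (scalarSymbol g) where
  meas := (hg.smul continuous_const).stronglyMeasurable
  bdd := ⟨C, fun p => by
    rw [scalarSymbol, norm_smul]
    exact (mul_le_of_le_one_right (norm_nonneg _) ContinuousLinearMap.norm_id_le).trans (hC p)⟩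

theorem continuous_omega_sq_inv (hm : 0 < m) :
    Continuous fun p => ((omega m p ^ 2 : ℝ) : ℂ)⁻¹ := by
  refine Continuous.inv₀ (Complex.continuous_ofReal.comp ((continuous_omega m).pow 2)) fun p => ?_
  exact_mod_cast (pow_pos (omega_pos hm p) 2).ne'

theorem norm_omega_sq_inv_le (hm : 0 < m) (p : E3) :
    ‖((omega m p ^ 2 : ℝ) : ℂ)⁻¹‖ ≤ (m ^ 2)⁻¹ := by
  rw [norm_inv, Complex.norm_real, Real.norm_eq_abs, abs_of_nonneg (sq_nonneg _)]
  have := omega_ge m p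
  gcongr

theorem isSymbol_resolvent (hm : 0 < m) :
    IsSymbol (scalarSymbol fun p => ((omega m p ^ 2 : ℝ) : ℂ)⁻¹) :=
  isSymbol_scalarSymbol (continuous_omega_sq_inv hm) (norm_omega_sq_inv_le hm)

theorem isSymbol_derivResolvent (hm : 0 < m) (j : Fin 3) :
    IsSymbol (scalarSymbol fun p => Complex.I * p j * ((omega m p ^ 2 : ℝ) : ℂ)⁻¹) := by
  refine isSymbol_scalarSymbol (C := m⁻¹) ((by fun_prop : Continuous fun p : E3 =>
    Complex.I * (p j : ℂ)).mul (continuous_omega_sq_inv hm)) fun p => ?_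
  have h0 := omega_pos hm p
  have h1 : |p j| ≤ omega m p := by
    refine (PiLp.norm_apply_le p j).trans (abs_le_of_sq_le_sq' ?_ h0.le).2
    rw [omega_sq]; nlinarith
  rw [norm_mul, norm_mul, Complex.norm_I, one_mul, Complex.norm_real, norm_inv, Complex.norm_real,
    Real.norm_eq_abs, Real.norm_eq_abs, abs_of_nonneg (sq_nonneg (omega m p)), ← div_eq_mul_inv]
  rw [div_le_iff₀ (by positivity)]
  have h2 := omega_ge m p
  have h3 : m⁻¹ * omega m p ^ 2 = omega m p * (omega m p / m) := by ring
  rw [h3]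
  have h4 : 1 ≤ omega m p / m := (one_le_div hm).2 h2
  nlinarith

theorem resolvent_comm_derivResolvent (hm : 0 < m) (j : Fin 3) :
    resolvent m * derivResolvent m j = derivResolvent m j * resolvent m := by
  rw [resolvent, derivResolvent, fourierMul_mul (isSymbol_resolvent hm)
    (isSymbol_derivResolvent hm j), fourierMul_mul (isSymbol_derivResolvent hm j)
    (isSymbol_resolvent hm)]
  congr 1
  ext1 p
  simp only [scalarSymbol, smul_mul_smul_comm, mul_one]
  rw [mul_comm]

/-- Reduces an identity between Fourier multipliers and differential operators on Schwartz functions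
to a pointwise identity of Fourier transforms. -/
theorem fourierMul_toLp {M : E3 → SOp} (hM : IsSymbol M) {ψ φ : 𝓢(E3, Spinor)}
    (h : ∀ ξ, M ((2 * Real.pi) • ξ) (𝓕 ψ ξ) = 𝓕 φ ξ) :
    fourierMul M (ψ.toLp 2) = φ.toLp 2 := by
  rw [fourierMul_apply, LinearIsometryEquiv.symm_apply_eq]
  have e1 : fourierU (ψ.toLp 2) = (𝓕 ψ).toLp 2 := SchwartzMap.toLp_fourier_eq ψ
  have e2 : fourierU (φ.toLp 2) = (𝓕 φ).toLp 2 := SchwartzMap.toLp_fourier_eq φ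
  rw [e1, e2]
  ext1
  filter_upwards [mulOp_coeFn hM.memLp ((𝓕 ψ).toLp 2), (𝓕 ψ).coeFn_toLp 2, (𝓕 φ).coeFn_toLp 2]
    with ξ h1 h2 h3
  rw [h1, h2, h3, h]

/-- `(m² - Δ) φ`. -/
def helmholtz (m : ℝ) (φ : 𝓢(E3, Spinor)) : 𝓢(E3, Spinor) :=
  ((m ^ 2 : ℝ) : ℂ) • φ - ∑ j, ∂_{unitVec j} (∂_{unitVec j} φ)

theorem fourier_deriv_apply (φ : 𝓢(E3, Spinor)) (j : Fin 3) (ξ : E3) :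
    𝓕 (∂_{unitVec j} φ) ξ = (2 * Real.pi * Complex.I * ξ j) • 𝓕 φ ξ := by
  rw [SchwartzMap.fourier_lineDerivOp_eq, smul_apply,
    SchwartzMap.smulLeftCLM_apply_apply (by fun_prop)]
  have : inner ℝ ξ (unitVec j) = ξ j := by
    simp [unitVec, EuclideanSpace.inner_single_right]
  rw [this, mul_smul _ (ξ j : ℂ)]
  rfl

theorem fourier_helmholtz (m : ℝ) (φ : 𝓢(E3, Spinor)) (ξ : E3) :
    𝓕 (helmholtz m φ) ξ = ((omega m ((2 * Real.pi) • ξ) ^ 2 : ℝ) : ℂ) • 𝓕 φ ξ := by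
  have e : 𝓕 (helmholtz m φ) = ((m ^ 2 : ℝ) : ℂ) • 𝓕 φ
      - ∑ j, 𝓕 (∂_{unitVec j} (∂_{unitVec j} φ)) := by
    have h := (map_sub (FourierTransform.fourierCLE ℂ 𝓢(E3, Spinor)) (((m ^ 2 : ℝ) : ℂ) • φ)
      (∑ j, ∂_{unitVec j} (∂_{unitVec j} φ)))
    rw [map_smul, map_sum] at h
    exact h
  have h3 : ((omega m ((2 * Real.pi) • ξ) ^ 2 : ℝ) : ℂ)
      = (m : ℂ) ^ 2 + ∑ j, (2 * Real.pi * ξ j : ℂ) ^ 2 := by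
    rw [omega_sq, EuclideanSpace.norm_sq_eq]
    simp only [Fin.sum_univ_three, Real.norm_eq_abs, sq_abs, PiLp.smul_apply, smul_eq_mul]
    push_cast
    ring
  rw [e, h3]
  simp only [Fin.sum_univ_three, sub_apply, add_apply, smul_apply, fourier_deriv_apply, smul_smul, ← add_smul, ← sub_smul]
  congr 1
  have := Complex.I_sq
  push_cast
  linear_combination (-(4 * Real.pi ^ 2 * (ξ 0 ^ 2 + ξ 1 ^ 2 + ξ 2 ^ 2)) : ℂ) * this

theorem resolvent_helmholtz (hm : 0 < m) (φ : 𝓢(E3, Spinor)) :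
    resolvent m ((helmholtz m φ).toLp 2) = φ.toLp 2 := by
  refine fourierMul_toLp (isSymbol_resolvent hm) fun ξ => ?_
  have : ((omega m ((2 * Real.pi) • ξ) ^ 2 : ℝ) : ℂ) ≠ 0 := by
    exact_mod_cast (pow_pos (omega_pos hm _) 2).ne'
  rw [fourier_helmholtz, scalarSymbol, smul_apply, one_apply_eq_self, smul_smul,
    inv_mul_cancel₀ this, one_smul]

theorem derivResolvent_helmholtz (hm : 0 < m) (j : Fin 3) (φ : 𝓢(E3, Spinor)) :
    derivResolvent m j ((helmholtz m φ).toLp 2) = (∂_{unitVec j} φ).toLp 2 := by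
  refine fourierMul_toLp (isSymbol_derivResolvent hm j) fun ξ => ?_
  have : ((omega m ((2 * Real.pi) • ξ) ^ 2 : ℝ) : ℂ) ≠ 0 := by
    exact_mod_cast (pow_pos (omega_pos hm _) 2).ne'
  rw [fourier_helmholtz, scalarSymbol, smul_apply, one_apply_eq_self, smul_smul,
    mul_assoc, inv_mul_cancel₀ this, mul_one, fourier_deriv_apply]
  congr 1
  simp
  ring

/-- Divide the Fourier transform by ω². The rescaling L makes ω⁻² equal to m⁻²(1 + |Lξ|²)⁻¹, a
function of temperate growth, so the quotient is again a Schwartz function. -/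
theorem helmholtz_surjective (hm : 0 < m) (g : 𝓢(E3, Spinor)) : ∃ φ, helmholtz m φ = g := by
  set L : E3 →L[ℝ] E3 := (2 * Real.pi / m) • ContinuousLinearMap.id ℝ E3
  set w : E3 → ℝ := fun ξ => (m ^ 2)⁻¹ * (1 + ‖L ξ‖ ^ 2) ^ (-1 : ℝ)
  have hw : Function.HasTemperateGrowth w := by
    have h1 := (Function.hasTemperateGrowth_one_add_norm_sq_rpow E3 (-1)).comp
      L.hasTemperateGrowth
    exact (Function.HasTemperateGrowth.const _).mul h1
  have hw2 : ∀ ξ, omega m ((2 * Real.pi) • ξ) ^ 2 * w ξ = 1 := fun ξ => by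
    have h2 : omega m ((2 * Real.pi) • ξ) ^ 2 = m ^ 2 * (1 + ‖L ξ‖ ^ 2) := by
      have : L ξ = (2 * Real.pi / m) • ξ := rfl
      rw [omega_sq, this, norm_smul, norm_smul, Real.norm_eq_abs, Real.norm_eq_abs, mul_pow,
        mul_pow, sq_abs, sq_abs]
      field_simp
      ring
    have h3 : 0 < 1 + ‖L ξ‖ ^ 2 := by positivity
    simp only [w]
    rw [h2, Real.rpow_neg_one]
    field_simp
  refine ⟨𝓕⁻ (SchwartzMap.smulLeftCLM Spinor w (𝓕 g)), ?_⟩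
  apply (FourierTransform.fourierCLE ℂ 𝓢(E3, Spinor)).injective
  rw [FourierTransform.fourierCLE_apply, FourierTransform.fourierCLE_apply]
  ext1 ξ
  rw [fourier_helmholtz, FourierTransform.fourier_fourierInv_eq,
    SchwartzMap.smulLeftCLM_apply_apply hw]
  have h4 : w ξ • 𝓕 g ξ = (w ξ : ℂ) • 𝓕 g ξ := rfl
  rw [h4, smul_smul, ← Complex.ofReal_mul, hw2, Complex.ofReal_one, one_smul]

theorem BOp_ext_schwartz {S T : BOp} (h : ∀ φ : 𝓢(E3, Spinor), S (φ.toLp 2) = T (φ.toLp 2)) :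
    S = T := by
  have hd := SchwartzMap.denseRange_toLpCLM (E := E3) (F := Spinor) (p := 2) (by simp)
    (μ := (volume : Measure E3))
  exact ContinuousLinearMap.coeFn_injective
    (hd.equalizer S.continuous T.continuous (funext fun φ => h φ))

end

end DiracEntropy

namespace DiracEntropy
open Filter Topology
open scoped ContDiff SchwartzMap FourierTransform LineDeriv

/-! ### The Leibniz rule and the commutation of smooth fields with D⁻². -/

namespace IsField
variable {m : ℝ} {B : ℝ × E3 → SOp}

/-- The derivative of a field in the `j`-th spatial direction. -/
abbrev _root_.DiracEntropy.spaceDeriv (j : Fin 3) (B : ℝ × E3 → SOp) : ℝ × E3 → SOp :=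
  dirDeriv (0, unitVec j) B

theorem contDiff_slice (hB : IsField B) (s : ℝ) : ContDiff ℝ ∞ fun x => B (s, x) :=
  hB.smooth.comp (by fun_prop)

theorem contDiff_apply (hB : IsField B) (s : ℝ) (φ : 𝓢(E3, Spinor)) :
    ContDiff ℝ ∞ fun x => B (s, x) (φ x) := by
  have h := (ContinuousLinearMap.restrictScalarsL ℂ Spinor Spinor ℝ ℝ).contDiff.comp
    (hB.contDiff_slice s)
  exact h.clm_apply (φ.smooth ⊤)

theorem hasCompactSupport_apply (hB : IsField B) (s : ℝ) (φ : 𝓢(E3, Spinor)) :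
    HasCompactSupport fun x => B (s, x) (φ x) := by
  obtain ⟨C, hC, h0⟩ := hB.supp
  exact HasCompactSupport.intro hC fun x hx => by simp [h0 s x hx]

/-- The product of a field at time `s` and a Schwartz function. -/
def mulSchwartz (hB : IsField B) (s : ℝ) (φ : 𝓢(E3, Spinor)) : 𝓢(E3, Spinor) :=
  (hB.hasCompactSupport_apply s φ).toSchwartzMap (hB.contDiff_apply s φ)

theorem mulSchwartz_apply (hB : IsField B) (s : ℝ) (φ : 𝓢(E3, Spinor)) (x : E3) :
    hB.mulSchwartz s φ x = B (s, x) (φ x) := rfl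

theorem fieldOp_toLp (hB : IsField B) (s : ℝ) (φ : 𝓢(E3, Spinor)) :
    fieldOp B s (φ.toLp 2) = (hB.mulSchwartz s φ).toLp 2 := by
  ext1
  filter_upwards [mulOp_coeFn (hB.memLp s) (φ.toLp 2), φ.coeFn_toLp 2,
    (hB.mulSchwartz s φ).coeFn_toLp 2] with x h1 h2 h3
  rw [fieldOp, h1, h2, h3, mulSchwartz_apply]

theorem deriv_mulSchwartz (hB : IsField B) (s : ℝ) (φ : 𝓢(E3, Spinor)) (j : Fin 3) :
    ∂_{unitVec j} (hB.mulSchwartz s φ)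
      = (hB.dir (0, unitVec j)).mulSchwartz s φ + hB.mulSchwartz s (∂_{unitVec j} φ) := by
  ext1 x
  rw [SchwartzMap.lineDerivOp_apply_eq_fderiv, add_apply, mulSchwartz_apply,
    mulSchwartz_apply, SchwartzMap.lineDerivOp_apply_eq_fderiv]
  have h1 : HasFDerivAt B (fderiv ℝ B (s, x)) (s, x) :=
    (hB.smooth.differentiable (by simp) _).hasFDerivAt
  have h2 : HasFDerivAt (fun y : E3 => (s, y)) (ContinuousLinearMap.inr ℝ ℝ E3) x :=
    hasFDerivAt_prodMk_right s x
  have h3 := (ContinuousLinearMap.restrictScalarsL ℂ Spinor Spinor ℝ ℝ).hasFDerivAt.comp x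
    (h1.comp x h2)
  have h4 := h3.clm_apply (φ.differentiableAt (x := x)).hasFDerivAt
  have h5 : (hB.mulSchwartz s φ : E3 → Spinor) = fun y => B (s, y) (φ y) := rfl
  rw [h5]
  have h6 := h4.fderiv
  refine (congrArg (fun T : E3 →L[ℝ] Spinor => T (unitVec j)) h6).trans ?_
  simp [dirDeriv, add_comm]

/-- The Leibniz rule for `m² - Δ`. -/
theorem helmholtz_mulSchwartz (hB : IsField B) (s : ℝ) (φ : 𝓢(E3, Spinor)) :
    hB.mulSchwartz s (helmholtz m φ) = helmholtz m (hB.mulSchwartz s φ)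
      + ∑ j, (((hB.dir (0, unitVec j)).dir (0, unitVec j)).mulSchwartz s φ
        + (2 : ℂ) • (hB.dir (0, unitVec j)).mulSchwartz s (∂_{unitVec j} φ)) := by
  have h : ∀ j, ∂_{unitVec j} (∂_{unitVec j} (hB.mulSchwartz s φ))
      = ((hB.dir (0, unitVec j)).dir (0, unitVec j)).mulSchwartz s φ
        + (2 : ℂ) • (hB.dir (0, unitVec j)).mulSchwartz s (∂_{unitVec j} φ)
        + hB.mulSchwartz s (∂_{unitVec j} (∂_{unitVec j} φ)) := fun j => by
    rw [hB.deriv_mulSchwartz, LineDeriv.lineDerivOp_add, deriv_mulSchwartz,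
      deriv_mulSchwartz]
    module
  simp only [helmholtz, h, Fin.sum_univ_three]
  ext1 x
  simp only [mulSchwartz_apply, add_apply, sub_apply, smul_apply, map_sub, map_add, map_smul]
  module

/-- `mulOp b D⁻² = D⁻² · commRes b`. -/
def _root_.DiracEntropy.commRes (m : ℝ) (B : ℝ × E3 → SOp) (s : ℝ) : BOp :=
  fieldOp B s - ∑ j, (fieldOp (spaceDeriv j (spaceDeriv j B)) s * resolvent m
    + (2 : ℂ) • (fieldOp (spaceDeriv j B) s * derivResolvent m j))

/-- Test on g = (m² - Δ)φ, which covers all Schwartz functions. Then B D⁻² g = Bφ = D⁻²(m² - Δ)(Bφ),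
and the Leibniz rule rewrites (m² - Δ)(Bφ) as `commRes` applied to g. -/
theorem fieldOp_mul_resolvent (hm : 0 < m) (hB : IsField B) (s : ℝ) :
    fieldOp B s * resolvent m = resolvent m * commRes m B s := by
  refine BOp_ext_schwartz fun g => ?_
  obtain ⟨φ, rfl⟩ := helmholtz_surjective hm g
  have h1 : ∀ j, (fieldOp (spaceDeriv j (spaceDeriv j B)) s * resolvent m
      + (2 : ℂ) • (fieldOp (spaceDeriv j B) s * derivResolvent m j)) ((helmholtz m φ).toLp 2)
      = (((hB.dir (0, unitVec j)).dir (0, unitVec j)).mulSchwartz s φ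
        + (2 : ℂ) • (hB.dir (0, unitVec j)).mulSchwartz s (∂_{unitVec j} φ)).toLp 2 := fun j => by
    rw [add_apply, smul_apply, mul_apply_eq_comp, mul_apply_eq_comp, resolvent_helmholtz hm,
      derivResolvent_helmholtz hm, ((hB.dir (0, unitVec j)).dir (0, unitVec j)).fieldOp_toLp,
      (hB.dir (0, unitVec j)).fieldOp_toLp]
    simp only [← SchwartzMap.toLpCLM_apply (𝕜 := ℂ), map_add, map_smul]
  have h2 : commRes m B s ((helmholtz m φ).toLp 2) = (helmholtz m (hB.mulSchwartz s φ)).toLp 2 := by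
    rw [commRes, sub_apply, hB.fieldOp_toLp, sum_apply, Finset.sum_congr rfl fun j _ => h1 j,
      hB.helmholtz_mulSchwartz (m := m)]
    simp only [← SchwartzMap.toLpCLM_apply (𝕜 := ℂ), map_add, map_sum]
    abel
  rw [mul_apply_eq_comp, mul_apply_eq_comp, h2, resolvent_helmholtz hm, resolvent_helmholtz hm,
    hB.fieldOp_toLp]

end IsField

end DiracEntropy

namespace DiracEntropy
open Filter Topology
open scoped ContDiff SchwartzMap FourierTransform LineDeriv

/-! ### Localized `D⁻²` is a Hilbert-Schmidt operator -/

section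
variable {m : ℝ}

/-- The function `ω⁻²` of the Fourier variable `ξ = p/2π`. -/
def omegaInv (m : ℝ) (ξ : E3) : ℝ := (omega m ((2 * Real.pi) • ξ) ^ 2)⁻¹

theorem omegaInv_pos (hm : 0 < m) (ξ : E3) : 0 < omegaInv m ξ :=
  inv_pos.2 (pow_pos (omega_pos hm _) 2)

theorem continuous_omegaInv (hm : 0 < m) : Continuous (omegaInv m) :=
  Continuous.inv₀ (((continuous_omega m).comp (by fun_prop)).pow 2)
    fun ξ => (pow_pos (omega_pos hm _) 2).ne'

/-- Dimension three enters here: ω⁻⁴ decays like |ξ|⁻⁴ and 4 > 3. The constant c below gives ω² ≥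
c(1 + |ξ|²). -/
theorem integrable_omegaInv_sq (hm : 0 < m) : Integrable fun ξ => omegaInv m ξ ^ 2 := by
  have h := integrable_rpow_neg_one_add_norm_sq (E := E3) (μ := volume) (r := 4)
    (by rw [finrank_euclideanSpace]; norm_num)
  set c := min (m ^ 2) ((2 * Real.pi) ^ 2)
  have hc : 0 < c := lt_min (by positivity) (by positivity)
  refine (h.const_mul (c ^ 2)⁻¹).mono' ((continuous_omegaInv hm).pow 2).aestronglyMeasurable
    (ae_of_all _ fun ξ => ?_)
  have h1 : c * (1 + ‖ξ‖ ^ 2) ≤ omega m ((2 * Real.pi) • ξ) ^ 2 := by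
    rw [omega_sq, norm_smul, mul_pow, Real.norm_eq_abs, sq_abs]
    nlinarith [min_le_left (m ^ 2) ((2 * Real.pi) ^ 2), min_le_right (m ^ 2) ((2 * Real.pi) ^ 2),
      sq_nonneg ‖ξ‖]
  have h2 : (1 + ‖ξ‖ ^ 2) ^ (-(4 : ℝ) / 2) = ((1 + ‖ξ‖ ^ 2) ^ 2)⁻¹ := by
    rw [show (-(4 : ℝ) / 2) = -((2 : ℕ) : ℝ) by norm_num, Real.rpow_neg (by positivity),
      Real.rpow_natCast]
  rw [h2, ← mul_inv, ← mul_pow, Real.norm_eq_abs, abs_of_nonneg (sq_nonneg _), omegaInv, inv_pow]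
  have : 0 < c * (1 + ‖ξ‖ ^ 2) := by positivity
  gcongr

/-- The function `e^{-2πi x·ξ} ω⁻² e_a`, which represents the evaluation at `x` of the `a`-th component
of `D⁻² f`. -/
def evalFn (m : ℝ) (x : E3) (a : Fin 4) (ξ : E3) : Spinor :=
  (Complex.exp (-(2 * Real.pi * inner ℝ ξ x : ℝ) * Complex.I) * (omegaInv m ξ : ℂ)) •
    EuclideanSpace.single a (1 : ℂ)

theorem norm_evalFn (hm : 0 < m) (x : E3) (a : Fin 4) (ξ : E3) :
    ‖evalFn m x a ξ‖ = omegaInv m ξ := by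
  rw [evalFn, norm_smul, norm_mul, ← Complex.ofReal_neg, Complex.norm_exp_ofReal_mul_I,
    Complex.norm_real, Real.norm_eq_abs, abs_of_pos (omegaInv_pos hm ξ)]
  simp

theorem memLp_evalFn (hm : 0 < m) (x : E3) (a : Fin 4) : MemLp (evalFn m x a) 2 volume := by
  have hc : Continuous (evalFn m x a) := by
    have := continuous_omegaInv hm
    unfold evalFn
    fun_prop
  rw [memLp_two_iff_integrable_sq_norm hc.aestronglyMeasurable]
  simpa only [norm_evalFn hm] using integrable_omegaInv_sq hm

theorem norm_evalFn_toLp_sq (hm : 0 < m) (x : E3) (a : Fin 4) :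
    ‖(memLp_evalFn hm x a).toLp‖ ^ 2 = ∫ ξ, omegaInv m ξ ^ 2 := by
  rw [HSp_norm_sq]
  refine integral_congr_ae ?_
  filter_upwards [(memLp_evalFn hm x a).coeFn_toLp] with ξ h
  rw [h, norm_evalFn hm]

/-- Fourier inversion for φ = D⁻²(m² - Δ)φ: evaluation at a point after D⁻² is a bounded functional
on L², represented by `evalFn`. -/
theorem eval_resolvent_helmholtz (hm : 0 < m) (φ : 𝓢(E3, Spinor)) (x : E3) (a : Fin 4) :
    φ x a = inner ℂ ((memLp_evalFn hm x a).toLp) (fourierU ((helmholtz m φ).toLp 2)) := by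
  have e1 : fourierU ((helmholtz m φ).toLp 2) = (𝓕 (helmholtz m φ)).toLp 2 :=
    SchwartzMap.toLp_fourier_eq _
  have e2 : φ x = ∫ ξ, Complex.exp ((2 * Real.pi * inner ℝ ξ x : ℝ) * Complex.I) • 𝓕 φ ξ := by
    have h := congrArg (fun ψ : 𝓢(E3, Spinor) => ψ x) 
      (FourierTransform.fourierInv_fourier_eq (F := 𝓢(E3, Spinor)) φ)
    rw [← h]
    exact (congrFun (SchwartzMap.fourierInv_coe (𝓕 φ)) x).trans (Real.fourierInv_eq' _ x)
  have hi : Integrable fun ξ => Complex.exp ((2 * Real.pi * inner ℝ ξ x : ℝ) * Complex.I) • 𝓕 φ ξ := by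
    refine (𝓕 φ).integrable.norm.mono' ?_ (ae_of_all _ fun ξ => ?_)
    · exact (by fun_prop : Continuous fun ξ : E3 =>
        Complex.exp ((2 * Real.pi * inner ℝ ξ x : ℝ) * Complex.I)).aestronglyMeasurable.smul
        (𝓕 φ).continuous.aestronglyMeasurable
    · rw [norm_smul, Complex.norm_exp_ofReal_mul_I, one_mul]
  have e3 : φ x a = ∫ ξ, Complex.exp ((2 * Real.pi * inner ℝ ξ x : ℝ) * Complex.I) * 𝓕 φ ξ a := by
    rw [e2]
    exact (((EuclideanSpace.proj a : Spinor →L[ℂ] ℂ)).integral_comp_comm hi).symm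
  rw [e1, e3, L2.inner_def]
  refine integral_congr_ae ?_
  filter_upwards [(memLp_evalFn hm x a).coeFn_toLp, (𝓕 (helmholtz m φ)).coeFn_toLp 2] with ξ h1 h2
  have h3 : (omega m ((2 * Real.pi) • ξ) : ℂ) ≠ 0 := by
    exact_mod_cast (omega_pos hm _).ne'
  rw [h1, h2, evalFn, fourier_helmholtz, inner_smul_left, inner_smul_right,
    EuclideanSpace.inner_single_left, map_mul, ← Complex.exp_conj, map_mul, Complex.conj_I,
    omegaInv, Complex.conj_ofReal, map_neg, Complex.conj_ofReal]
  push_cast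
  rw [map_one, one_mul]
  field_simp

/-- The point evaluation formula extends by density: an L²-convergent sequence has a subsequence
converging almost everywhere, while the right-hand side is continuous in f. -/
theorem eval_resolvent (hm : 0 < m) (f : HSp) :
    ∀ᵐ x, ∀ a, resolvent m f x a = inner ℂ ((memLp_evalFn hm x a).toLp) (fourierU f) := by
  have hd := SchwartzMap.denseRange_toLpCLM (E := E3) (F := Spinor) (p := 2) (by simp)
    (μ := (volume : Measure E3))
  obtain ⟨u, hu, hlim⟩ := mem_closure_iff_seq_limit.1 (hd f)
  choose g hg using hu
  choose φ hφ using fun n => helmholtz_surjective hm (g n)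
  have hu2 : ∀ n, u n = (helmholtz m (φ n)).toLp 2 := fun n => by rw [hφ, ← hg]; rfl
  have h1 : Tendsto (fun n => resolvent m (u n)) atTop (𝓝 (resolvent m f)) :=
    ((resolvent m).continuous.tendsto f).comp hlim
  obtain ⟨ns, hns, hae⟩ := (tendstoInMeasure_of_tendsto_Lp h1).exists_seq_tendsto_ae
  have h2 : ∀ᵐ x, ∀ n, resolvent m (u n) x = φ n x := by
    rw [ae_all_iff]
    intro n
    rw [hu2, resolvent_helmholtz hm]
    exact (φ n).coeFn_toLp 2
  filter_upwards [hae, h2] with x h3 h4 a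
  have h5 : Tendsto (fun k => resolvent m (u (ns k)) x a) atTop (𝓝 (resolvent m f x a)) :=
    (((EuclideanSpace.proj a : Spinor →L[ℂ] ℂ)).continuous.tendsto _).comp h3
  refine tendsto_nhds_unique h5 ?_
  have h6 : ∀ k, resolvent m (u (ns k)) x a
      = inner ℂ ((memLp_evalFn hm x a).toLp) (fourierU (u (ns k))) := fun k => by
    rw [h4, hu2, eval_resolvent_helmholtz hm]
  simp only [h6]
  exact ((continuous_const.inner (fourierU.continuous)).tendsto f).comp
    (hlim.comp hns.tendsto_atTop)

/-- Bessel's inequality applied to the evaluation functionals, whose norms do not depend on x. The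
factor 4 counts the spinor components. -/
theorem sum_norm_resolvent_sq_le (hm : 0 < m) {ι : Type} {s : Finset ι} {y : ι → HSp}
    (hy : IsBessel s y) :
    ∀ᵐ x, ∑ i ∈ s, ‖resolvent m (y i) x‖ ^ 2 ≤ 4 * ∫ ξ, omegaInv m ξ ^ 2 := by
  have h := (Finset.eventually_all s).2 fun i _ => eval_resolvent hm (y i)
  filter_upwards [h] with x hx
  have e : ∀ i ∈ s, ‖resolvent m (y i) x‖ ^ 2
      = ∑ a, ‖inner ℂ (fourierU (y i)) ((memLp_evalFn hm x a).toLp)‖ ^ 2 := fun i hi => by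
    rw [EuclideanSpace.norm_sq_eq]
    exact Finset.sum_congr rfl fun a _ => by rw [hx i hi a, norm_inner_symm]
  rw [Finset.sum_congr rfl e, Finset.sum_comm]
  have h2 : ∀ a : Fin 4, ∑ i ∈ s, ‖inner ℂ (fourierU (y i)) ((memLp_evalFn hm x a).toLp)‖ ^ 2
      ≤ ∫ ξ, omegaInv m ξ ^ 2 := fun a => by
    rw [← norm_evalFn_toLp_sq hm x a]
    have e2 : ∀ i, inner ℂ (fourierU (y i)) ((memLp_evalFn hm x a).toLp)
        = inner ℂ (y i) (fourierU.symm ((memLp_evalFn hm x a).toLp)) := fun i => by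
      rw [← fourierU.inner_map_map (y i), LinearIsometryEquiv.apply_symm_apply]
    simp only [e2]
    refine (hy _).trans ?_
    rw [LinearIsometryEquiv.norm_map]
  refine (Finset.sum_le_sum fun a _ => h2 a).trans (le_of_eq ?_)
  simp

/-- The pointwise Bessel bound for D⁻² is constant in x; multiplication by B restricts it to a
compact set, where it can be integrated. -/
theorem IsField.hsNormLe (hm : 0 < m) {B : ℝ × E3 → SOp} (hB : IsField B) (a b : ℝ) :
    ∃ c, ∀ s ∈ Set.Icc a b, HSNormLe (fieldOp B s * resolvent m) c := by
  obtain ⟨C, hC, h0⟩ := hB.supp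
  obtain ⟨M, hM0, hM⟩ := hB.exists_bound a b
  set κ := 4 * ∫ ξ, omegaInv m ξ ^ 2
  have hκ : 0 ≤ κ := mul_nonneg (by norm_num) (integral_nonneg fun ξ => sq_nonneg _)
  refine ⟨√(volume.real C * (M ^ 2 * κ)), fun s hs => ⟨Real.sqrt_nonneg _, fun ι t y hy => ?_⟩⟩
  rw [Real.sq_sqrt (by positivity)]
  simp only [HSp_norm_sq]
  rw [← integral_finsetSum _ fun i _ => HSp_integrable_norm_sq _]
  have h1 : ∀ᵐ x, ∑ i ∈ t, ‖(fieldOp B s * resolvent m) (y i) x‖ ^ 2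
      ≤ C.indicator (fun _ => M ^ 2 * κ) x := by
    have h := (Finset.eventually_all t).2 fun i _ => mulOp_coeFn (hB.memLp s) (resolvent m (y i))
    filter_upwards [sum_norm_resolvent_sq_le hm hy, h] with x hx h2
    have h3 : ∀ i ∈ t, ‖(fieldOp B s * resolvent m) (y i) x‖ ^ 2
        ≤ C.indicator (fun _ => M ^ 2 * ‖resolvent m (y i) x‖ ^ 2) x := fun i hi => by
      have e : (fieldOp B s * resolvent m) (y i) x = B (s, x) (resolvent m (y i) x) := h2 i hi
      rw [e]
      by_cases hxC : x ∈ C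
      · rw [Set.indicator_of_mem hxC, ← mul_pow]
        gcongr
        exact (ContinuousLinearMap.le_opNorm _ _).trans
          (mul_le_mul_of_nonneg_right (hM s hs x) (norm_nonneg _))
      · rw [Set.indicator_of_notMem hxC, h0 s x hxC]
        simp
    refine (Finset.sum_le_sum h3).trans ?_
    by_cases hxC : x ∈ C
    · simp only [Set.indicator_of_mem hxC, ← Finset.mul_sum]
      gcongr
    · simp [Set.indicator_of_notMem hxC]
  refine (integral_mono_ae (integrable_finsetSum _ fun i _ => HSp_integrable_norm_sq _)
    ((integrableOn_const hC.measure_lt_top.ne enorm_ne_top).integrable_indicator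
      hC.measurableSet) h1).trans (le_of_eq ?_)
  rw [integral_indicator hC.measurableSet, setIntegral_const, smul_eq_mul]

end

end DiracEntropy

namespace DiracEntropy
open Filter Topology
open scoped ContDiff

/-! ### Fields times D⁻⁴ are trace class; commutation with D⁻⁴. -/

section
variable {m ε : ℝ} {B : ℝ × E3 → SOp}

/-- `D⁻⁴`. -/
def resolventSq (m : ℝ) : BOp := resolvent m * resolvent m

namespace IsField

/-- The cutoff provides a second localizing factor, so that both D⁻² in B D⁻⁴ can be made
Hilbert–Schmidt. -/
theorem exists_cutoff (hB : IsField B) :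
    ∃ χ : ℝ × E3 → SOp, IsField χ ∧ ∀ s, fieldOp χ s * fieldOp B s = fieldOp B s := by
  obtain ⟨C, hC, h0⟩ := hB.supp
  obtain ⟨r, hr⟩ := hC.isBounded.subset_closedBall (0 : E3)
  have hr0 : 0 < max r 1 := by positivity
  let f : ContDiffBump (0 : E3) := ⟨max r 1, max r 1 + 1, hr0, by linarith⟩
  have hχ : IsField fun z => f z.2 • (1 : SOp) := by
    refine ⟨?_, Metric.closedBall 0 (max r 1 + 1), isCompact_closedBall _ _, fun t x hx => ?_⟩
    · exact (f.contDiff.comp contDiff_snd).smul contDiff_const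
    · have : f x = 0 := f.zero_of_le_dist (by
        rw [Metric.mem_closedBall, not_le] at hx
        exact hx.le)
      ext v i
      simp [this]
  refine ⟨_, hχ, fun s => ?_⟩
  rw [fieldOp, fieldOp, mulOp_mul (hχ.memLp s) (hB.memLp s)]
  congr 1
  ext1 x
  by_cases hx : x ∈ C
  · have : f x = 1 := f.one_of_mem_closedBall
      (Metric.closedBall_subset_closedBall (le_max_left _ _) (hr hx))
    ext v i
    simp [this]
  · rw [h0 s x hx, mul_zero]

/-- Every summand of `commRes` begins with a compactly supported field. The extra D⁻² is commuted
past the bounded Fourier multipliers to stand next to that field. -/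
theorem hsNormLe_commRes (hm : 0 < m) (hB : IsField B) (a b : ℝ) :
    ∃ c, ∀ s ∈ Set.Icc a b, HSNormLe (commRes m B s * resolvent m) c := by
  obtain ⟨c0, h0⟩ := hB.hsNormLe hm a b
  have h2 : ∀ j : Fin 3, ∃ c, ∀ s ∈ Set.Icc a b,
      HSNormLe (fieldOp (spaceDeriv j (spaceDeriv j B)) s * resolvent m * resolvent m
        + (2 : ℂ) • (fieldOp (spaceDeriv j B) s * resolvent m * derivResolvent m j)) c := fun j => by
    obtain ⟨c1, h1⟩ := ((hB.dir (0, unitVec j)).dir (0, unitVec j)).hsNormLe hm a b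
    obtain ⟨c2, h2⟩ := (hB.dir (0, unitVec j)).hsNormLe hm a b
    exact ⟨_, fun s hs => ((h1 s hs).mul_right le_rfl).add (((h2 s hs).mul_right le_rfl).smul 2)⟩
  choose c hc using h2
  refine ⟨c0 + ‖(-1 : ℂ)‖ * ∑ j, c j, fun s hs => ?_⟩
  have h := (h0 s hs).add ((HSNormLe.sum Finset.univ fun j _ => hc j s hs).smul (-1))
  convert h using 1
  rw [commRes, sub_mul, Finset.sum_mul, neg_one_smul, ← sub_eq_add_neg]
  congr 1
  refine Finset.sum_congr rfl fun j _ => ?_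
  rw [add_mul, smul_mul_assoc, mul_assoc _ (derivResolvent m j), ← resolvent_comm_derivResolvent hm,
    mul_assoc _ (resolvent m) (derivResolvent m j)]

/-- With χB = B and B D⁻² = D⁻² `commRes`, one has B D⁻⁴ = (χ D⁻²)(`commRes` D⁻²), a product of two
Hilbert–Schmidt operators. -/
theorem traceNormLe (hm : 0 < m) (hB : IsField B) (a b : ℝ) :
    ∃ c, ∀ s ∈ Set.Icc a b, TraceNormLe (fieldOp B s * resolventSq m) c := by
  obtain ⟨χ, hχ, hχB⟩ := hB.exists_cutoff
  obtain ⟨c1, h1⟩ := hχ.hsNormLe hm a b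
  obtain ⟨c2, h2⟩ := hB.hsNormLe_commRes hm a b
  refine ⟨c1 * c2, fun s hs => ?_⟩
  have h := (h1 s hs).mul (h2 s hs)
  rwa [mul_assoc, ← mul_assoc (resolvent m), ← hB.fieldOp_mul_resolvent hm s, ← mul_assoc,
    ← mul_assoc, hχB, mul_assoc] at h

/-- `mulOp b D⁻⁴ = D⁻⁴ · commResSq b`. -/
def _root_.DiracEntropy.commResSq (m : ℝ) (B : ℝ × E3 → SOp) (s : ℝ) : BOp :=
  commRes m B s - ∑ j, (commRes m (spaceDeriv j (spaceDeriv j B)) s * resolvent m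
    + (2 : ℂ) • (commRes m (spaceDeriv j B) s * derivResolvent m j))

theorem fieldOp_mul_resolventSq (hm : 0 < m) (hB : IsField B) (s : ℝ) :
    fieldOp B s * resolventSq m = resolventSq m * commResSq m B s := by
  have h : commRes m B s * resolvent m = resolvent m * commResSq m B s := by
    rw [commResSq, mul_sub, ← hB.fieldOp_mul_resolvent hm, Finset.mul_sum, commRes, sub_mul,
      Finset.sum_mul]
    congr 1
    refine Finset.sum_congr rfl fun j _ => ?_
    rw [mul_add, mul_smul_comm, ← mul_assoc, ← mul_assoc,
      ← ((hB.dir (0, unitVec j)).dir (0, unitVec j)).fieldOp_mul_resolvent hm,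
      ← (hB.dir (0, unitVec j)).fieldOp_mul_resolvent hm, add_mul, smul_mul_assoc,
      mul_assoc _ (derivResolvent m j), ← resolvent_comm_derivResolvent hm, ← mul_assoc]
  rw [resolventSq, ← mul_assoc, hB.fieldOp_mul_resolvent hm, mul_assoc, h, mul_assoc]

theorem contDiff_commRes (hB : IsField B) : ContDiff ℝ ∞ (commRes m B) := by
  unfold commRes
  refine hB.contDiff_fieldOp.sub (ContDiff.sum fun j _ => ?_)
  exact (((hB.dir _).dir _).contDiff_fieldOp.mul contDiff_const).add
    (((hB.dir _).contDiff_fieldOp.mul contDiff_const).const_smul (2 : ℂ))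

theorem contDiff_commResSq (hB : IsField B) : ContDiff ℝ ∞ (commResSq m B) := by
  unfold commResSq
  refine hB.contDiff_commRes.sub (ContDiff.sum fun j _ => ?_)
  exact (((hB.dir _).dir _).contDiff_commRes.mul contDiff_const).add
    (((hB.dir _).contDiff_commRes.mul contDiff_const).const_smul (2 : ℂ))

end IsField

theorem dirDeriv_eq_zero {I : Set ℝ} (hI : IsOpen I) (h : ∀ s ∈ I, ∀ x, B (s, x) = 0)
    (v : ℝ × E3) : ∀ s ∈ I, ∀ x, dirDeriv v B (s, x) = 0 := fun s hs x => by
  have h : B =ᶠ[𝓝 (s, x)] fun _ => 0 := by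
    have : (Prod.fst ⁻¹' I : Set (ℝ × E3)) ∈ 𝓝 (s, x) := (hI.preimage continuous_fst).mem_nhds hs
    filter_upwards [this] with z hz using h z.1 hz z.2
  rw [dirDeriv, h.fderiv_eq]
  simp

theorem fieldOp_eq_zero {s : ℝ} (h : ∀ x, B (s, x) = 0) : fieldOp B s = 0 := by
  rw [fieldOp, funext h]
  exact mulOp_zero

theorem commRes_eq_zero {I : Set ℝ} (hI : IsOpen I) (h : ∀ s ∈ I, ∀ x, B (s, x) = 0) :
    ∀ s ∈ I, commRes m B s = 0 := fun s hs => by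
  have h1 : ∀ j, fieldOp (spaceDeriv j B) s = 0 := fun j =>
    fieldOp_eq_zero (dirDeriv_eq_zero hI h _ s hs)
  have h2 : ∀ j, fieldOp (spaceDeriv j (spaceDeriv j B)) s = 0 := fun j =>
    fieldOp_eq_zero (dirDeriv_eq_zero hI (dirDeriv_eq_zero hI h _) _ s hs)
  simp [commRes, fieldOp_eq_zero (h s hs), h1, h2]

theorem commResSq_eq_zero {I : Set ℝ} (hI : IsOpen I) (h : ∀ s ∈ I, ∀ x, B (s, x) = 0) :
    ∀ s ∈ I, commResSq m B s = 0 := fun s hs => by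
  have h1 : ∀ j, commRes m (spaceDeriv j B) s = 0 := fun j =>
    commRes_eq_zero hI (dirDeriv_eq_zero hI h _) s hs
  have h2 : ∀ j, commRes m (spaceDeriv j (spaceDeriv j B)) s = 0 := fun j =>
    commRes_eq_zero hI (dirDeriv_eq_zero hI (dirDeriv_eq_zero hI h _) _) s hs
  simp [commResSq, commRes_eq_zero hI h s hs, h1, h2]

theorem resolvent_adjoint (hm : 0 < m) :
    ContinuousLinearMap.adjoint (resolvent m) = resolvent m := by
  rw [resolvent, fourierMul_adjoint (isSymbol_resolvent hm)]
  congr 1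
  ext1 p
  rw [scalarSymbol, map_smulₛₗ, map_inv₀, Complex.conj_ofReal]
  congr 1
  exact ContinuousLinearMap.adjoint_id

theorem adjoint_mul (S T : BOp) : ContinuousLinearMap.adjoint (S * T)
    = ContinuousLinearMap.adjoint T * ContinuousLinearMap.adjoint S :=
  ContinuousLinearMap.adjoint_comp S T

theorem resolventSq_adjoint (hm : 0 < m) :
    ContinuousLinearMap.adjoint (resolventSq m) = resolventSq m := by
  rw [resolventSq, adjoint_mul, resolvent_adjoint hm]

theorem resolvent_eq (m : ℝ) : resolvent m = diracOp m fun x => ((x : ℂ) ^ 2)⁻¹ := by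
  rw [resolvent, diracOp_eq]
  congr 1
  ext1 p
  rw [matOp_diracMatFn, scalarSymbol]
  push_cast
  rw [neg_sq]
  module

theorem isSpecFn_inv_sq (hm : 0 < m) : IsSpecFn m fun x => ((x : ℂ) ^ 2)⁻¹ where
  meas := by fun_prop
  bdd := ⟨(m ^ 2)⁻¹, fun x hx => by
    rw [norm_inv, norm_pow, Complex.norm_real, Real.norm_eq_abs]
    gcongr⟩

theorem resolventSq_eq (hm : 0 < m) : resolventSq m = diracOp m fun x => ((x : ℂ) ^ 4)⁻¹ := by
  rw [resolventSq, resolvent_eq, diracOp_mul hm (isSpecFn_inv_sq hm) (isSpecFn_inv_sq hm)]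
  congr 1
  ext1 x
  rw [← mul_inv]
  ring

theorem resolventSq_comm_freeEvol (hm : 0 < m) (t : ℝ) :
    resolventSq m * freeEvol m t = freeEvol m t * resolventSq m := by
  have h : resolvent m * freeEvol m t = freeEvol m t * resolvent m := by
    rw [resolvent_eq]
    exact diracOp_comm hm (isSpecFn_inv_sq hm) (isSpecFn_freeEvol m t)
  rw [resolventSq, mul_assoc, h, ← mul_assoc, h, mul_assoc]

/-- The adjoint as a real continuous linear map. -/
def adjointCLM : BOp →L[ℝ] BOp :=
  AddMonoidHom.toRealLinearMap ⟨⟨ContinuousLinearMap.adjoint, map_zero _⟩, map_add _⟩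
    (ContinuousLinearMap.adjoint (𝕜 := ℂ) (E := HSp) (F := HSp)).continuous

theorem contDiff_adjoint {Z : ℝ → BOp} (hZ : ContDiff ℝ ∞ Z) :
    ContDiff ℝ ∞ fun s => ContinuousLinearMap.adjoint (Z s) :=
  adjointCLM.contDiff.comp hZ

end

/-! ### Curves of operators which become trace class after multiplication by `D⁻⁴` -/

/-- `X` is a smooth curve with support in `[-ε, 0]`, and `X⁽ᵏ⁾(s) D⁻⁴` is trace class, uniformly in
`s`, for `k ≤ n`. -/
def IsTraceCurve (m ε : ℝ) : ℕ → (ℝ → BOp) → Prop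
  | 0, X => ContDiff ℝ ∞ X ∧ (∀ s ∉ Set.Icc (-ε) 0, X s = 0) ∧
      ∃ C, ∀ s, TraceNormLe (X s * resolventSq m) C
  | n + 1, X => IsTraceCurve m ε n X ∧ IsTraceCurve m ε n (deriv X)

namespace IsTraceCurve
variable {m ε : ℝ} {n : ℕ} {X Y Ψ Φ Φ' : ℝ → BOp}

theorem zero (h : IsTraceCurve m ε n X) : IsTraceCurve m ε 0 X := by
  induction n with
  | zero => exact h
  | succ n ih => exact ih h.1

theorem add (hX : IsTraceCurve m ε n X) (hY : IsTraceCurve m ε n Y) :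
    IsTraceCurve m ε n fun s => X s + Y s := by
  induction n generalizing X Y with
  | zero =>
    obtain ⟨h1, h2, C, h3⟩ := hX
    obtain ⟨h4, h5, D, h6⟩ := hY
    refine ⟨h1.add h4, fun s hs => by simp only [h2 s hs, h5 s hs, add_zero], C + D, fun s => ?_⟩
    rw [add_mul]
    exact (h3 s).add (h6 s)
  | succ n ih =>
    refine ⟨ih hX.1 hY.1, ?_⟩
    have e : deriv (fun s => X s + Y s) = fun s => deriv X s + deriv Y s := funext fun s =>
      deriv_fun_add (hX.zero.1.differentiable (by simp) s) (hY.zero.1.differentiable (by simp) s)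
    rw [e]
    exact ih hX.2 hY.2

theorem exists_bound {Z : ℝ → BOp} (hZ : Continuous Z) (ε : ℝ) :
    ∃ M, ∀ s ∈ Set.Icc (-ε) 0, ‖Z s‖ ≤ M :=
  isCompact_Icc.exists_bound_of_continuousOn hZ.continuousOn

theorem mul_left (hΨ : ContDiff ℝ ∞ Ψ) (hX : IsTraceCurve m ε n X) :
    IsTraceCurve m ε n fun s => Ψ s * X s := by
  induction n generalizing X Ψ with
  | zero =>
    obtain ⟨h1, h2, C, h3⟩ := hX
    obtain ⟨M, hM⟩ := exists_bound hΨ.continuous ε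
    refine ⟨hΨ.mul h1, fun s hs => by simp only [h2 s hs, mul_zero], max (M * C) 0, fun s => ?_⟩
    by_cases hs : s ∈ Set.Icc (-ε) 0
    · rw [mul_assoc]
      exact ((h3 s).mul_left (hM s hs)).mono (le_max_left _ _)
    · simp only [h2 s hs, mul_zero, zero_mul]
      exact .zero (le_max_right _ _)
  | succ n ih =>
    refine ⟨ih hΨ hX.1, ?_⟩
    have e : deriv (fun s => Ψ s * X s) = fun s => deriv Ψ s * X s + Ψ s * deriv X s :=
      funext fun s => deriv_fun_mul (hΨ.differentiable (by simp) s)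
        (hX.zero.1.differentiable (by simp) s)
    rw [e]
    exact (ih (contDiff_infty_iff_deriv.1 hΨ).2 hX.1).add (ih hΨ hX.2)

/-- The relation ΦD⁻⁴ = D⁻⁴Φ' rewrites XΦD⁻⁴ as (XD⁻⁴)Φ'. It is inherited by derivatives, which is
what the induction needs. -/
theorem mul_right (hΦ : ContDiff ℝ ∞ Φ) (hΦ' : ContDiff ℝ ∞ Φ')
    (h : ∀ s, Φ s * resolventSq m = resolventSq m * Φ' s) (hX : IsTraceCurve m ε n X) :
    IsTraceCurve m ε n fun s => X s * Φ s := by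
  induction n generalizing X Φ Φ' with
  | zero =>
    obtain ⟨h1, h2, C, h3⟩ := hX
    obtain ⟨M, hM⟩ := exists_bound hΦ'.continuous ε
    refine ⟨h1.mul hΦ, fun s hs => by simp only [h2 s hs, zero_mul], max (C * M) 0, fun s => ?_⟩
    by_cases hs : s ∈ Set.Icc (-ε) 0
    · rw [mul_assoc, h, ← mul_assoc]
      exact ((h3 s).mul_right (hM s hs)).mono (le_max_left _ _)
    · simp only [h2 s hs, zero_mul]
      exact .zero (le_max_right _ _)
  | succ n ih =>
    refine ⟨ih hΦ hΦ' h hX.1, ?_⟩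
    have e : deriv (fun s => X s * Φ s) = fun s => deriv X s * Φ s + X s * deriv Φ s :=
      funext fun s => deriv_fun_mul (hX.zero.1.differentiable (by simp) s)
        (hΦ.differentiable (by simp) s)
    have h' : ∀ s, deriv Φ s * resolventSq m = resolventSq m * deriv Φ' s := fun s => by
      have h1 := ((hΦ.differentiable (by simp) s).hasDerivAt).mul_const (resolventSq m)
      have h2 := ((hΦ'.differentiable (by simp) s).hasDerivAt).const_mul (resolventSq m)
      rw [← funext h] at h2
      exact h1.unique h2
    rw [e]
    exact (ih hΦ hΦ' h hX.2).add
      (ih (contDiff_infty_iff_deriv.1 hΦ).2 (contDiff_infty_iff_deriv.1 hΦ').2 h' hX.1)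

theorem fieldOp (hm : 0 < m) {B : ℝ × E3 → SOp} (hB : IsField B)
    (h : ∀ s ∈ (Set.Icc (-ε) 0)ᶜ, ∀ x, B (s, x) = 0) : IsTraceCurve m ε n (fieldOp B) := by
  induction n generalizing B with
  | zero =>
    obtain ⟨C, hC⟩ := hB.traceNormLe hm (-ε) 0
    refine ⟨hB.contDiff_fieldOp, fun s hs => fieldOp_eq_zero (h s hs), max C 0, fun s => ?_⟩
    by_cases hs : s ∈ Set.Icc (-ε) 0
    · exact (hC s hs).mono (le_max_left _ _)
    · rw [fieldOp_eq_zero (h s hs), zero_mul]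
      exact .zero (le_max_right _ _)
  | succ n ih =>
    refine ⟨ih hB h, ?_⟩
    rw [hB.deriv_fieldOp]
    exact ih (hB.dir _) (dirDeriv_eq_zero isClosed_Icc.isOpen_compl h _)

end IsTraceCurve

/-! ### The interaction in the Schrödinger picture -/

/-- `e^{-isD} V_s e^{isD} Ȧ̸(s) e^{-isD} V_s^* e^{isD}`. -/
def schrodingerInteraction (m : ℝ) (A : ℝ → E3 → Fin 4 → ℝ) (s : ℝ) : BOp :=
  lagV m (fun s => slashOp (A s)) s * slashOp (dotPot A s) *
    ContinuousLinearMap.adjoint (lagV m (fun s => slashOp (A s)) s)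

/-- In V Ȧ̸ V* D⁻⁴ the factor D⁻⁴ is moved to the left of V*, at the price of replacing V* by the
adjoint of another Dyson sum; it then meets the compactly supported field Ȧ̸. -/
theorem isTraceCurve_schrodingerInteraction {m ε : ℝ} (hm : 0 < m) {A : ℝ → E3 → Fin 4 → ℝ}
    (hA : IsSwitchedPotential ε A) (n : ℕ) :
    IsTraceCurve m ε n (schrodingerInteraction m A) := by
  set B : ℝ × E3 → SOp := fun z => slashCLM (A z.1 z.2) with hBdef
  have hB : IsField B := hA.isField
  have ha := hA.isSwitchedCurve
  -- Taking adjoints in B D⁻⁴ = D⁻⁴ `commResSq` gives D⁻⁴ B = `a2` D⁻⁴, so `a2` is the curve that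
  -- generates the second Dyson sum.
  set a2 : ℝ → BOp := fun s => ContinuousLinearMap.adjoint (commResSq m B s)
  have hBv : ∀ s ∈ Set.Iio (-ε), ∀ x, B (s, x) = 0 := fun s hs x => by
    simp [hBdef, hA.vanish s hs]
  have ha2 : IsSwitchedCurve ε a2 := ⟨contDiff_adjoint hB.contDiff_commResSq, fun s hs => by
    simp only [a2]
    rw [commResSq_eq_zero isOpen_Iio hBv s hs, map_zero]⟩
  have hcomm : ∀ s, resolventSq m * slashOp (A s) = a2 s * resolventSq m := fun s => by
    have h := congrArg ContinuousLinearMap.adjoint (hB.fieldOp_mul_resolventSq hm s)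
    rw [adjoint_mul, adjoint_mul, resolventSq_adjoint hm] at h
    rw [← h, ← IsSwitchedPotential.slashOp_eq_fieldOp A s,
      IsSwitchedPotential.slashOp_adjoint _ (hB.memLp s)]
  have hV := lagV_intertwine hm ha ha2 (resolventSq_comm_freeEvol hm) hcomm
  have hV' : ∀ s, ContinuousLinearMap.adjoint (lagV m (fun s => slashOp (A s)) s) * resolventSq m
      = resolventSq m * ContinuousLinearMap.adjoint (lagV m a2 s) := fun s => by
    have h := congrArg ContinuousLinearMap.adjoint (hV s)
    rwa [adjoint_mul, adjoint_mul, resolventSq_adjoint hm] at h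
  have hdot : IsTraceCurve m ε n fun s => slashOp (dotPot A s) := by
    have e : (fun s => slashOp (dotPot A s)) = fieldOp (dirDeriv (1, 0) B) :=
      funext fun s => hA.slashOp_dotPot s
    rw [e]
    refine IsTraceCurve.fieldOp hm (hB.dir _) fun s hs x => ?_
    rw [Set.mem_compl_iff, Set.mem_Icc, not_and_or, not_le, not_le] at hs
    rcases hs with hs | hs
    · exact dirDeriv_eq_zero isOpen_Iio hBv _ s hs x
    · refine (hB.hasDerivAt s x).unique ?_
      -- Near a positive time the field coincides with its value at time 1, so its time derivative
      -- vanishes.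
      refine (hasDerivAt_const s (B (1, x))).congr_of_eventuallyEq ?_
      filter_upwards [Ioi_mem_nhds hs] with u hu
      simp only [hBdef, hA.constant u 1 hu one_pos]
  exact IsTraceCurve.mul_right (contDiff_adjoint (contDiff_lagV hm ha))
    (contDiff_adjoint (contDiff_lagV hm ha2)) hV' (hdot.mul_left (contDiff_lagV hm ha))

end DiracEntropy

namespace DiracEntropy
open Filter Topology
open scoped ContDiff Nat

/-! ### Time integrals of Heisenberg evolutions -/

section
variable {m ε : ℝ} {n : ℕ} {X : ℝ → BOp}

/-- `e^{isD} X(s) e^{-isD}`. -/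
def heisenberg (m : ℝ) (X : ℝ → BOp) (s : ℝ) : BOp := freeEvol m s * X s * freeEvol m (-s)

/-- `∫ e^{isD} X(s) e^{-isD} ds`. -/
def timeIntegral (m : ℝ) (X : ℝ → BOp) : BOp := strongIntegral volume (heisenberg m X)

namespace IsTraceCurve

theorem iterate_deriv {k : ℕ} (h : IsTraceCurve m ε (n + k) X) :
    IsTraceCurve m ε n (deriv^[k] X) := by
  induction k generalizing X with
  | zero => exact h
  | succ k ih =>
    rw [Function.iterate_succ_apply]
    exact ih h.2

theorem strMeas_heisenberg (hm : 0 < m) (hX : IsTraceCurve m ε n X) :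
    StrMeas (heisenberg m X) :=
  ((strMeas_freeEvol hm).mul (StrMeas.of_norm_continuous hX.zero.1.continuous)).mul
    ((strMeas_freeEvol hm).comp measurable_neg)

theorem hasStrongIntegral (hm : 0 < m) (hX : IsTraceCurve m ε n X) :
    HasStrongIntegral volume (heisenberg m X) (timeIntegral m X) := by
  obtain ⟨M, hM⟩ := exists_bound hX.zero.1.continuous ε
  refine exists_hasStrongIntegral (c := (Set.Icc (-ε) 0).indicator fun _ => M)
    (fun f => (hX.strMeas_heisenberg hm f).aestronglyMeasurable)
    ((integrableOn_const isCompact_Icc.measure_lt_top.ne enorm_ne_top).integrable_indicator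
      measurableSet_Icc) (ae_of_all _ fun s => ?_)
  refine (norm_conj_freeEvol_le hm _ _ _).trans ?_
  by_cases hs : s ∈ Set.Icc (-ε) 0
  · rw [Set.indicator_of_mem hs]; exact hM s hs
  · rw [Set.indicator_of_notMem hs, hX.zero.2.1 s hs, norm_zero]

theorem traceNormLe_timeIntegral (hm : 0 < m) (hX : IsTraceCurve m ε n X) :
    ∃ C, TraceNormLe (timeIntegral m X * resolventSq m) C := by
  obtain ⟨-, h0, C, hC⟩ := hX.zero
  refine ⟨_, ((hX.hasStrongIntegral hm).mul_right (resolventSq m)).traceNormLe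
    (c := (Set.Icc (-ε) 0).indicator fun _ => 1 * C * 1)
    ((integrableOn_const isCompact_Icc.measure_lt_top.ne enorm_ne_top).integrable_indicator
      measurableSet_Icc) (ae_of_all _ fun s => ?_)⟩
  by_cases hs : s ∈ Set.Icc (-ε) 0
  · rw [Set.indicator_of_mem hs, heisenberg, mul_assoc, ← resolventSq_comm_freeEvol hm,
      ← mul_assoc, mul_assoc (freeEvol m s)]
    exact ((hC s).mul_left (norm_freeEvol_le hm s)).mul_right (norm_freeEvol_le hm _)
  · rw [Set.indicator_of_notMem hs, heisenberg, h0 s hs, mul_zero, zero_mul, zero_mul]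
    exact .zero le_rfl

end IsTraceCurve

theorem norm_exp_I_sub_le (y : ℝ) :
    ‖Complex.exp (Complex.I * y) - 1 - Complex.I * y‖ ≤ 3 * y ^ 2 := by
  have hn : ‖Complex.I * (y : ℂ)‖ = |y| := by simp
  by_cases h : |y| ≤ 1
  · have := Complex.norm_exp_sub_one_sub_id_le (x := Complex.I * y) (by rwa [hn])
    rw [hn, sq_abs] at this
    nlinarith [sq_nonneg y]
  · have h1 : ‖Complex.exp (Complex.I * y)‖ = 1 := by rw [mul_comm]; exact Complex.norm_exp_ofReal_mul_I y
    have h2 := norm_sub_le (Complex.exp (Complex.I * y) - 1) (Complex.I * y)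
    have h3 := norm_sub_le (Complex.exp (Complex.I * y)) 1
    rw [norm_one] at h3
    rw [← sq_abs y]
    -- For |y| > 1 the three terms contribute at most 2 + |y| ≤ 3y².
    nlinarith

/-- On the spectrum |x| ≤ x²/m. -/
theorem IsSpecFn.of_sq {a : ℝ → ℂ} (hm : 0 < m) (ha : IsSpecFn m a)
    (ha2 : IsSpecFn m fun x => x ^ 2 * a x) : IsSpecFn m fun x => x * a x where
  meas := by have := ha.meas; fun_prop
  bdd := by
    obtain ⟨C, hC⟩ := ha2.bdd
    refine ⟨C / m, fun x hx => ?_⟩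
    have h := hC x hx
    rw [norm_mul, norm_pow, Complex.norm_real, Real.norm_eq_abs] at h
    rw [norm_mul, Complex.norm_real, Real.norm_eq_abs, le_div_iff₀ hm]
    nlinarith [mul_le_mul_of_nonneg_left hx (mul_nonneg (abs_nonneg x) (norm_nonneg (a x)))]

/-- The free evolution is only strongly continuous; after multiplication by a function a(D) that
absorbs two powers of D it becomes norm differentiable, with remainder controlled by x² a(x). -/
theorem hasDerivAt_diracOp_expI (hm : 0 < m) {a : ℝ → ℂ} (ha : IsSpecFn m a)
    (ha2 : IsSpecFn m fun x => x ^ 2 * a x) (t : ℝ) :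
    HasDerivAt (fun s => diracOp m a * freeEvol m s)
      (Complex.I • (diracOp m (fun x => x * a x) * freeEvol m t)) t := by
  have ha1 := ha.of_sq hm ha2
  obtain ⟨C, hC⟩ := ha2.bdd
  have e1 : (fun s => diracOp m a * freeEvol m s)
      = fun s : ℝ => diracOp m fun x => a x * Complex.exp (Complex.I * s * x) := funext fun s =>
    diracOp_mul hm ha (isSpecFn_freeEvol m s)
  have e2 : Complex.I • (diracOp m (fun x => x * a x) * freeEvol m t)
      = diracOp m fun x => Complex.I * (x * a x * Complex.exp (Complex.I * t * x)) := by
    rw [diracOp_const_mul hm (ha1.mul (isSpecFn_freeEvol m t)), freeEvol,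
      diracOp_mul hm ha1 (isSpecFn_freeEvol m t)]
  rw [e1, e2]
  refine hasDerivAt_diracOp hm (C := 3 * C) one_pos (fun u => ha.mul (isSpecFn_freeEvol m u))
    ((ha1.mul (isSpecFn_freeEvol m t)).const_smul _) fun u _ x hx => ?_
  have e3 : a x * Complex.exp (Complex.I * u * x) - a x * Complex.exp (Complex.I * t * x)
      - (u - t) * (Complex.I * (x * a x * Complex.exp (Complex.I * t * x)))
      = a x * Complex.exp (Complex.I * t * x) * (Complex.exp (Complex.I * ((u - t) * x : ℝ)) - 1
        - Complex.I * ((u - t) * x : ℝ)) := by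
    have : Complex.exp (Complex.I * u * x)
        = Complex.exp (Complex.I * t * x) * Complex.exp (Complex.I * ((u - t) * x : ℝ)) := by
      rw [← Complex.exp_add]
      congr 1
      push_cast
      ring
    rw [this]
    push_cast
    ring
  rw [e3, norm_mul, norm_mul, norm_exp_I_mul, mul_one]
  have h1 := norm_exp_I_sub_le ((u - t) * x)
  have h2 := hC x hx
  rw [norm_mul, norm_pow, Complex.norm_real, Real.norm_eq_abs, sq_abs] at h2
  calc ‖a x‖ * _ ≤ ‖a x‖ * (3 * ((u - t) * x) ^ 2) := by gcongr
    _ = 3 * (x ^ 2 * ‖a x‖) * (u - t) ^ 2 := by ring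
    _ ≤ _ := by gcongr

/-- The commutator of `D` with a time integral is the time integral of the derivative. -/
theorem timeIntegral_commutator (hm : 0 < m) (hX : IsTraceCurve m ε (n + 1) X) {a b : ℝ → ℂ}
    (ha : IsSpecFn m a) (ha2 : IsSpecFn m fun x => x ^ 2 * a x)
    (hb : IsSpecFn m b) (hb2 : IsSpecFn m fun x => x ^ 2 * b x) :
    diracOp m (fun x => x * a x) * timeIntegral m X * diracOp m b
      - diracOp m a * timeIntegral m X * diracOp m (fun x => x * b x)
      = Complex.I • (diracOp m a * timeIntegral m (deriv X) * diracOp m b) := by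
  -- The product rule for a(D) e^{isD} X(s) e^{-isD} b(D); the regularizers a(D) and b(D) absorb the
  -- factors D produced by the two exponentials.
  have hd : ∀ s, HasDerivAt
      (fun s => diracOp m a * heisenberg m X s * diracOp m b)
      (Complex.I • (diracOp m (fun x => x * a x) * heisenberg m X s * diracOp m b)
        + diracOp m a * heisenberg m (deriv X) s * diracOp m b
        + (-Complex.I) • (diracOp m a * heisenberg m X s * diracOp m fun x => x * b x)) s := by
    intro s
    have h1 := hasDerivAt_diracOp_expI hm ha ha2 s
    have h2 := (hX.zero.1.differentiable (by simp) s).hasDerivAt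
    have h3 : HasDerivAt (fun s => diracOp m b * freeEvol m (-s))
        ((-1 : ℝ) • (Complex.I • (diracOp m (fun x => x * b x) * freeEvol m (-s)))) s :=
      (hasDerivAt_diracOp_expI hm hb hb2 (-s)).scomp s (hasDerivAt_neg s)
    have h4 := (h1.mul h2).mul h3
    have hc : ∀ f : ℝ → ℂ, IsSpecFn m f → diracOp m f * freeEvol m (-s) = freeEvol m (-s) * diracOp m f :=
      fun f hf => diracOp_comm hm hf (isSpecFn_freeEvol m (-s))
    have e : (fun s => diracOp m a * heisenberg m X s * diracOp m b)
        = fun s => diracOp m a * freeEvol m s * X s * (diracOp m b * freeEvol m (-s)) :=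
      funext fun s => by
        rw [show diracOp m b * freeEvol m (-s) = freeEvol m (-s) * diracOp m b from
          diracOp_comm hm hb (isSpecFn_freeEvol m (-s)), heisenberg]
        simp only [mul_assoc]
    rw [e]
    refine h4.congr_deriv ?_
    rw [hc b hb, hc _ (hb.of_sq hm hb2), heisenberg, heisenberg]
    ext1 v
    simp only [add_apply, smul_apply, mul_apply_eq_comp, map_smul, map_neg, neg_smul, one_smul,
      Pi.mul_apply, neg_apply]
  have hI := (((hX.hasStrongIntegral hm).mul_left (diracOp m fun x => x * a x)).mul_right
      (diracOp m b)).smul Complex.I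
  have hI2 := ((hX.2.hasStrongIntegral hm).mul_left (diracOp m a)).mul_right (diracOp m b)
  have hI3 := (((hX.hasStrongIntegral hm).mul_left (diracOp m a)).mul_right
      (diracOp m fun x => x * b x)).smul (-Complex.I)
  have hsum := (hI.add hI2).add hI3
  have hF := ((hX.hasStrongIntegral hm).mul_left (diracOp m a)).mul_right (diracOp m b)
  ext1 v
  -- There are no boundary terms: the function and its derivative are both integrable on the line.
  have h0 := integral_eq_zero_of_hasDerivAt_of_integrable
    (fun s => ((ContinuousLinearMap.apply ℂ HSp v).hasFDerivAt.restrictScalars ℝ).comp_hasDerivAt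
      s (hd s)) (hsum v).1 (hF v).1
  have h1 := (hsum v).2.trans h0
  simp only [add_apply, smul_apply, neg_smul, neg_apply] at h1
  have h2 : Complex.I • ((diracOp m (fun x => x * a x) * timeIntegral m X * diracOp m b) v
      - (diracOp m a * timeIntegral m X * diracOp m (fun x => x * b x)) v)
      = - (diracOp m a * timeIntegral m (deriv X) * diracOp m b) v := by
    rw [smul_sub]
    refine eq_neg_of_add_eq_zero_left ?_
    rw [← h1]
    abel
  have h3 := congrArg (fun w => (-Complex.I) • w) h2
  simp only [smul_smul, neg_mul, Complex.I_mul_I, neg_neg, one_smul, neg_smul, smul_neg] at h3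
  rw [sub_apply, smul_apply, h3]

end

end DiracEntropy

namespace DiracEntropy
open Filter Topology
open scoped ContDiff Nat

/-! ### Off-diagonal blocks of time integrals are trace class -/

section
variable {m ε : ℝ} {X : ℝ → BOp}

theorem pow_mul_exp_neg_le (k : ℕ) {c y : ℝ} (hc : 0 < c) (hy : 0 ≤ y) :
    y ^ k * Real.exp (-(c * y)) ≤ k ! / c ^ k := by
  have h := Real.pow_div_factorial_le_exp (c * y) (by positivity) k
  rw [div_le_iff₀ (by positivity), mul_pow] at h
  rw [Real.exp_neg, ← div_eq_mul_inv, div_le_div_iff₀ (Real.exp_pos _) (by positivity)]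
  linarith

/-- The function `e^{-τ|x|}` on the half-line `σ x > 0`. -/
def decayFn (σ τ x : ℝ) : ℂ := ((if 0 < σ * x then Real.exp (-(max τ 0 * |x|)) else 0 : ℝ) : ℂ)

theorem norm_decayFn_le (σ τ x : ℝ) : ‖decayFn σ τ x‖ ≤ Real.exp (-(max τ 0 * |x|)) := by
  rw [decayFn, Complex.norm_real]
  split_ifs
  · rw [Real.norm_of_nonneg (Real.exp_pos _).le]
  · rw [norm_zero]; positivity

/-- The truncation `max τ 0` keeps the function bounded for every real τ, so that continuity in τ
can be stated on the whole line. -/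
theorem norm_decayFn_le_one (σ τ x : ℝ) : ‖decayFn σ τ x‖ ≤ 1 :=
  (norm_decayFn_le σ τ x).trans (Real.exp_le_one_iff.2 (by
    have : 0 ≤ max τ 0 * |x| := by positivity
    linarith))

theorem measurable_decayFn (σ τ : ℝ) : Measurable (decayFn σ τ) := by
  unfold decayFn
  refine Complex.measurable_ofReal.comp (Measurable.ite ?_ (by fun_prop) measurable_const)
  exact measurableSet_lt measurable_const (by fun_prop)

theorem isSpecFn_decayFn (m σ τ : ℝ) : IsSpecFn m (decayFn σ τ) :=
  ⟨measurable_decayFn σ τ, 1, fun x _ => norm_decayFn_le_one σ τ x⟩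

theorem norm_pow_mul_decayFn_le (k : ℕ) (σ : ℝ) {τ : ℝ} (hτ : 0 < τ) (x : ℝ) :
    ‖(x : ℂ) ^ k * decayFn σ τ x‖ ≤ k ! / τ ^ k := by
  rw [norm_mul, norm_pow, Complex.norm_real, Real.norm_eq_abs]
  have h := norm_decayFn_le σ τ x
  rw [max_eq_left hτ.le] at h
  calc |x| ^ k * ‖decayFn σ τ x‖ ≤ |x| ^ k * Real.exp (-(τ * |x|)) := by gcongr
    _ ≤ _ := pow_mul_exp_neg_le k hτ (abs_nonneg x)

theorem isSpecFn_pow_mul_decayFn (m : ℝ) (k : ℕ) (σ : ℝ) {τ : ℝ} (hτ : 0 < τ) :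
    IsSpecFn m fun x => (x : ℂ) ^ k * decayFn σ τ x :=
  ⟨by have := measurable_decayFn σ τ; fun_prop, _, fun x _ => norm_pow_mul_decayFn_le k σ hτ x⟩

/-- The decaying spectral projections `e^{-τ|D|} 1_{σ D > 0}`. -/
def decayOp (m σ τ : ℝ) : BOp := diracOp m (decayFn σ τ)

theorem norm_decayOp_le (hm : 0 < m) (σ τ : ℝ) : ‖decayOp m σ τ‖ ≤ Real.exp (-(max τ 0 * m)) :=
  norm_diracOp_le hm fun x hx => (norm_decayFn_le σ τ x).trans (by gcongr)

theorem norm_decayOp_le_one (hm : 0 < m) (σ τ : ℝ) : ‖decayOp m σ τ‖ ≤ 1 :=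
  norm_diracOp_le hm fun x _ => norm_decayFn_le_one σ τ x

theorem decayOp_adjoint (hm : 0 < m) (σ τ : ℝ) :
    ContinuousLinearMap.adjoint (decayOp m σ τ) = decayOp m σ τ := by
  rw [decayOp, diracOp_adjoint hm (isSpecFn_decayFn m σ τ)]
  congr 1
  ext1 x
  rw [decayFn, Complex.conj_ofReal]

theorem continuous_decayOp_apply (hm : 0 < m) (σ : ℝ) (v : HSp) :
    Continuous fun τ => decayOp m σ τ v :=
  continuous_diracOp hm (measurable_decayFn σ) (fun τ x _ => norm_decayFn_le_one σ τ x)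
    (fun x _ => by
      unfold decayFn
      split_ifs
      · fun_prop
      · fun_prop) v

theorem abs_exp_sub_le (y : ℝ) : |Real.exp y - 1 - y| ≤ y ^ 2 * Real.exp |y| := by
  have h := Complex.norm_exp_sub_sum_le_norm_mul_exp (y : ℂ) 2
  have e : Complex.exp (y : ℂ) - ∑ k ∈ Finset.range 2, (y : ℂ) ^ k / k !
      = ((Real.exp y - 1 - y : ℝ) : ℂ) := by
    simp [Finset.sum_range_succ, sub_sub]
  rw [e, Complex.norm_real, Complex.norm_real, Real.norm_eq_abs, Real.norm_eq_abs, sq_abs] at h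
  exact h

/-- On the half-line σx > 0 one has |x| = σx, so the derivative -|D| of the exponent becomes -σD
there. -/
theorem hasDerivAt_decayOp (hm : 0 < m) {σ : ℝ} (hσ : σ ^ 2 = 1) {t : ℝ} (ht : 0 < t) :
    HasDerivAt (decayOp m σ) (-(σ : ℂ) • diracOp m fun x => x * decayFn σ t x) t := by
  have h1 : IsSpecFn m fun x => x * decayFn σ t x := by
    simpa using isSpecFn_pow_mul_decayFn m 1 σ ht
  rw [← diracOp_const_mul hm h1]
  -- For |u - t| < t/2 the remainder is at most (u - t)² x² e^{-t|x|/2}, bounded by the stated C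
  -- times (u - t)².
  refine hasDerivAt_diracOp hm (δ := t / 2) (C := 2 ! / (t / 2) ^ 2) (by positivity)
    (isSpecFn_decayFn m σ) (h1.const_smul _) fun u hu x _ => ?_
  have hu0 : 0 < u := by rw [abs_lt] at hu; linarith
  by_cases hx : 0 < σ * x
  · have hσx : σ * x = |x| := by
      have h0 : |σ| = 1 := by
        rw [← Real.sqrt_sq_eq_abs, hσ, Real.sqrt_one]
      rw [← abs_of_pos hx, abs_mul, h0, one_mul]
    have e : decayFn σ u x - decayFn σ t x - (u - t) * (-(σ : ℂ) * (x * decayFn σ t x))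
        = ((Real.exp (-(t * |x|)) * (Real.exp (-((u - t) * |x|)) - 1 - -((u - t) * |x|)) : ℝ) : ℂ) := by
      have h3 : Real.exp (-(u * |x|)) = Real.exp (-(t * |x|)) * Real.exp (-((u - t) * |x|)) := by
        rw [← Real.exp_add]; congr 1; ring
      simp only [decayFn, if_pos hx, max_eq_left hu0.le, max_eq_left ht.le]
      rw [h3, ← hσx]
      push_cast
      ring
    rw [e, Complex.norm_real, Real.norm_eq_abs, abs_mul, abs_of_pos (Real.exp_pos _)]
    have h4 := abs_exp_sub_le (-((u - t) * |x|))
    have h5 : |-((u - t) * |x|)| ≤ t / 2 * |x| := by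
      rw [abs_neg, abs_mul, abs_abs]
      gcongr
    have h6 := pow_mul_exp_neg_le 2 (half_pos ht) (abs_nonneg x)
    calc Real.exp (-(t * |x|)) * |Real.exp (-((u - t) * |x|)) - 1 - -((u - t) * |x|)|
        ≤ Real.exp (-(t * |x|)) * ((-((u - t) * |x|)) ^ 2 * Real.exp (t / 2 * |x|)) := by
          refine mul_le_mul_of_nonneg_left (h4.trans ?_) (Real.exp_pos _).le
          gcongr
      _ = (|x| ^ 2 * Real.exp (-(t / 2 * |x|))) * (u - t) ^ 2 := by
          have : Real.exp (-(t / 2 * |x|)) = Real.exp (-(t * |x|)) * Real.exp (t / 2 * |x|) := by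
            rw [← Real.exp_add]; congr 1; ring
          rw [this]
          ring
      _ ≤ _ := by gcongr
  · simp only [decayFn, if_neg hx]
    simp
    positivity

/-- The off-diagonal block `1_{D<0} e^{-τ|D|} (∫ e^{isD} X(s) e^{-isD} ds) e^{-τ|D|} 1_{D>0}`. -/
def offDiag (m : ℝ) (X : ℝ → BOp) (τ : ℝ) : BOp :=
  decayOp m (-1) τ * timeIntegral m X * decayOp m 1 τ

/-- The left factor contributes +D because it lives on D < 0, the right factor -D because it lives
on D > 0. Hence the τ-derivative is a commutator with D, which `timeIntegral_commutator` converts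
into a time derivative of X. For diagonal blocks it would be an anticommutator. -/
theorem hasDerivAt_offDiag {n : ℕ} (hm : 0 < m) (hX : IsTraceCurve m ε (n + 1) X) {t : ℝ}
    (ht : 0 < t) : HasDerivAt (offDiag m X) (Complex.I • offDiag m (deriv X) t) t := by
  have h1 := hasDerivAt_decayOp hm (σ := -1) (by norm_num) ht
  have h2 := hasDerivAt_decayOp hm (σ := 1) (by norm_num) ht
  have h := (h1.mul_const (timeIntegral m X)).mul h2
  refine h.congr_deriv ?_
  rw [offDiag, decayOp, decayOp, ← timeIntegral_commutator hm hX (isSpecFn_decayFn m _ t)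
    (isSpecFn_pow_mul_decayFn m 2 _ ht) (isSpecFn_decayFn m _ t)
    (isSpecFn_pow_mul_decayFn m 2 _ ht)]
  ext1 v
  simp [sub_eq_add_neg]

theorem norm_offDiag_le (hm : 0 < m) (X : ℝ → BOp) {τ : ℝ} (hτ : 0 ≤ τ) :
    ‖offDiag m X τ‖ ≤ ‖timeIntegral m X‖ * Real.exp (-(m * τ)) := by
  have h1 := norm_decayOp_le hm (-1) τ
  have h2 := norm_decayOp_le_one hm 1 τ
  rw [max_eq_left hτ, mul_comm τ] at h1
  calc ‖offDiag m X τ‖ ≤ ‖decayOp m (-1) τ‖ * ‖timeIntegral m X‖ * ‖decayOp m 1 τ‖ :=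
        (norm_mul_le _ _).trans (by gcongr; exact norm_mul_le _ _)
    _ ≤ Real.exp (-(m * τ)) * ‖timeIntegral m X‖ * 1 := by gcongr
    _ = _ := by ring

/-- The right factor is D⁻⁴ times D⁴ e^{-τ|D|}, the latter of norm at most 4!/τ⁴; the left factor
contributes e^{-mτ} by the mass gap. -/
theorem traceNormLe_offDiag {n : ℕ} (hm : 0 < m) (hX : IsTraceCurve m ε n X) :
    ∃ C, ∀ τ > 0, TraceNormLe (offDiag m X τ) (C * (Real.exp (-(m * τ)) / τ ^ 4)) := by
  obtain ⟨C, hC⟩ := hX.traceNormLe_timeIntegral hm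
  refine ⟨C * 4 !, fun τ hτ => ?_⟩
  have h1 := norm_decayOp_le hm (-1) τ
  rw [max_eq_left hτ.le, mul_comm τ] at h1
  have h2 : decayOp m 1 τ = resolventSq m * diracOp m fun x => (x : ℂ) ^ 4 * decayFn 1 τ x := by
    have h3 : IsSpecFn m fun x => ((x : ℂ) ^ 4)⁻¹ := by
      have := (isSpecFn_inv_sq hm).mul (isSpecFn_inv_sq hm)
      convert this using 2 with x
      rw [← mul_inv]; ring
    rw [resolventSq_eq hm, diracOp_mul hm h3 (isSpecFn_pow_mul_decayFn m 4 1 hτ)]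
    refine diracOp_congr fun x hx => ?_
    have : (x : ℂ) ≠ 0 := by
      rintro h
      rw [Complex.ofReal_eq_zero] at h
      rw [h, abs_zero] at hx
      linarith
    field_simp
  have h4 : ‖diracOp m fun x => (x : ℂ) ^ 4 * decayFn 1 τ x‖ ≤ 4 ! / τ ^ 4 :=
    norm_diracOp_le hm fun x _ => norm_pow_mul_decayFn_le 4 1 hτ x
  have h := (hC.mul_right h4).mul_left h1
  rw [offDiag, h2, mul_assoc, ← mul_assoc (timeIntegral m X)]
  convert h using 1
  ring

theorem continuous_inner_offDiag (hm : 0 < m) (X : ℝ → BOp) (x y : HSp) :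
    Continuous fun τ => inner ℂ x (offDiag m X τ y) := by
  have e : (fun τ => inner ℂ x (offDiag m X τ y))
      = fun τ => inner ℂ (decayOp m (-1) τ x) (timeIntegral m X (decayOp m 1 τ y)) :=
    funext fun τ => by
      rw [offDiag, mul_assoc, mul_apply_eq_comp, ← ContinuousLinearMap.adjoint_inner_left,
        decayOp_adjoint hm]
      rfl
  rw [e]
  exact (continuous_decayOp_apply hm _ x).inner
    ((timeIntegral m X).continuous.comp (continuous_decayOp_apply hm _ y))

theorem pow_mul_exp_neg_le_exp (k : ℕ) (hm : 0 < m) {τ : ℝ} (hτ : 0 ≤ τ) :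
    τ ^ k * Real.exp (-(m * τ)) ≤ k ! / (m / 2) ^ k * Real.exp (-(m / 2) * τ) := by
  have h := pow_mul_exp_neg_le k (half_pos hm) hτ
  have e : Real.exp (-(m * τ)) = Real.exp (-(m / 2 * τ)) * Real.exp (-(m / 2) * τ) := by
    rw [← Real.exp_add]; congr 1; ring
  rw [e, ← mul_assoc]
  gcongr

/-- Taylor's formula in τ from infinity to 0, with remainder of order five. The factor τ⁴/4! in the
remainder cancels the singularity τ⁻⁴ of the trace norm, leaving an integrable multiple of e^{-mτ};
this dictates the number of derivatives. -/
theorem exists_traceNormLe_offDiag_zero (hm : 0 < m) (hX : IsTraceCurve m ε 5 X) :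
    ∃ C, TraceNormLe (offDiag m X 0) C := by
  set Y : ℕ → ℝ → BOp := fun k => deriv^[k] X
  have hY : ∀ k ≤ 4, IsTraceCurve m ε 1 (Y k) := fun k hk => by
    have : IsTraceCurve m ε ((4 - k + 1) + k) X := by
      rw [show 4 - k + 1 + k = 5 by omega]; exact hX
    have h2 := this.iterate_deriv
    clear this
    generalize 4 - k = l at h2
    induction l with
    | zero => exact h2
    | succ l ih => exact ih h2.1
  have hYs : ∀ k, deriv (Y k) = Y (k + 1) := fun k => (Function.iterate_succ_apply' deriv k X).symm
  have hY5 : IsTraceCurve m ε 0 (Y 5) := hX.iterate_deriv (n := 0) (k := 5)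
  obtain ⟨C, hC⟩ := traceNormLe_offDiag hm hY5
  -- the factor `(-iτ)ᵏ / k!`
  set w : ℕ → ℝ → ℂ := fun k τ => (-Complex.I * τ) ^ k / (k ! : ℂ)
  have hw0 : ∀ k τ, ‖w k τ‖ = |τ| ^ k / (k ! : ℝ) := fun k τ => by simp [w]
  have hw : ∀ k τ, HasDerivAt (w (k + 1)) (-Complex.I * w k τ) τ := fun k τ => by
    have h1 : HasDerivAt (fun τ : ℝ => -Complex.I * (τ : ℂ)) (-Complex.I) τ := by
      simpa using (Complex.ofRealCLM.hasDerivAt (x := τ)).const_mul (-Complex.I)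
    refine ((h1.pow (k + 1)).div_const _).congr_deriv ?_
    have : ((k + 1 : ℕ) : ℂ) ≠ 0 := by exact_mod_cast k.succ_ne_zero
    have h2 : (k ! : ℂ) ≠ 0 := by exact_mod_cast k.factorial_ne_zero
    simp only [w, Nat.factorial_succ, Nat.add_sub_cancel, Nat.cast_mul]
    field_simp
  have hwc : ∀ k, Continuous (w k) := fun k => by fun_prop
  refine ⟨∫ τ in Set.Ioi 0, C * (Real.exp (-(m * τ)) / 4 !), ?_⟩
  have hexp : IntegrableOn (fun τ => Real.exp (-(m * τ))) (Set.Ioi 0) := by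
    simpa only [neg_mul] using exp_neg_integrableOn_Ioi 0 hm
  have hint : ∀ x y, IntegrableOn (fun τ => w 4 τ * inner ℂ x (offDiag m (Y 5) τ y))
      (Set.Ioi 0) := fun x y => by
    have hb := (exp_neg_integrableOn_Ioi 0 (half_pos hm)).const_mul
      (‖x‖ * ‖timeIntegral m (Y 5)‖ * ‖y‖ * (4 ! / (m / 2) ^ 4))
    refine Integrable.mono' hb (((hwc 4).mul
      (continuous_inner_offDiag hm _ x y)).aestronglyMeasurable) ?_
    refine (ae_restrict_iff' measurableSet_Ioi).2 (ae_of_all _ fun τ hτ => ?_)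
    have hτ' : 0 ≤ τ := (Set.mem_Ioi.1 hτ).le
    have h1 : ‖inner ℂ x (offDiag m (Y 5) τ y)‖
        ≤ ‖x‖ * (‖timeIntegral m (Y 5)‖ * Real.exp (-(m * τ)) * ‖y‖) :=
      (norm_inner_le_norm _ _).trans (by
        gcongr
        exact (ContinuousLinearMap.le_opNorm _ _).trans (by
          gcongr; exact norm_offDiag_le hm _ hτ'))
    have h2 := pow_mul_exp_neg_le_exp 4 hm hτ'
    rw [norm_mul, hw0, abs_of_nonneg hτ']
    calc τ ^ 4 / 4 ! * _ ≤ τ ^ 4 / 1 * (‖x‖ * (‖timeIntegral m (Y 5)‖ * Real.exp (-(m * τ)) * ‖y‖)) := by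
          gcongr
          exact_mod_cast Nat.one_le_iff_ne_zero.2 (Nat.factorial_ne_zero 4)
      _ = ‖x‖ * ‖timeIntegral m (Y 5)‖ * ‖y‖ * (τ ^ 4 * Real.exp (-(m * τ))) := by ring
      _ ≤ ‖x‖ * ‖timeIntegral m (Y 5)‖ * ‖y‖
          * (4 ! / (m / 2) ^ 4 * Real.exp (-(m / 2) * τ)) := by gcongr
      _ = _ := by ring
  have hmain : ∀ x y, inner ℂ x (offDiag m X 0 y)
      = ∫ τ in Set.Ioi 0, inner ℂ x (((-(Complex.I * w 4 τ)) • offDiag m (Y 5) τ) y) := fun x y => by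
    set F : ℕ → ℝ → ℂ := fun k τ => inner ℂ x (offDiag m (Y k) τ y)
    have hFc : ∀ k, Continuous (F k) := fun k => continuous_inner_offDiag hm _ x y
    have hF : ∀ k ≤ 4, ∀ τ > 0, HasDerivAt (F k) (Complex.I * F (k + 1) τ) τ := fun k hk τ hτ => by
      have h1 := (((innerSL ℂ x).comp (ContinuousLinearMap.apply ℂ HSp y)).hasFDerivAt
        (x := offDiag m (Y k) τ) |>.restrictScalars ℝ).comp_hasDerivAt τ
        (hasDerivAt_offDiag hm (hY k hk) hτ)
      refine h1.congr_deriv ?_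
      rw [hYs]
      simp [F]
    -- Since w_{k+1}' = -i w_k and F_k' = i F_{k+1}, the derivative of the Taylor sum telescopes to
    -- its last term.
    have hH : ∀ n ≤ 4, ∀ τ > 0, HasDerivAt (fun τ => ∑ k ∈ Finset.range (n + 1), w k τ * F k τ)
        (Complex.I * w n τ * F (n + 1) τ) τ := by
      intro n
      induction n with
      | zero =>
        intro _ τ hτ
        simpa [w] using hF 0 (by norm_num) τ hτ
      | succ n ih =>
        intro hn τ hτ
        simp only [Finset.sum_range_succ _ (n + 1)]
        refine ((ih (by omega) τ hτ).fun_add ((hw n τ).mul (hF (n + 1) hn τ hτ))).congr_deriv ?_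
        ring
    have hHc : Continuous fun τ => ∑ k ∈ Finset.range 5, w k τ * F k τ :=
      continuous_finsetSum _ fun k _ => (hwc k).mul (hFc k)
    have hlim : Tendsto (fun τ => ∑ k ∈ Finset.range 5, w k τ * F k τ) atTop (𝓝 0) := by
      rw [← Finset.sum_const_zero (s := Finset.range 5)]
      refine tendsto_finsetSum _ fun k _ => ?_
      have hz : Tendsto (fun τ => k ! / (m / 2) ^ k * Real.exp (-(m / 2) * τ)
          * (‖x‖ * ‖timeIntegral m (Y k)‖ * ‖y‖)) atTop (𝓝 0) := by
        have h1 : Tendsto (fun τ => Real.exp (-(m / 2) * τ)) atTop (𝓝 0) :=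
          Real.tendsto_exp_atBot.comp (tendsto_id.const_mul_atTop_of_neg (by linarith))
        simpa using (h1.const_mul (k ! / (m / 2) ^ k)).mul_const
          (‖x‖ * ‖timeIntegral m (Y k)‖ * ‖y‖)
      refine squeeze_zero_norm' ?_ hz
      filter_upwards [eventually_ge_atTop 0] with τ hτ
      have h1 : ‖F k τ‖ ≤ ‖x‖ * (‖timeIntegral m (Y k)‖ * Real.exp (-(m * τ)) * ‖y‖) :=
        (norm_inner_le_norm _ _).trans (by
          gcongr
          exact (ContinuousLinearMap.le_opNorm _ _).trans (by
            gcongr; exact norm_offDiag_le hm _ hτ))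
      have h2 := pow_mul_exp_neg_le_exp k hm hτ
      have h3 : (1 : ℝ) ≤ k ! := by exact_mod_cast Nat.one_le_iff_ne_zero.2 (Nat.factorial_ne_zero k)
      rw [norm_mul, hw0, abs_of_nonneg hτ]
      calc τ ^ k / k ! * ‖F k τ‖
          ≤ τ ^ k / 1 * (‖x‖ * (‖timeIntegral m (Y k)‖ * Real.exp (-(m * τ)) * ‖y‖)) := by
            gcongr
        _ = (τ ^ k * Real.exp (-(m * τ))) * (‖x‖ * ‖timeIntegral m (Y k)‖ * ‖y‖) := by ring
        _ ≤ _ := by gcongr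
    have hint' : IntegrableOn (fun τ => Complex.I * w 4 τ * F 5 τ) (Set.Ioi 0) :=
      ((hint x y).const_mul Complex.I).congr (ae_of_all _ fun τ => (mul_assoc _ _ _).symm)
    -- The Taylor sum tends to 0 at infinity and equals F₀(0) at τ = 0, because w_k(0) = 0 for k >
    -- 0.
    have h := integral_Ioi_of_hasDerivAt_of_tendsto (hHc.continuousWithinAt)
      (fun τ hτ => hH 4 le_rfl τ hτ) hint' hlim
    have h0 : ∑ k ∈ Finset.range 5, w k 0 * F k 0 = F 0 0 := by
      rw [Finset.sum_range_succ']
      simp [w]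
    rw [h0, zero_sub] at h
    have h1 : F 0 0 = inner ℂ x (offDiag m X 0 y) := rfl
    rw [← h1, ← neg_neg (F 0 0), ← h, ← integral_neg]
    refine integral_congr_ae (ae_of_all _ fun τ => ?_)
    simp only [smul_apply, inner_smul_right, neg_mul]
    rfl
  refine TraceNormLe.of_integral (μ := volume.restrict (Set.Ioi 0)) ?_ ?_ ?_ hmain
  · refine (ae_restrict_iff' measurableSet_Ioi).2 (ae_of_all _ fun τ hτ => ?_)
    have h1 := (hC τ hτ).smul (-(Complex.I * w 4 τ))
    have h2 : 0 < τ := hτ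
    convert h1 using 1
    rw [norm_neg, norm_mul, Complex.norm_I, hw0, abs_of_pos h2]
    field_simp
  · exact (hexp.div_const _).const_mul _
  · intro x y
    have h1 := (hint x y).const_mul (-Complex.I)
    refine h1.congr (ae_of_all _ fun τ => ?_)
    simp only [smul_apply, inner_smul_right]
    ring

end

end DiracEntropy

namespace DiracEntropy
open Filter Topology
open scoped ContDiff

/-! ### The interaction -/

section
variable {m ε : ℝ} {A : ℝ → E3 → Fin 4 → ℝ}

theorem interactionIntegrand_eq (hm : 0 < m) (hA : IsSwitchedPotential ε A) (s : ℝ) :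
    interactionIntegrand m A s = heisenberg m (schrodingerInteraction m A) s := by
  have h1 := freeEvol_adjoint hm s
  have h2 := freeEvol_adjoint hm (-s)
  rw [neg_neg] at h2
  have h3 : ∀ T : BOp, freeEvol m (-s) * (freeEvol m s * T) = T := fun T => by
    rw [← mul_assoc, freeEvol_neg_mul hm, one_mul]
  rw [interactionIntegrand, Vop_eq hm hA.isSwitchedCurve, slashInt, adjoint_mul, adjoint_mul, h1, h2,
    heisenberg, schrodingerInteraction]
  simp only [mul_assoc, h3]

/-- The integrand vanishes outside [-ε, 0] and endpoints are null, so the integral may be taken over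
the whole line, where integration by parts has no boundary terms. -/
theorem hasStrongIntegral_interaction (hm : 0 < m) (hA : IsSwitchedPotential ε A) :
    HasStrongIntegral (volume.restrict (Set.Ioo (-ε) 0)) (interactionIntegrand m A)
      (timeIntegral m (schrodingerInteraction m A)) := by
  have hX := isTraceCurve_schrodingerInteraction hm hA 0
  rw [funext (interactionIntegrand_eq hm hA), restrict_Ioo_eq_restrict_Icc]
  intro f
  have h := hX.hasStrongIntegral hm f
  refine ⟨h.1.integrableOn, ?_⟩
  rw [h.2, setIntegral_eq_integral_of_forall_compl_eq_zero]
  intro s hs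
  rw [heisenberg, hX.zero.2.1 s hs, mul_zero, zero_mul]
  rfl

theorem interaction_eq (hm : 0 < m) (hA : IsSwitchedPotential ε A) :
    interaction m ε A = timeIntegral m (schrodingerInteraction m A) :=
  (hasStrongIntegral_interaction hm hA).strongIntegral_eq

theorem HasStrongIntegral.isSelfAdjoint {T : Type} [MeasurableSpace T] {μ : Measure T}
    {Φ : T → BOp} {L : BOp} (h : HasStrongIntegral μ Φ L)
    (hΦ : ∀ s, ContinuousLinearMap.adjoint (Φ s) = Φ s) : ContinuousLinearMap.adjoint L = L := by
  ext1 y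
  refine ext_inner_left ℂ fun x => ?_
  rw [ContinuousLinearMap.adjoint_inner_right, ← inner_conj_symm, h.inner_eq, h.inner_eq,
    ← integral_conj]
  refine integral_congr_ae (ae_of_all _ fun s => ?_)
  simp only [inner_conj_symm]
  rw [← ContinuousLinearMap.adjoint_inner_right, hΦ]

theorem schrodingerInteraction_adjoint (hA : IsSwitchedPotential ε A) (s : ℝ) :
    ContinuousLinearMap.adjoint (schrodingerInteraction m A s) = schrodingerInteraction m A s := by
  have h : ContinuousLinearMap.adjoint (slashOp (dotPot A s)) = slashOp (dotPot A s) := by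
    have h1 : ContinuousLinearMap.adjoint (deriv (fun s => slashOp (A s)) s)
        = deriv (fun s => slashOp (A s)) s := by
      have h2 := (hA.isSwitchedCurve.differentiable s).hasDerivAt
      have h3 := adjointCLM.hasFDerivAt.comp_hasDerivAt s h2
      have e : (adjointCLM ∘ fun s => slashOp (A s)) = fun s => slashOp (A s) := funext fun r =>
        IsSwitchedPotential.slashOp_adjoint _ (hA.isField.memLp r)
      rw [e] at h3
      exact h3.unique h2
    rwa [hA.deriv_slashOp] at h1
  rw [schrodingerInteraction, adjoint_mul, adjoint_mul, h, ContinuousLinearMap.adjoint_adjoint,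
    mul_assoc]

theorem interaction_adjoint (hm : 0 < m) (hA : IsSwitchedPotential ε A) :
    ContinuousLinearMap.adjoint (interaction m ε A) = interaction m ε A := by
  rw [interaction_eq hm hA]
  refine ((isTraceCurve_schrodingerInteraction hm hA 0).hasStrongIntegral hm).isSelfAdjoint
    fun s => ?_
  have h1 := freeEvol_adjoint hm s
  have h2 := freeEvol_adjoint hm (-s)
  rw [neg_neg] at h2
  rw [heisenberg, adjoint_mul, adjoint_mul, h1, h2, schrodingerInteraction_adjoint hA, mul_assoc]

/-- `K` is an operator with trace class off-diagonal blocks with respect to the sign of `D`, such that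
`K D⁻⁴` is trace class. -/
structure IsTameInteraction (m : ℝ) (K : BOp) (C : ℝ) : Prop where
  neg_pos : TraceNormLe (decayOp m (-1) 0 * K * decayOp m 1 0) C
  pos_neg : TraceNormLe (decayOp m 1 0 * K * decayOp m (-1) 0) C
  resolventSq : TraceNormLe (K * resolventSq m) C

/-- One off-diagonal block comes from the Taylor argument; the other is its adjoint, because 𝒦 is
self-adjoint. -/
theorem exists_isTameInteraction (hm : 0 < m) (hA : IsSwitchedPotential ε A) :
    ∃ C, IsTameInteraction m (interaction m ε A) C := by
  have hX := isTraceCurve_schrodingerInteraction hm hA 5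
  obtain ⟨C1, h1⟩ := exists_traceNormLe_offDiag_zero hm hX
  obtain ⟨C2, h2⟩ := hX.traceNormLe_timeIntegral hm
  rw [offDiag, ← interaction_eq hm hA] at h1
  rw [← interaction_eq hm hA] at h2
  have h3 := h1.adjoint
  rw [adjoint_mul, adjoint_mul, interaction_adjoint hm hA, decayOp_adjoint hm, decayOp_adjoint hm,
    ← mul_assoc] at h3
  exact ⟨max C1 C2, h1.mono (le_max_left _ _), h3.mono (le_max_left _ _),
    h2.mono (le_max_right _ _)⟩

end

end DiracEntropy

namespace DiracEntropy
open Filter Topology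

/-! ### Fermi factors -/

section
variable {m β : ℝ}

/-- The projection of `c` to `[0, β]`. -/
def clampTo (β c : ℝ) : ℝ := max 0 (min c β)

/-- For the exponents that actually occur the projection is the identity. It is there so that bounds
and strong continuity hold for all real parameters. -/
theorem clampTo_of_mem {c : ℝ} (h : c ∈ Set.Icc 0 β) : clampTo β c = c := by
  rw [clampTo, min_eq_left h.2, max_eq_right h.1]

theorem clampTo_mem (hβ : 0 < β) (c : ℝ) : clampTo β c ∈ Set.Icc 0 β :=
  ⟨le_max_left _ _, max_le hβ.le (min_le_right _ _)⟩

/-- The function `F₋ e^{-cx}`, with `c` projected to `[0, β]`. -/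
def lowerFn (β c x : ℝ) : ℝ := fermiMinus β x * Real.exp (-clampTo β c * x)

/-- The function `e^{cx} F₊`, with `c` projected to `[0, β]`. -/
def upperFn (β c x : ℝ) : ℝ := Real.exp (clampTo β c * x) * fermiPlus β x

theorem exp_div_le (b d : ℝ) : Real.exp d / (1 + Real.exp b) ≤ Real.exp d :=
  div_le_self (Real.exp_pos _).le (by linarith [Real.exp_pos b])

theorem exp_div_le' (b d : ℝ) : Real.exp d / (1 + Real.exp b) ≤ Real.exp (d - b) := by
  rw [Real.exp_sub]
  gcongr
  linarith

theorem abs_lowerFn (β c x : ℝ) :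
    |lowerFn β c x| = Real.exp (-clampTo β c * x) / (1 + Real.exp (-β * x)) := by
  rw [lowerFn, fermiMinus, abs_of_nonneg (by positivity)]
  ring

theorem abs_upperFn (β c x : ℝ) :
    |upperFn β c x| = Real.exp (clampTo β c * x) / (1 + Real.exp (β * x)) := by
  rw [upperFn, fermiPlus, abs_mul, abs_of_pos (Real.exp_pos _), abs_div, abs_neg, abs_one,
    abs_of_pos (by positivity : 0 < 1 + Real.exp (β * x)), mul_one_div]

/-- The Fermi factors decay at rates c and β - c, with the two rates exchanged between the
half-lines and between F₋ and F₊. These rates give the contraction property and are what add up to β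
along a chain. -/
theorem abs_lowerFn_le_of_pos (c : ℝ) {x : ℝ} (hx : 0 ≤ x) :
    |lowerFn β c x| ≤ Real.exp (-(clampTo β c * |x|)) := by
  rw [abs_lowerFn, abs_of_nonneg hx, ← neg_mul]
  exact exp_div_le _ _

theorem abs_lowerFn_le_of_neg (c : ℝ) {x : ℝ} (hx : x ≤ 0) :
    |lowerFn β c x| ≤ Real.exp (-((β - clampTo β c) * |x|)) := by
  rw [abs_lowerFn, abs_of_nonpos hx]
  refine (exp_div_le' _ _).trans (le_of_eq ?_)
  congr 1
  ring

theorem abs_upperFn_le_of_pos (c : ℝ) {x : ℝ} (hx : 0 ≤ x) :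
    |upperFn β c x| ≤ Real.exp (-((β - clampTo β c) * |x|)) := by
  rw [abs_upperFn, abs_of_nonneg hx]
  refine (exp_div_le' _ _).trans (le_of_eq ?_)
  congr 1
  ring

theorem abs_upperFn_le_of_neg (c : ℝ) {x : ℝ} (hx : x ≤ 0) :
    |upperFn β c x| ≤ Real.exp (-(clampTo β c * |x|)) := by
  rw [abs_upperFn, abs_of_nonpos hx]
  refine (exp_div_le _ _).trans (le_of_eq ?_)
  congr 1
  ring

theorem exp_neg_mul_abs_le_one {ρ : ℝ} (hρ : 0 ≤ ρ) (x : ℝ) : Real.exp (-(ρ * |x|)) ≤ 1 :=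
  Real.exp_le_one_iff.2 (by have := mul_nonneg hρ (abs_nonneg x); linarith)

theorem abs_lowerFn_le_one (hβ : 0 < β) (c x : ℝ) : |lowerFn β c x| ≤ 1 := by
  have h := clampTo_mem hβ c
  rcases le_total 0 x with hx | hx
  · exact (abs_lowerFn_le_of_pos c hx).trans (exp_neg_mul_abs_le_one h.1 x)
  · exact (abs_lowerFn_le_of_neg c hx).trans (exp_neg_mul_abs_le_one (sub_nonneg.2 h.2) x)

theorem abs_upperFn_le_one (hβ : 0 < β) (c x : ℝ) : |upperFn β c x| ≤ 1 := by
  have h := clampTo_mem hβ c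
  rcases le_total 0 x with hx | hx
  · exact (abs_upperFn_le_of_pos c hx).trans (exp_neg_mul_abs_le_one (sub_nonneg.2 h.2) x)
  · exact (abs_upperFn_le_of_neg c hx).trans (exp_neg_mul_abs_le_one h.1 x)

theorem measurable_lowerFn (β c : ℝ) : Measurable (lowerFn β c) := by
  unfold lowerFn fermiMinus; fun_prop

theorem measurable_upperFn (β c : ℝ) : Measurable (upperFn β c) := by
  unfold upperFn fermiPlus; fun_prop

theorem isSpecFn_lowerFn (hβ : 0 < β) (c : ℝ) : IsSpecFn m fun x => (lowerFn β c x : ℂ) :=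
  ⟨by have := measurable_lowerFn β c; fun_prop, 1, fun x _ => by
    rw [Complex.norm_real]; exact abs_lowerFn_le_one hβ c x⟩

theorem isSpecFn_upperFn (hβ : 0 < β) (c : ℝ) : IsSpecFn m fun x => (upperFn β c x : ℂ) :=
  ⟨by have := measurable_upperFn β c; fun_prop, 1, fun x _ => by
    rw [Complex.norm_real]; exact abs_upperFn_le_one hβ c x⟩

/-- The operator `F₋ e^{-cD}`, with `c` projected to `[0, β]`. -/
def lowerOp (m β c : ℝ) : BOp := diracOp m fun x => (lowerFn β c x : ℂ)

/-- The operator `e^{cD} F₊`, with `c` projected to `[0, β]`. -/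
def upperOp (m β c : ℝ) : BOp := diracOp m fun x => (upperFn β c x : ℂ)

/-- The operator `e^{lD} F_{σ(l)}`, for `|l| ≤ β`. -/
def midOp (m β l : ℝ) : BOp := if 0 < l then upperOp m β l else lowerOp m β (-l)

theorem norm_lowerOp_le (hm : 0 < m) (hβ : 0 < β) (c : ℝ) : ‖lowerOp m β c‖ ≤ 1 :=
  norm_diracOp_le hm fun x _ => by rw [Complex.norm_real]; exact abs_lowerFn_le_one hβ c x

theorem norm_upperOp_le (hm : 0 < m) (hβ : 0 < β) (c : ℝ) : ‖upperOp m β c‖ ≤ 1 :=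
  norm_diracOp_le hm fun x _ => by rw [Complex.norm_real]; exact abs_upperFn_le_one hβ c x

theorem norm_midOp_le (hm : 0 < m) (hβ : 0 < β) (c : ℝ) : ‖midOp m β c‖ ≤ 1 := by
  unfold midOp
  split_ifs
  · exact norm_upperOp_le hm hβ c
  · exact norm_lowerOp_le hm hβ _

theorem strMeas_lowerOp (hm : 0 < m) (hβ : 0 < β) : StrMeas (lowerOp m β) :=
  StrMeas.of_continuous fun f => continuous_diracOp (C := 1) hm
    (fun c => (isSpecFn_lowerFn (m := m) hβ c).meas)
    (fun c x _ => by rw [Complex.norm_real]; exact abs_lowerFn_le_one hβ c x)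
    (fun x _ => by unfold lowerFn clampTo; fun_prop) f

theorem strMeas_upperOp (hm : 0 < m) (hβ : 0 < β) : StrMeas (upperOp m β) :=
  StrMeas.of_continuous fun f => continuous_diracOp (C := 1) hm
    (fun c => (isSpecFn_upperFn (m := m) hβ c).meas)
    (fun c x _ => by rw [Complex.norm_real]; exact abs_upperFn_le_one hβ c x)
    (fun x _ => by unfold upperFn clampTo; fun_prop) f

theorem strMeas_midOp (hm : 0 < m) (hβ : 0 < β) : StrMeas (midOp m β) :=
  StrMeas.ite measurableSet_Ioi (strMeas_upperOp hm hβ) ((strMeas_lowerOp hm hβ).comp measurable_neg)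

/-! ### The terms of the series `T` -/

/-- The integrand of the series for `e^{-aD} (T(ū) - T(0)) e^{aD}`, with the exponents projected to
the range in which the operators are bounded. -/
def shiftedIntegrand (m β : ℝ) (K : BOp) (n : ℕ) (a : ℝ) (u : Fin (n + 1) → ℝ) : BOp :=
  lowerOp m β (a + u 0) * (List.ofFn fun j : Fin n => K * midOp m β (u j.castSucc - u j.succ)).prod *
    K * upperOp m β (a + u (Fin.last n))

theorem strMeas_listProd {T : Type} [MeasurableSpace T] (l : List (T → BOp))
    (h : ∀ Φ ∈ l, StrMeas Φ) : StrMeas fun t => (l.map fun Φ => Φ t).prod := by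
  induction l with
  | nil => exact StrMeas.const 1
  | cons Φ l ih =>
    simp only [List.map_cons, List.prod_cons]
    exact (h Φ (by simp)).mul (ih fun Ψ hΨ => h Ψ (by simp [hΨ]))

theorem strMeas_shiftedIntegrand (hm : 0 < m) (hβ : 0 < β) (K : BOp) (n : ℕ) :
    StrMeas fun z : ℝ × (Fin (n + 1) → ℝ) => shiftedIntegrand m β K n z.1 z.2 := by
  have h : StrMeas fun z : ℝ × (Fin (n + 1) → ℝ) =>
      (List.ofFn fun j : Fin n => K * midOp m β (z.2 j.castSucc - z.2 j.succ)).prod := by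
    have := strMeas_listProd (List.ofFn fun (j : Fin n) (z : ℝ × (Fin (n + 1) → ℝ)) =>
      K * midOp m β (z.2 j.castSucc - z.2 j.succ)) fun Φ hΦ => by
        obtain ⟨j, rfl⟩ := (List.mem_ofFn' _ _).1 hΦ
        exact (StrMeas.const K).mul ((strMeas_midOp hm hβ).comp (by fun_prop))
    simpa only [List.map_ofFn, Function.comp_def] using this
  exact ((((strMeas_lowerOp hm hβ).comp (by fun_prop)).mul h).mul (StrMeas.const K)).mul
    ((strMeas_upperOp hm hβ).comp (by fun_prop))

theorem norm_listProd_le (l : List BOp) {k : ℝ} (hk : 0 ≤ k) (h : ∀ T ∈ l, ‖T‖ ≤ k) :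
    ‖l.prod‖ ≤ k ^ l.length := by
  induction l with
  | nil =>
    rw [List.prod_nil, List.length_nil, pow_zero]
    exact ContinuousLinearMap.norm_id_le
  | cons T l ih =>
    rw [List.prod_cons, List.length_cons, pow_succ']
    exact (norm_mul_le _ _).trans (mul_le_mul (h T (by simp)) (ih fun S hS => h S (by simp [hS]))
      (norm_nonneg _) hk)

theorem norm_shiftedIntegrand_le (hm : 0 < m) (hβ : 0 < β) (K : BOp) (n : ℕ) (a : ℝ)
    (u : Fin (n + 1) → ℝ) : ‖shiftedIntegrand m β K n a u‖ ≤ ‖K‖ ^ (n + 1) := by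
  have h1 := norm_lowerOp_le hm hβ (a + u 0)
  have h2 := norm_upperOp_le hm hβ (a + u (Fin.last n))
  have h3 := norm_listProd_le (List.ofFn fun j : Fin n => K * midOp m β (u j.castSucc - u j.succ))
    (norm_nonneg K) fun T hT => by
      obtain ⟨j, rfl⟩ := (List.mem_ofFn' _ _).1 hT
      exact (norm_mul_le _ _).trans (mul_le_of_le_one_right (norm_nonneg _) (norm_midOp_le hm hβ _))
  rw [List.length_ofFn] at h3
  unfold shiftedIntegrand
  calc _ ≤ ‖lowerOp m β (a + u 0)‖ *
        ‖(List.ofFn fun j : Fin n => K * midOp m β (u j.castSucc - u j.succ)).prod‖ * ‖K‖ *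
        ‖upperOp m β (a + u (Fin.last n))‖ := by
        refine (norm_mul_le _ _).trans ?_
        gcongr
        refine (norm_mul_le _ _).trans ?_
        gcongr
        exact norm_mul_le _ _
    _ ≤ 1 * ‖K‖ ^ n * ‖K‖ * 1 := by gcongr
    _ = _ := by ring

theorem measurableSet_cube (k : ℕ) (ub : ℝ) :
    MeasurableSet (Set.univ.pi fun _ : Fin k => Set.Ioo 0 ub) :=
  MeasurableSet.univ_pi fun _ => measurableSet_Ioo

theorem cubeMeasure_univ (k : ℕ) {ub : ℝ} (hub : 0 ≤ ub) :
    cubeMeasure k ub Set.univ = ENNReal.ofReal (ub ^ k) := by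
  rw [cubeMeasure, Measure.restrict_apply_univ, Real.volume_pi_Ioo]
  simp [ENNReal.ofReal_pow hub]

instance (k : ℕ) (ub : ℝ) : IsFiniteMeasure (cubeMeasure k ub) := by
  refine ⟨?_⟩
  rw [cubeMeasure, Measure.restrict_apply_univ, Real.volume_pi_Ioo]
  exact ENNReal.prod_lt_top fun _ _ => ENNReal.ofReal_lt_top

theorem integral_cubeMeasure_const (k : ℕ) {ub : ℝ} (hub : 0 ≤ ub) (c : ℝ) :
    ∫ _, c ∂cubeMeasure k ub = ub ^ k * c := by
  rw [integral_const, Measure.real, cubeMeasure_univ k hub, smul_eq_mul,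
    ENNReal.toReal_ofReal (by positivity)]

/-- The integral of `shiftedIntegrand` over the cube. -/
def shiftedIntegral (m β : ℝ) (K : BOp) (n : ℕ) (a ub : ℝ) : BOp :=
  strongIntegral (cubeMeasure (n + 1) ub) (shiftedIntegrand m β K n a)

theorem hasStrongIntegral_shiftedIntegral (hm : 0 < m) (hβ : 0 < β) (K : BOp) (n : ℕ) (a ub : ℝ) :
    HasStrongIntegral (cubeMeasure (n + 1) ub) (shiftedIntegrand m β K n a)
      (shiftedIntegral m β K n a ub) :=
  exists_hasStrongIntegral (fun f => (((strMeas_shiftedIntegrand hm hβ K n).comp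
    (g := fun u => (a, u)) (by fun_prop)) f).aestronglyMeasurable) (integrable_const _)
    (ae_of_all _ fun u => norm_shiftedIntegrand_le hm hβ K n a u)

theorem norm_shiftedIntegral_le (hm : 0 < m) (hβ : 0 < β) (K : BOp) (n : ℕ) (a : ℝ) {ub : ℝ}
    (hub : 0 ≤ ub) : ‖shiftedIntegral m β K n a ub‖ ≤ (ub * ‖K‖) ^ (n + 1) := by
  have h := (hasStrongIntegral_shiftedIntegral hm hβ K n a ub).norm_le (integrable_const _)
    (ae_of_all _ fun u => norm_shiftedIntegrand_le hm hβ K n a u)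
  rwa [integral_cubeMeasure_const _ hub, ← mul_pow] at h

theorem ae_mem_cube (k : ℕ) (ub : ℝ) : ∀ᵐ u ∂cubeMeasure k ub, ∀ i, u i ∈ Set.Ioo 0 ub := by
  rw [cubeMeasure, ae_restrict_iff' (measurableSet_cube k ub)]
  exact ae_of_all _ fun u hu i => hu i (Set.mem_univ i)

theorem midOp_eq {u v : ℝ} (hu : u ∈ Set.Icc 0 β) (hv : v ∈ Set.Icc 0 β) :
    midOp m β (u - v) = diracOp m fun x => ((Real.exp (u * x) * fermiSign β (u - v) x *
        Real.exp (-v * x) : ℝ) : ℂ) := by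
  have h : ∀ x, Real.exp ((u - v) * x) = Real.exp (u * x) * Real.exp (-v * x) := fun x => by
    rw [← Real.exp_add]; congr 1; ring
  unfold midOp fermiSign
  split_ifs with hl
  · rw [upperOp]
    refine diracOp_congr fun x _ => ?_
    rw [upperFn, clampTo_of_mem ⟨hl.le, by linarith [hu.2, hv.1]⟩, h]
    push_cast
    ring
  · rw [lowerOp]
    refine diracOp_congr fun x _ => ?_
    rw [lowerFn, clampTo_of_mem ⟨by linarith, by linarith [hv.2, hu.1]⟩, neg_neg, h]
    push_cast
    ring

theorem TIntegrand_eq (K : BOp) (n : ℕ) {u : Fin (n + 1) → ℝ} (hu : ∀ i, u i ∈ Set.Icc 0 β) :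
    TIntegrand m β K n u = shiftedIntegrand m β K n 0 u := by
  unfold TIntegrand shiftedIntegrand
  simp only [midOp_eq (hu _) (hu _), zero_add, lowerOp, upperOp, lowerFn, upperFn,
    clampTo_of_mem (hu _)]

theorem hasStrongIntegral_TIntegrand (hm : 0 < m) (hβ : 0 < β) (K : BOp) (n : ℕ) {ub : ℝ}
    (hub : ub ≤ β) : HasStrongIntegral (cubeMeasure (n + 1) ub) (TIntegrand m β K n)
      (shiftedIntegral m β K n 0 ub) := by
  refine (hasStrongIntegral_shiftedIntegral hm hβ K n 0 ub).congr ?_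
  filter_upwards [ae_mem_cube (n + 1) ub] with u hu
  exact (TIntegrand_eq K n fun i => ⟨(hu i).1.le, (hu i).2.le.trans hub⟩).symm

theorem TIntegral_eq (hm : 0 < m) (hβ : 0 < β) (K : BOp) (n : ℕ) {ub : ℝ} (hub : ub ≤ β) :
    TIntegral m β K n ub = shiftedIntegral m β K n 0 ub :=
  (hasStrongIntegral_TIntegrand hm hβ K n hub).strongIntegral_eq

theorem summable_norm_shiftedIntegral (hm : 0 < m) (hβ : 0 < β) {K : BOp} (hK : β * ‖K‖ < 1)
    (a : ℝ) {ub : ℝ} (hub : ub ∈ Set.Icc 0 β) :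
    Summable fun n => ‖shiftedIntegral m β K n a ub‖ := by
  have h1 : Summable fun n => (β * ‖K‖) ^ (n + 1) :=
    (summable_nat_add_iff 1).2 (summable_geometric_of_lt_one (by positivity) hK)
  refine h1.of_nonneg_of_le (fun _ => norm_nonneg _) fun n => ?_
  refine (norm_shiftedIntegral_le hm hβ K n a hub.1).trans ?_
  have := hub.1
  gcongr
  exact hub.2

end

end DiracEntropy

namespace DiracEntropy
open Filter Topology

/-! ### Conjugation with `e^{aD}` -/

section
variable {m β : ℝ}

theorem isSpecFn_expCut (m Λ a : ℝ) :
    IsSpecFn m fun x => if |x| ≤ Λ then (Real.exp (a * x) : ℂ) else 0 where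
  meas := Measurable.ite (measurableSet_le (by fun_prop) measurable_const) (by fun_prop)
    measurable_const
  bdd := ⟨Real.exp (|a| * Λ), fun x _ => by
    split_ifs with h
    · rw [Complex.norm_real, Real.norm_of_nonneg (Real.exp_pos _).le]
      refine Real.exp_le_exp.2 ((le_abs_self _).trans ?_)
      rw [abs_mul]
      gcongr
    · rw [norm_zero]
      positivity⟩

theorem tendsto_expCut (hm : 0 < m) (f : HSp) :
    Tendsto (fun Λ => expCut m Λ 0 f) atTop (𝓝 f) := by
  have h := tendsto_diracOp hm (l := atTop) (C := 1) (fun Λ => isSpecFn_expCut m Λ 0)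
    (isSpecFn_freeEvol m 0) (Eventually.of_forall fun Λ x _ => by
      split_ifs
      · simp
      · simp) (fun x _ => by
      refine tendsto_const_nhds.congr' ?_
      filter_upwards [eventually_ge_atTop |x|] with Λ hΛ
      simp [hΛ]) f
  have e : diracOp m (fun x => Complex.exp (Complex.I * ((0 : ℝ) : ℂ) * x)) = 1 := freeEvol_zero m
  rw [e] at h
  exact h

theorem expCut_adjoint (hm : 0 < m) (Λ a : ℝ) :
    ContinuousLinearMap.adjoint (expCut m Λ a) = expCut m Λ a := by
  rw [expCut, diracOp_adjoint hm (isSpecFn_expCut m Λ a)]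
  congr 1
  ext1 x
  split_ifs
  · rw [Complex.conj_ofReal]
  · rw [map_zero]

/-- The self-adjoint cutoffs tend strongly to the identity, so the cut-off matrix elements determine
the operator. -/
theorem IsConj.unique (hm : 0 < m) {a : ℝ} {X Y Y' : BOp} (h : IsConj m a X Y)
    (h' : IsConj m a X Y') : Y = Y' := by
  have key : ∀ (Z : BOp) (x y : HSp), Tendsto
      (fun Λ => inner ℂ x ((expCut m Λ 0 * Z * expCut m Λ 0) y)) atTop (𝓝 (inner ℂ x (Z y))) := by
    intro Z x y
    have e : ∀ Λ, inner ℂ x ((expCut m Λ 0 * Z * expCut m Λ 0) y)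
        = inner ℂ (expCut m Λ 0 x) (Z (expCut m Λ 0 y)) := fun Λ => by
      rw [mul_assoc, mul_apply_eq_comp, ← ContinuousLinearMap.adjoint_inner_left,
        expCut_adjoint hm]
      rfl
    simp only [e]
    exact (tendsto_expCut hm x).inner ((Z.continuous.tendsto y).comp (tendsto_expCut hm y))
  ext1 y
  refine ext_inner_left ℂ fun x => ?_
  refine tendsto_nhds_unique (key Y x y) ?_
  simp only [h _]
  simp only [← h' _]
  exact key Y' x y

theorem conjOp_eq (hm : 0 < m) {a : ℝ} {X Y : BOp} (h : IsConj m a X Y) : conjOp m a X = Y := by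
  have h' : ∃ Y, IsConj m a X Y := ⟨Y, h⟩
  rw [conjOp, dif_pos h']
  exact h'.choose_spec.unique hm h

theorem expCut_mul_lowerOp (hm : 0 < m) (hβ : 0 < β) {Λ a u : ℝ} (hu : u ∈ Set.Icc 0 β)
    (hau : a + u ∈ Set.Icc 0 β) :
    expCut m Λ (-a) * lowerOp m β u = expCut m Λ 0 * lowerOp m β (a + u) := by
  rw [expCut, expCut, lowerOp, lowerOp, diracOp_mul hm (isSpecFn_expCut m Λ _)
    (isSpecFn_lowerFn hβ _), diracOp_mul hm (isSpecFn_expCut m Λ _) (isSpecFn_lowerFn hβ _)]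
  refine diracOp_congr fun x _ => ?_
  split_ifs
  · rw [← Complex.ofReal_mul, ← Complex.ofReal_mul, lowerFn, lowerFn, clampTo_of_mem hu,
      clampTo_of_mem hau]
    congr 1
    have : Real.exp (-(a + u) * x) = Real.exp (-a * x) * Real.exp (-u * x) := by
      rw [← Real.exp_add]; congr 1; ring
    rw [this, zero_mul, Real.exp_zero]
    ring
  · simp

theorem upperOp_mul_expCut (hm : 0 < m) (hβ : 0 < β) {Λ a u : ℝ} (hu : u ∈ Set.Icc 0 β)
    (hau : a + u ∈ Set.Icc 0 β) :
    upperOp m β u * expCut m Λ a = upperOp m β (a + u) * expCut m Λ 0 := by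
  rw [expCut, expCut, upperOp, upperOp, diracOp_mul hm (isSpecFn_upperFn hβ _)
    (isSpecFn_expCut m Λ _), diracOp_mul hm (isSpecFn_upperFn hβ _) (isSpecFn_expCut m Λ _)]
  refine diracOp_congr fun x _ => ?_
  split_ifs
  · rw [← Complex.ofReal_mul, ← Complex.ofReal_mul, upperFn, upperFn, clampTo_of_mem hu,
      clampTo_of_mem hau]
    congr 1
    have : Real.exp ((a + u) * x) = Real.exp (a * x) * Real.exp (u * x) := by
      rw [← Real.exp_add]; congr 1; ring
    rw [this, zero_mul, Real.exp_zero]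
    ring
  · simp

/-- Conjugation by e^{aD} leaves the inner factors alone and shifts the two outer exponents by a.
The condition a + ū ≤ β keeps the shifted exponents in the range where the Fermi factors bound them.
-/
theorem isConj_shiftedIntegral (hm : 0 < m) (hβ : 0 < β) (K : BOp) (n : ℕ) {a ub : ℝ}
    (ha : 0 ≤ a) (hab : a + ub ≤ β) :
    IsConj m a (shiftedIntegral m β K n 0 ub) (shiftedIntegral m β K n a ub) := fun Λ => by
  have h1 := ((hasStrongIntegral_shiftedIntegral hm hβ K n a ub).mul_left (expCut m Λ 0)).mul_right
    (expCut m Λ 0)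
  have h2 := ((hasStrongIntegral_shiftedIntegral hm hβ K n 0 ub).mul_left
    (expCut m Λ (-a))).mul_right (expCut m Λ a)
  refine h1.unique (h2.congr ?_)
  filter_upwards [ae_mem_cube (n + 1) ub] with u hu
  have h3 : ∀ i, u i ∈ Set.Icc 0 β := fun i =>
    ⟨(hu i).1.le, by linarith [(hu i).2]⟩
  have h4 : ∀ i, a + u i ∈ Set.Icc 0 β := fun i =>
    ⟨by linarith [(hu i).1], by linarith [(hu i).2]⟩
  unfold shiftedIntegrand
  rw [zero_add, zero_add]
  simp only [← mul_assoc]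
  rw [expCut_mul_lowerOp hm hβ (h3 0) (h4 0), mul_assoc _ (upperOp m β _) (expCut m Λ a),
    upperOp_mul_expCut hm hβ (h3 _) (h4 _)]
  simp only [← mul_assoc]

/-- The series for `e^{-aD} (T(ū) - T(0)) e^{aD}`. -/
def shiftedSeries (m β : ℝ) (K : BOp) (a ub : ℝ) : BOp :=
  ∑' n : ℕ, (-1 : ℂ) ^ (n + 1) • shiftedIntegral m β K n a ub

theorem norm_signed (n : ℕ) (S : BOp) : ‖(-1 : ℂ) ^ n • S‖ = ‖S‖ := by
  rw [norm_smul, norm_pow, norm_neg, norm_one, one_pow, one_mul]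

theorem summable_shiftedSeries (hm : 0 < m) (hβ : 0 < β) {K : BOp} (hK : β * ‖K‖ < 1)
    (a : ℝ) {ub : ℝ} (hub : ub ∈ Set.Icc 0 β) :
    Summable fun n : ℕ => (-1 : ℂ) ^ (n + 1) • shiftedIntegral m β K n a ub :=
  Summable.of_norm (by simpa only [norm_signed] using
    summable_norm_shiftedIntegral hm hβ hK a hub)

/-- The cube of edge 0 is null, so T(0) consists of the zeroth term alone. -/
theorem TOp_sub (hm : 0 < m) (hβ : 0 < β) {K : BOp} {ub : ℝ} (hub : ub ∈ Set.Icc 0 β) :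
    TOp m β K ub - TOp m β K 0 = shiftedSeries m β K 0 ub := by
  have h0 : ∀ n, TIntegral m β K n 0 = 0 := fun n => by
    have := norm_shiftedIntegral_le hm hβ K n 0 (le_refl (0 : ℝ))
    rw [zero_mul, zero_pow n.succ_ne_zero] at this
    rw [TIntegral_eq hm hβ K n hβ.le]
    exact norm_le_zero_iff.1 this
  simp only [TOp, shiftedSeries, h0, smul_zero, tsum_zero, add_zero, add_sub_cancel_left,
    TIntegral_eq hm hβ K _ hub.2]

theorem isConj_shiftedSeries (hm : 0 < m) (hβ : 0 < β) {K : BOp} (hK : β * ‖K‖ < 1) {a ub : ℝ}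
    (ha : 0 ≤ a) (hub : 0 ≤ ub) (hab : a + ub ≤ β) :
    IsConj m a (TOp m β K ub - TOp m β K 0) (shiftedSeries m β K a ub) := fun Λ => by
  have hub' : ub ∈ Set.Icc 0 β := ⟨hub, by linarith⟩
  have h1 := summable_shiftedSeries hm hβ hK a hub'
  have h2 := summable_shiftedSeries hm hβ hK 0 hub'
  rw [TOp_sub hm hβ hub', shiftedSeries, shiftedSeries, ← h1.tsum_mul_left,
    ← (h1.mul_left _).tsum_mul_right, ← h2.tsum_mul_left, ← (h2.mul_left _).tsum_mul_right]
  refine tsum_congr fun n => ?_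
  simp only [mul_smul_comm, smul_mul_assoc, isConj_shiftedIntegral hm hβ K n ha hab Λ]

/-! ### The operator `B` -/

/-- The cube depends on the parameter ū. Writing its restriction as the indicator of a measurable
set in the product space reduces the claim to measurability of a parameter integral. -/
theorem strMeas_shiftedIntegral (hm : 0 < m) (hβ : 0 < β) (K : BOp) (n : ℕ) :
    StrMeas fun z : ℝ × ℝ => shiftedIntegral m β K n z.1 z.2 := fun f => by
  have hS : MeasurableSet {w : (ℝ × ℝ) × (Fin (n + 1) → ℝ) | ∀ i, 0 < w.2 i ∧ w.2 i < w.1.2} := by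
    simp only [Set.ofPred_forall, Set.ofPred_and]
    exact MeasurableSet.iInter fun i => (measurableSet_lt (by fun_prop) (by fun_prop)).inter
      (measurableSet_lt (by fun_prop) (by fun_prop))
  have h := (((strMeas_shiftedIntegrand hm hβ K n).comp
    (g := fun w : (ℝ × ℝ) × (Fin (n + 1) → ℝ) => (w.1.1, w.2)) (by fun_prop)) f).indicator hS
  have e : (fun z : ℝ × ℝ => shiftedIntegral m β K n z.1 z.2 f) = fun z : ℝ × ℝ => ∫ u,
      {w : (ℝ × ℝ) × (Fin (n + 1) → ℝ) | ∀ i, 0 < w.2 i ∧ w.2 i < w.1.2}.indicator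
        (fun w => shiftedIntegrand m β K n w.1.1 w.2 f) (z, u) := funext fun z => by
    rw [(hasStrongIntegral_shiftedIntegral hm hβ K n z.1 z.2 f).2, cubeMeasure,
      ← integral_indicator (measurableSet_cube _ _)]
    refine integral_congr_ae (ae_of_all _ fun u => ?_)
    simp only [Set.indicator, Set.mem_pi, Set.mem_univ, true_imp_iff, Set.mem_Ioo, Set.mem_ofPred_eq]
  rw [e]
  exact h.integral_prod_right'

theorem aestronglyMeasurable_shiftedSeries (hm : 0 < m) (hβ : 0 < β) {K : BOp} (hK : β * ‖K‖ < 1)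
    (f : HSp) : AEStronglyMeasurable (fun u => shiftedSeries m β K (β * (1 - u)) (β * u) f)
      (volume.restrict (Set.Ioo 0 1)) := by
  refine aestronglyMeasurable_of_tendsto_ae (u := atTop)
    (f := fun N u => ∑ n ∈ Finset.range N, (-1 : ℂ) ^ (n + 1) •
      shiftedIntegral m β K n (β * (1 - u)) (β * u) f) (fun N => ?_) ?_
  · refine Finset.aestronglyMeasurable_fun_sum _ fun n _ => ?_
    exact ((((strMeas_shiftedIntegral hm hβ K n).comp (g := fun u => (β * (1 - u), β * u))
      (by fun_prop)) f).const_smul ((-1 : ℂ) ^ (n + 1))).aestronglyMeasurable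
  · refine (ae_restrict_iff' measurableSet_Ioo).2 (ae_of_all _ fun u hu => ?_)
    have h := (summable_shiftedSeries hm hβ hK (β * (1 - u)) (ub := β * u)
      ⟨by have := hu.1; positivity, by nlinarith [hu.2]⟩).hasSum.tendsto_sum_nat
    have h2 := ((ContinuousLinearMap.apply ℂ HSp f).continuous.tendsto _).comp h
    refine h2.congr fun N => ?_
    simp

theorem norm_shiftedSeries_le (hm : 0 < m) (hβ : 0 < β) {K : BOp} (hK : β * ‖K‖ < 1)
    (a : ℝ) {ub : ℝ} (hub : ub ∈ Set.Icc 0 β) :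
    ‖shiftedSeries m β K a ub‖ ≤ β * ‖K‖ / (1 - β * ‖K‖) := by
  have hg := (hasSum_geometric_of_lt_one (by positivity : 0 ≤ β * ‖K‖) hK).mul_left (β * ‖K‖)
  rw [← div_eq_mul_inv] at hg
  refine tsum_of_norm_bounded hg fun n => ?_
  rw [norm_signed, ← pow_succ']
  refine (norm_shiftedIntegral_le hm hβ K n a hub.1).trans ?_
  have := hub.1
  gcongr
  exact hub.2

/-- Here a = β(1 - u) and ū = βu, so that a + ū = β, the extreme case in which the shifted exponents
are still admissible. -/
theorem BIntegrand_eq (hm : 0 < m) (hβ : 0 < β) {K : BOp} (hK : β * ‖K‖ < 1) {u : ℝ}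
    (hu : u ∈ Set.Ioo 0 1) :
    BIntegrand m β K u = (β : ℂ) • shiftedSeries m β K (β * (1 - u)) (β * u) := by
  rw [BIntegrand, conjOp_eq hm (isConj_shiftedSeries hm hβ hK
    (mul_nonneg hβ.le (by linarith [hu.2])) (mul_nonneg hβ.le hu.1.le) (by nlinarith))]

theorem hasStrongIntegral_Bop_series (hm : 0 < m) (hβ : 0 < β) {K : BOp} (hK : β * ‖K‖ < 1) :
    HasStrongIntegral (volume.restrict (Set.Ioo 0 1))
      (fun u => (β : ℂ) • shiftedSeries m β K (β * (1 - u)) (β * u)) (Bop m β K) := by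
  have h1 := exists_hasStrongIntegral (μ := volume.restrict (Set.Ioo (0 : ℝ) 1))
    (Φ := fun u => (β : ℂ) • shiftedSeries m β K (β * (1 - u)) (β * u))
    (c := fun _ => β * (β * ‖K‖ / (1 - β * ‖K‖)))
    (fun f => (aestronglyMeasurable_shiftedSeries hm hβ hK f).const_smul (β : ℂ))
    (integrable_const _) ((ae_restrict_iff' measurableSet_Ioo).2 (ae_of_all _ fun u hu => by
      rw [norm_smul, Complex.norm_real, Real.norm_of_nonneg hβ.le]
      gcongr
      exact norm_shiftedSeries_le hm hβ hK _ ⟨mul_nonneg hβ.le hu.1.le, by nlinarith [hu.2]⟩))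
  have h2 : HasStrongIntegral (volume.restrict (Set.Ioo 0 1)) (BIntegrand m β K) _ :=
    h1.congr ((ae_restrict_iff' measurableSet_Ioo).2 (ae_of_all _ fun u hu =>
      (BIntegrand_eq hm hβ hK hu).symm))
  rw [Bop, h2.strongIntegral_eq]
  exact h1

theorem hasStrongIntegral_Bop (hm : 0 < m) (hβ : 0 < β) {K : BOp} (hK : β * ‖K‖ < 1) :
    HasStrongIntegral (volume.restrict (Set.Ioo 0 1)) (BIntegrand m β K) (Bop m β K) :=
  (hasStrongIntegral_Bop_series hm hβ hK).congr ((ae_restrict_iff' measurableSet_Ioo).2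
    (ae_of_all _ fun _ hu => (BIntegrand_eq hm hβ hK hu).symm))

theorem norm_entropyOp_le (hm : 0 < m) (hβ : 0 < β) {K : BOp} (hK : β * ‖K‖ < 1) :
    ‖entropyOp m β K‖ ≤ β ^ 2 * ‖K‖ ^ 2 / (1 - β * ‖K‖) := by
  have h := (hasStrongIntegral_Bop_series hm hβ hK).norm_le
    (c := fun _ => β * (β * ‖K‖ / (1 - β * ‖K‖))) (integrable_const _)
    ((ae_restrict_iff' measurableSet_Ioo).2 (ae_of_all _ fun u hu => by
      rw [norm_smul, Complex.norm_real, Real.norm_of_nonneg hβ.le]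
      gcongr
      exact norm_shiftedSeries_le hm hβ hK _ ⟨mul_nonneg hβ.le hu.1.le, by nlinarith [hu.2]⟩))
  rw [integral_const] at h
  simp only [measureReal_restrict_apply_univ, Real.volume_real_Ioo, sub_zero, smul_eq_mul,
    max_eq_left zero_le_one, one_mul] at h
  calc ‖entropyOp m β K‖ ≤ ‖K‖ * ‖Bop m β K‖ := norm_mul_le _ _
    _ ≤ ‖K‖ * (β * (β * ‖K‖ / (1 - β * ‖K‖))) := by gcongr
    _ = _ := by ring

end

end DiracEntropy

namespace DiracEntropy
open Filter Topology
open scoped Nat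

/-! ### Trace norm bounds for the terms of the series -/

section
variable {m β : ℝ}

/-- P is carried along the chain. It commutes with g, and the next K is split as KP + KQ: the Q-term
contains the trace class block PKQ, the P-term is a shorter chain of the same kind. The process ends
at a factor h for which KPh is trace class. Each stopping possibility contributes at most M times
powers of k, whence the factor `gs.length + 1`. -/
theorem traceNormLe_chain {K P Q : BOp} {M k : ℝ} (hPQ : P + Q = 1) (hP : ‖P‖ ≤ 1) (hk : ‖K‖ ≤ k)
    (hM : TraceNormLe (P * K * Q) M) (g : BOp) (gs : List BOp)
    (hg : ∀ h ∈ g :: gs, ‖h‖ ≤ 1 ∧ P * h = h * P)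
    (hex : ∃ h ∈ g :: gs, TraceNormLe (K * P * h) M) :
    TraceNormLe (K * P * g * (gs.map (K * ·)).prod) ((gs.length + 1) * M * k ^ gs.length) := by
  have hk0 : 0 ≤ k := (norm_nonneg K).trans hk
  have hM0 := hM.nonneg
  have hprod : ∀ l : List BOp, (∀ h ∈ l, ‖h‖ ≤ 1) → ‖(l.map (K * ·)).prod‖ ≤ k ^ l.length := by
    intro l hl
    rw [← List.length_map (K * ·)]
    refine norm_listProd_le _ hk0 fun T hT => ?_
    obtain ⟨h, hh, rfl⟩ := List.mem_map.1 hT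
    exact (norm_mul_le _ _).trans ((mul_le_of_le_one_right (norm_nonneg _) (hl h hh)).trans hk)
  induction gs generalizing g with
  | nil =>
    obtain ⟨h, hh, hT⟩ := hex
    rw [List.mem_singleton] at hh
    subst hh
    simpa using hT
  | cons g1 gs ih =>
    have hgs : ∀ h ∈ g1 :: gs, ‖h‖ ≤ 1 ∧ P * h = h * P := fun h hh => hg h (by simp [hh])
    -- If the current factor already yields the trace norm, the rest of the chain is only bounded in
    -- operator norm; otherwise the good factor lies further on.
    by_cases h0 : TraceNormLe (K * P * g) M
    · refine (h0.mul_right (hprod (g1 :: gs) fun h hh => (hgs h hh).1)).mono ?_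
      have : 0 ≤ M * k ^ (g1 :: gs).length := by positivity
      nlinarith [(Nat.cast_nonneg (g1 :: gs).length : (0 : ℝ) ≤ _)]
    · have hex' : ∃ h ∈ g1 :: gs, TraceNormLe (K * P * h) M := by
        obtain ⟨h, hh, hT⟩ := hex
        rcases List.mem_cons.1 hh with rfl | hh
        · exact absurd hT h0
        · exact ⟨h, hh, hT⟩
      have h1 := ih g1 hgs hex'
      have hg0 := hg g (by simp)
      have hg1 := hgs g1 (by simp)
      have hKg : ‖K * g‖ ≤ k :=
        (norm_mul_le _ _).trans ((mul_le_of_le_one_right (norm_nonneg _) hg0.1).trans hk)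
      have hKgP : ‖K * g * P‖ ≤ k :=
        (norm_mul_le _ _).trans ((mul_le_of_le_one_right (norm_nonneg _) hP).trans hKg)
      have hrest : ‖g1 * (gs.map (K * ·)).prod‖ ≤ k ^ gs.length := by
        refine (norm_mul_le _ _).trans ?_
        have := hprod gs fun h hh => (hgs h (by simp [hh])).1
        exact (mul_le_of_le_one_left (norm_nonneg _) hg1.1).trans this
      have h2 := ((hM.mul_right hrest).mul_left hKg).add (h1.mul_left hKgP)
      have e : K * P * g * ((g1 :: gs).map (K * ·)).prod
          = K * g * (P * K * Q * (g1 * (gs.map (K * ·)).prod))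
            + K * g * P * (K * P * g1 * (gs.map (K * ·)).prod) := by
        have hK : K = K * P + K * Q := by rw [← mul_add, hPQ, mul_one]
        rw [List.map_cons, List.prod_cons, mul_assoc K P g, hg0.2]
        calc K * (g * P) * (K * g1 * (gs.map (K * ·)).prod)
            = K * (g * P) * ((K * P + K * Q) * g1 * (gs.map (K * ·)).prod) := by rw [← hK]
          _ = _ := by noncomm_ring
      rw [e]
      refine h2.mono (le_of_eq ?_)
      rw [List.length_cons]
      push_cast
      ring

/-- The two spectral projections exhaust the space because 0 lies in the mass gap. -/
theorem decayOp_add (hm : 0 < m) : decayOp m 1 0 + decayOp m (-1) 0 = 1 := by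
  rw [decayOp, decayOp, ← diracOp_add hm (isSpecFn_decayFn m _ _) (isSpecFn_decayFn m _ _),
    ← diracOp_one m]
  refine diracOp_congr fun x hx => ?_
  have hx0 : x ≠ 0 := by rintro rfl; rw [abs_zero] at hx; linarith
  rcases hx0.lt_or_gt with h | h
  · simp [decayFn, h, h.not_gt]
  · simp [decayFn, h, h.not_gt]

/-- The function `f` is bounded by `e^{-ρ|x|}` on the half-line `σ x > 0`. -/
def DecaysAt (σ ρ : ℝ) (f : ℝ → ℝ) : Prop := ∀ x, 0 < σ * x → |f x| ≤ Real.exp (-(ρ * |x|))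

/-- On the half-line the function is D⁻⁴ times D⁴ f(D), and exponential decay at rate δ bounds the
latter by 4!/δ⁴. -/
theorem DecaysAt.traceNormLe (hm : 0 < m) {K : BOp} {C σ ρ δ : ℝ} {f : ℝ → ℝ}
    (hf : IsSpecFn m fun x => (f x : ℂ)) (hK : TraceNormLe (K * resolventSq m) C)
    (h : DecaysAt σ ρ f) (hδ : 0 < δ) (hρ : δ ≤ ρ) :
    TraceNormLe (K * decayOp m σ 0 * diracOp m fun x => (f x : ℂ)) (C * (4 ! / δ ^ 4)) := by
  have hs : IsSpecFn m fun x => ((x : ℂ) ^ 4)⁻¹ := by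
    have := (isSpecFn_inv_sq hm).mul (isSpecFn_inv_sq hm)
    convert this using 2 with x
    rw [← mul_inv]; ring
  have hb : ∀ x : ℝ, ‖(x : ℂ) ^ 4 * (decayFn σ 0 x * f x)‖ ≤ 4 ! / δ ^ 4 := fun x => by
    by_cases hx : 0 < σ * x
    · have h1 : ‖decayFn σ 0 x * f x‖ ≤ Real.exp (-(δ * |x|)) := by
        rw [norm_mul, Complex.norm_real, Real.norm_eq_abs]
        refine (mul_le_of_le_one_left (abs_nonneg _) (norm_decayFn_le_one σ 0 x)).trans
          ((h x hx).trans ?_)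
        gcongr
      rw [norm_mul, norm_pow, Complex.norm_real, Real.norm_eq_abs]
      exact (mul_le_mul_of_nonneg_left h1 (by positivity)).trans
        (pow_mul_exp_neg_le 4 hδ (abs_nonneg x))
    · rw [decayFn, if_neg hx]
      simp
      positivity
  have hd := (isSpecFn_decayFn m σ 0).mul hf
  have hs2 : IsSpecFn m fun x => (x : ℂ) ^ 4 * (decayFn σ 0 x * f x) :=
    ⟨(by fun_prop : Measurable fun x : ℝ => (x : ℂ) ^ 4).mul hd.meas, _, fun x _ => hb x⟩
  have e : decayOp m σ 0 * diracOp m (fun x => (f x : ℂ))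
      = resolventSq m * diracOp m fun x => (x : ℂ) ^ 4 * (decayFn σ 0 x * f x) := by
    rw [decayOp, diracOp_mul hm (isSpecFn_decayFn m σ 0) hf, resolventSq_eq hm, diracOp_mul hm hs hs2]
    refine diracOp_congr fun x hx => ?_
    have : (x : ℂ) ≠ 0 := by
      rintro h
      rw [Complex.ofReal_eq_zero] at h
      rw [h, abs_zero] at hx
      linarith
    field_simp
  rw [mul_assoc, e, ← mul_assoc]
  exact hK.mul_right (norm_diracOp_le hm fun x _ => hb x)

theorem decaysAt_lowerFn_pos {c : ℝ} (hc : c ∈ Set.Icc 0 β) : DecaysAt 1 c (lowerFn β c) :=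
  fun x hx => by
    have := abs_lowerFn_le_of_pos (β := β) c (x := x) (by linarith)
    rwa [clampTo_of_mem hc] at this

theorem decaysAt_lowerFn_neg {c : ℝ} (hc : c ∈ Set.Icc 0 β) : DecaysAt (-1) (β - c) (lowerFn β c) :=
  fun x hx => by
    have := abs_lowerFn_le_of_neg (β := β) c (x := x) (by linarith)
    rwa [clampTo_of_mem hc] at this

theorem decaysAt_upperFn_pos {c : ℝ} (hc : c ∈ Set.Icc 0 β) : DecaysAt 1 (β - c) (upperFn β c) :=
  fun x hx => by
    have := abs_upperFn_le_of_pos (β := β) c (x := x) (by linarith)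
    rwa [clampTo_of_mem hc] at this

theorem decaysAt_upperFn_neg {c : ℝ} (hc : c ∈ Set.Icc 0 β) : DecaysAt (-1) c (upperFn β c) :=
  fun x hx => by
    have := abs_upperFn_le_of_neg (β := β) c (x := x) (by linarith)
    rwa [clampTo_of_mem hc] at this

theorem DecaysAt.mono {σ ρ ρ' : ℝ} {f : ℝ → ℝ} (h : DecaysAt σ ρ f) (hρ : ρ' ≤ ρ) :
    DecaysAt σ ρ' f := fun x hx => (h x hx).trans (by gcongr)

/-- The function `e^{lx} F_{σ(l)}`. -/
def midFn (β l : ℝ) : ℝ → ℝ := if 0 < l then upperFn β l else lowerFn β (-l)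

theorem midOp_eq_diracOp (l : ℝ) : midOp m β l = diracOp m fun x => (midFn β l x : ℂ) := by
  unfold midOp midFn
  split_ifs <;> rfl

theorem isSpecFn_midFn (hβ : 0 < β) (l : ℝ) : IsSpecFn m fun x => (midFn β l x : ℂ) := by
  unfold midFn
  split_ifs
  · exact isSpecFn_upperFn hβ l
  · exact isSpecFn_lowerFn hβ _

/-- The rate may be negative, in which case the bound is weak but true. Allowing this makes the
rates telescope without case distinctions on the order of the variables. -/
theorem decaysAt_midFn_pos {l : ℝ} (hl : l ∈ Set.Icc (-β) β) : DecaysAt 1 (-l) (midFn β l) := by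
  unfold midFn
  have := hl.1
  have := hl.2
  split_ifs with h
  · exact (decaysAt_upperFn_pos ⟨h.le, hl.2⟩).mono (by linarith)
  · exact decaysAt_lowerFn_pos ⟨by linarith, by linarith⟩

theorem decaysAt_midFn_neg {l : ℝ} (hl : l ∈ Set.Icc (-β) β) : DecaysAt (-1) l (midFn β l) := by
  unfold midFn
  have := hl.1
  have := hl.2
  split_ifs with h
  · exact decaysAt_upperFn_neg ⟨h.le, hl.2⟩
  · exact (decaysAt_lowerFn_neg ⟨by linarith, by linarith⟩).mono (by linarith)

/-- Pigeonhole: n + 2 numbers with sum b cannot all be smaller than b/(n + 2). -/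
theorem exists_ge_of_sum {n : ℕ} {b r0 r1 : ℝ} {r : Fin n → ℝ} (h : r0 + ∑ j, r j + r1 = b) :
    b / (n + 2) ≤ r0 ∨ (∃ j, b / (n + 2) ≤ r j) ∨ b / (n + 2) ≤ r1 := by
  by_contra! hc
  obtain ⟨h0, h1, h2⟩ := hc
  have h3 : ∑ j, r j ≤ n * (b / (n + 2)) := by
    simpa using Finset.sum_le_sum fun j (_ : j ∈ Finset.univ) => (h1 j).le
  have h4 : (n + 2) * (b / (n + 2)) = b := by field_simp
  linarith

theorem sum_castSucc_sub_succ {n : ℕ} (u : Fin (n + 1) → ℝ) :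
    ∑ j : Fin n, (u j.castSucc - u j.succ) = u 0 - u (Fin.last n) := by
  have h1 := Fin.sum_univ_castSucc u
  have h2 := Fin.sum_univ_succ u
  rw [Finset.sum_sub_distrib]
  linarith

/-- A trace norm bound for `K` times the `n`-th integrand. -/
def chainBound (β C k : ℝ) (n : ℕ) : ℝ :=
  2 * ((n + 2) * (C * (1 + 4 ! / (β / (n + 2)) ^ 4)) * k ^ (n + 1))

/-- The rates of the n + 2 functions of D sum to β on each half-line, so one of them is at least δ =
β/(n + 2). Splitting the first K by the two spectral projections and applying `traceNormLe_chain` to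
each half gives the bound; this is the factor 2 in `chainBound`. -/
theorem traceNormLe_mul_shiftedIntegrand (hm : 0 < m) (hβ : 0 < β) {K : BOp} {C : ℝ}
    (hK : IsTameInteraction m K C) {n : ℕ} {a : ℝ} {u : Fin (n + 1) → ℝ} (ha : 0 ≤ a)
    (hu : ∀ i, 0 ≤ u i ∧ a + u i ≤ β) :
    TraceNormLe (K * shiftedIntegrand m β K n a u) (chainBound β C ‖K‖ n) := by
  set g := lowerOp m β (a + u 0)
  set gs := (List.ofFn fun j : Fin n => midOp m β (u j.castSucc - u j.succ)) ++
    [upperOp m β (a + u (Fin.last n))]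
  set δ := β / (n + 2)
  have hδ : 0 < δ := by positivity
  -- A common bound for the off-diagonal blocks (C) and for K times a decaying factor (C · 4!/δ⁴).
  set M := C * (1 + 4 ! / δ ^ 4)
  have hC := hK.neg_pos.nonneg
  have hCM : C ≤ M := le_mul_of_one_le_right hC (le_add_of_nonneg_right (by positivity))
  have hCM' : C * (4 ! / δ ^ 4) ≤ M := mul_le_mul_of_nonneg_left (by linarith) hC
  have hc : ∀ i, a + u i ∈ Set.Icc 0 β := fun i => ⟨add_nonneg ha (hu i).1, (hu i).2⟩
  have hl : ∀ j : Fin n, u j.castSucc - u j.succ ∈ Set.Icc (-β) β := fun j =>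
    ⟨by linarith [hu j.castSucc, (hu j.castSucc).1, (hu j.succ).2], by
      linarith [(hu j.succ).1, (hu j.castSucc).2]⟩
  have hlen : gs.length = n + 1 := by simp [gs]
  have e : K * shiftedIntegrand m β K n a u = K * g * (gs.map (K * ·)).prod := by
    simp only [shiftedIntegrand, gs, List.map_append, List.map_ofFn, List.prod_append,
      List.map_cons, List.map_nil, List.prod_cons, List.prod_nil, mul_one, Function.comp_def,
      mul_assoc, g]
  have hgd : ∀ h ∈ g :: gs, ∃ f : ℝ → ℝ, IsSpecFn m (fun x => (f x : ℂ)) ∧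
      h = diracOp m (fun x => (f x : ℂ)) ∧ ‖h‖ ≤ 1 := by
    intro h hh
    rcases List.mem_cons.1 hh with rfl | hh
    · exact ⟨_, isSpecFn_lowerFn hβ _, rfl, norm_lowerOp_le hm hβ _⟩
    · rcases List.mem_append.1 hh with hh | hh
      · obtain ⟨j, rfl⟩ := (List.mem_ofFn' _ _).1 hh
        exact ⟨_, isSpecFn_midFn hβ _, midOp_eq_diracOp _, norm_midOp_le hm hβ _⟩
      · rw [List.mem_singleton] at hh
        subst hh
        exact ⟨_, isSpecFn_upperFn hβ _, rfl, norm_upperOp_le hm hβ _⟩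
  have hcomm : ∀ σ, ∀ h ∈ g :: gs, ‖h‖ ≤ 1 ∧ decayOp m σ 0 * h = h * decayOp m σ 0 := by
    intro σ h hh
    obtain ⟨f, hf, rfl, hn⟩ := hgd h hh
    exact ⟨hn, diracOp_comm hm (isSpecFn_decayFn m σ 0) hf⟩
  have hmid : ∀ j : Fin n, midOp m β (u j.castSucc - u j.succ) ∈ g :: gs := fun j =>
    List.mem_cons_of_mem _ (List.mem_append_left _ ((List.mem_ofFn' _ _).2 ⟨j, rfl⟩))
  have hlast : upperOp m β (a + u (Fin.last n)) ∈ g :: gs :=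
    List.mem_cons_of_mem _ (List.mem_append_right _ (by simp))
  have hsum := sum_castSucc_sub_succ u
  -- On D > 0 the rates are a + u₀, then u_{j+1} - u_j, then β - (a + u_n); their sum telescopes to
  -- β.
  have hpos : ∃ h ∈ g :: gs, TraceNormLe (K * decayOp m 1 0 * h) M := by
    rcases exists_ge_of_sum (b := β) (r0 := a + u 0) (r1 := β - (a + u (Fin.last n)))
      (r := fun j : Fin n => -(u j.castSucc - u j.succ))
      (by rw [Finset.sum_neg_distrib, hsum]; ring) with h | ⟨j, h⟩ | h
    · exact ⟨g, by simp, ((decaysAt_lowerFn_pos (hc 0)).traceNormLe hm (isSpecFn_lowerFn hβ _)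
        hK.resolventSq hδ h).mono hCM'⟩
    · refine ⟨_, hmid j, ?_⟩
      rw [midOp_eq_diracOp]
      exact ((decaysAt_midFn_pos (hl j)).traceNormLe hm (isSpecFn_midFn hβ _)
        hK.resolventSq hδ h).mono hCM'
    · exact ⟨_, hlast, ((decaysAt_upperFn_pos (hc _)).traceNormLe hm (isSpecFn_upperFn hβ _)
        hK.resolventSq hδ h).mono hCM'⟩
  -- On D < 0 the rates are β - (a + u₀), then u_j - u_{j+1}, then a + u_n, again with sum β.
  have hneg : ∃ h ∈ g :: gs, TraceNormLe (K * decayOp m (-1) 0 * h) M := by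
    rcases exists_ge_of_sum (b := β) (r0 := β - (a + u 0)) (r1 := a + u (Fin.last n))
      (r := fun j : Fin n => u j.castSucc - u j.succ)
      (by rw [hsum]; ring) with h | ⟨j, h⟩ | h
    · exact ⟨g, by simp, ((decaysAt_lowerFn_neg (hc 0)).traceNormLe hm (isSpecFn_lowerFn hβ _)
        hK.resolventSq hδ h).mono hCM'⟩
    · refine ⟨_, hmid j, ?_⟩
      rw [midOp_eq_diracOp]
      exact ((decaysAt_midFn_neg (hl j)).traceNormLe hm (isSpecFn_midFn hβ _)
        hK.resolventSq hδ h).mono hCM'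
    · exact ⟨_, hlast, ((decaysAt_upperFn_neg (hc _)).traceNormLe hm (isSpecFn_upperFn hβ _)
        hK.resolventSq hδ h).mono hCM'⟩
  have h1 := traceNormLe_chain (decayOp_add hm) (norm_decayOp_le_one hm 1 0) le_rfl
    (hK.pos_neg.mono hCM) g gs (hcomm 1) hpos
  have h2 := traceNormLe_chain ((add_comm _ _).trans (decayOp_add hm))
    (norm_decayOp_le_one hm (-1) 0) le_rfl (hK.neg_pos.mono hCM) g gs (hcomm (-1)) hneg
  have h3 := h1.add h2
  rw [← add_mul, ← add_mul, ← mul_add, decayOp_add hm, mul_one, ← e, hlen] at h3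
  refine h3.mono (le_of_eq ?_)
  rw [chainBound]
  push_cast
  ring

theorem chainBound_nonneg (hβ : 0 < β) {C k : ℝ} (hC : 0 ≤ C) (hk : 0 ≤ k) (n : ℕ) :
    0 ≤ chainBound β C k n := by
  unfold chainBound; positivity

/-- The number of factors and δ⁻⁴ together grow like n⁵, so the terms are dominated by n⁵(βk)ⁿ. The
16 comes from n + 2 ≤ 2(n + 1). -/
theorem summable_chainBound (hβ : 0 < β) {C k : ℝ} (hC : 0 ≤ C) (hk : 0 ≤ k) (hq : β * k < 1) :
    Summable fun n => β ^ (n + 1) * chainBound β C k n := by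
  have hq' : ‖β * k‖ < 1 := by rwa [Real.norm_of_nonneg (by positivity)]
  have h0 : Summable fun n : ℕ => (n : ℝ) ^ 5 * (β * k) ^ n :=
    summable_pow_mul_geometric_of_norm_lt_one 5 hq'
  have h1 : Summable fun n : ℕ => ((n + 1 : ℕ) : ℝ) ^ 5 * (β * k) ^ (n + 1) :=
    (summable_nat_add_iff (f := fun n : ℕ => (n : ℝ) ^ 5 * (β * k) ^ n) 1).2 h0
  refine (h1.mul_left (4 * C * (1 + 4 ! * 16 / β ^ 4))).of_nonneg_of_le
    (fun n => mul_nonneg (by positivity) (chainBound_nonneg hβ hC hk n)) fun n => ?_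
  have hn : (0 : ℝ) ≤ n := n.cast_nonneg
  have h2 : (1 : ℝ) ≤ ((n : ℝ) + 1) ^ 4 := one_le_pow₀ (by linarith)
  have h3 : ((n : ℝ) + 2) ^ 4 ≤ 16 * ((n : ℝ) + 1) ^ 4 := by
    calc ((n : ℝ) + 2) ^ 4 ≤ (2 * ((n : ℝ) + 1)) ^ 4 := by gcongr; linarith
      _ = _ := by ring
  have h4 : 1 + 4 ! / (β / (n + 2)) ^ 4 ≤ (1 + 4 ! * 16 / β ^ 4) * ((n : ℝ) + 1) ^ 4 := by
    rw [div_pow, div_div_eq_mul_div, add_mul, one_mul]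
    refine add_le_add h2 ?_
    calc 4 ! * ((n : ℝ) + 2) ^ 4 / β ^ 4 ≤ 4 ! * (16 * ((n : ℝ) + 1) ^ 4) / β ^ 4 := by gcongr
      _ = _ := by ring
  calc β ^ (n + 1) * chainBound β C k n
      = 2 * C * ((n + 2) * (1 + 4 ! / (β / (n + 2)) ^ 4)) * (β * k) ^ (n + 1) := by
        unfold chainBound
        rw [mul_pow]
        generalize 1 + (4 ! : ℝ) / (β / (n + 2)) ^ 4 = w
        ring
    _ ≤ 2 * C * ((2 * ((n : ℝ) + 1)) * ((1 + 4 ! * 16 / β ^ 4) * ((n : ℝ) + 1) ^ 4))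
          * (β * k) ^ (n + 1) := by
        gcongr
        linarith
    _ = _ := by
        push_cast
        generalize 1 + (4 ! : ℝ) * 16 / β ^ 4 = w
        ring

theorem traceNormLe_mul_shiftedIntegral (hm : 0 < m) (hβ : 0 < β) {K : BOp} {C : ℝ}
    (hK : IsTameInteraction m K C) (n : ℕ) {a ub : ℝ} (ha : 0 ≤ a) (hub : 0 ≤ ub)
    (hab : a + ub ≤ β) :
    TraceNormLe (K * shiftedIntegral m β K n a ub) (β ^ (n + 1) * chainBound β C ‖K‖ n) := by
  have h := ((hasStrongIntegral_shiftedIntegral hm hβ K n a ub).mul_left K).traceNormLe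
    (c := fun _ => chainBound β C ‖K‖ n) (integrable_const _) (by
      filter_upwards [ae_mem_cube (n + 1) ub] with u hu
      exact traceNormLe_mul_shiftedIntegrand hm hβ hK ha fun i =>
        ⟨(hu i).1.le, by linarith [(hu i).2]⟩)
  rw [integral_cubeMeasure_const _ hub] at h
  have := chainBound_nonneg hβ hK.neg_pos.nonneg (norm_nonneg K) n
  refine h.mono ?_
  gcongr
  linarith

theorem traceNormLe_mul_shiftedSeries (hm : 0 < m) (hβ : 0 < β) {K : BOp} {C : ℝ}
    (hK : IsTameInteraction m K C) (hq : β * ‖K‖ < 1) {a ub : ℝ} (ha : 0 ≤ a) (hub : 0 ≤ ub)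
    (hab : a + ub ≤ β) :
    TraceNormLe (K * shiftedSeries m β K a ub) (∑' n, β ^ (n + 1) * chainBound β C ‖K‖ n) := by
  have hs := (summable_shiftedSeries hm hβ hq a (ub := ub) ⟨hub, by linarith⟩).hasSum.tendsto_sum_nat
  have ht := (summable_chainBound hβ hK.neg_pos.nonneg (norm_nonneg K) hq).hasSum.tendsto_sum_nat
  refine TraceNormLe.of_tendsto (l := atTop) (F := fun N => K * ∑ n ∈ Finset.range N,
    (-1 : ℂ) ^ (n + 1) • shiftedIntegral m β K n a ub) (Eventually.of_forall fun N => ?_)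
    (fun x y => ?_) ht
  · rw [Finset.mul_sum]
    refine TraceNormLe.sum _ fun n _ => ?_
    have h := (traceNormLe_mul_shiftedIntegral hm hβ hK n ha hub hab).smul ((-1 : ℂ) ^ (n + 1))
    rwa [norm_pow, norm_neg, norm_one, one_pow, one_mul, ← mul_smul_comm] at h
  · have h1 : Tendsto (fun N => (∑ n ∈ Finset.range N,
        (-1 : ℂ) ^ (n + 1) • shiftedIntegral m β K n a ub) y) atTop
        (𝓝 (shiftedSeries m β K a ub y)) :=
      ((ContinuousLinearMap.apply ℂ HSp y).continuous.tendsto _).comp hs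
    exact tendsto_const_nhds.inner ((K.continuous.tendsto _).comp h1)

theorem exists_traceNormLe_entropyOp (hm : 0 < m) (hβ : 0 < β) {K : BOp} {C : ℝ}
    (hK : IsTameInteraction m K C) (hq : β * ‖K‖ < 1) :
    ∃ D, TraceNormLe (entropyOp m β K) D := by
  refine ⟨_, ((hasStrongIntegral_Bop_series hm hβ hq).mul_left K).traceNormLe
    (c := fun _ => ‖(β : ℂ)‖ * ∑' n, β ^ (n + 1) * chainBound β C ‖K‖ n) (integrable_const _)
    ((ae_restrict_iff' measurableSet_Ioo).2 (ae_of_all _ fun u hu => ?_))⟩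
  rw [mul_smul_comm]
  exact (traceNormLe_mul_shiftedSeries hm hβ hK hq (mul_nonneg hβ.le (by linarith [hu.2]))
    (mul_nonneg hβ.le hu.1.le) (by nlinarith)).smul _

end

end DiracEntropy

namespace DiracEntropy
open Filter Topology

/-! ### Young's inequality for kernels in momentum space -/

section

theorem norm_momentumRep_sq (f : HSp) (p : E3) : ‖momentumRep f p‖ ^ 2
    = ((2 * Real.pi) ^ 3)⁻¹ * ‖fourierU f ((2 * Real.pi)⁻¹ • p)‖ ^ 2 := by
  have h2 : ((2 * Real.pi) ^ (-(3 / 2) : ℝ)) ^ 2 = ((2 * Real.pi) ^ 3)⁻¹ := by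
    rw [← Real.rpow_natCast, ← Real.rpow_mul (by positivity),
      show (-(3 / 2) : ℝ) * ((2 : ℕ) : ℝ) = -((3 : ℕ) : ℝ) by norm_num,
      Real.rpow_neg (by positivity), Real.rpow_natCast]
  rw [momentumRep, norm_smul, mul_pow, Real.norm_eq_abs, sq_abs, h2]
  rfl

/-- Plancherel: the normalization (2π)⁻³ compensates the Jacobian of the dilation p = 2πξ. -/
theorem integral_norm_momentumRep_sq (f : HSp) : ∫ p, ‖momentumRep f p‖ ^ 2 = ‖f‖ ^ 2 := by
  simp only [norm_momentumRep_sq]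
  rw [integral_const_mul, Measure.integral_comp_smul volume (fun p => ‖fourierU f p‖ ^ 2),
    ← HSp_norm_sq, LinearIsometryEquiv.norm_map, finrank_euclideanSpace, Fintype.card_fin,
    inv_pow, inv_inv, abs_of_pos (by positivity), smul_eq_mul,
    inv_mul_cancel_left₀ (by positivity)]

theorem integrable_norm_momentumRep_sq (f : HSp) :
    Integrable fun p => ‖momentumRep f p‖ ^ 2 := by
  simp only [norm_momentumRep_sq]
  exact ((HSp_integrable_norm_sq (fourierU f)).comp_smul (by positivity)).const_mul _

theorem stronglyMeasurable_momentumRep (f : HSp) : StronglyMeasurable (momentumRep f) :=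
  ((Lp.stronglyMeasurable (fourierU f)).comp_measurable
    (measurable_const_smul (2 * Real.pi)⁻¹)).const_smul ((2 * Real.pi) ^ (-(3 / 2) : ℝ))

theorem lintegral_momentumRep_sq (f : HSp) :
    ∫⁻ p, ‖momentumRep f p‖ₑ ^ 2 = ENNReal.ofReal (‖f‖ ^ 2) := by
  rw [← integral_norm_momentumRep_sq, ofReal_integral_eq_lintegral_ofReal
    (integrable_norm_momentumRep_sq f) (ae_of_all _ fun _ => sq_nonneg _)]
  refine lintegral_congr fun p => ?_
  rw [ENNReal.ofReal_pow (norm_nonneg _), ofReal_norm]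

/-- Cauchy–Schwarz for the measure with density h, obtained by writing hG = √h · (√h G). -/
theorem sq_lintegral_mul_le {h G : E3 → ENNReal} (hh : Measurable h) (hG : Measurable G) :
    (∫⁻ q, h q * G q) ^ 2 ≤ (∫⁻ q, h q) * ∫⁻ q, h q * G q ^ 2 := by
  have e : ∀ q, h q * G q = h q ^ (1 / 2 : ℝ) * (h q ^ (1 / 2 : ℝ) * G q) := fun q => by
    rw [← mul_assoc, ← ENNReal.rpow_add_of_nonneg _ _ (by norm_num) (by norm_num)]
    norm_num
  have h1 := ENNReal.lintegral_mul_le_Lp_mul_Lq (volume : Measure E3)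
    (Real.HolderConjugate.two_two) (f := fun q => h q ^ (1 / 2 : ℝ))
    (g := fun q => h q ^ (1 / 2 : ℝ) * G q) (by fun_prop) (by fun_prop)
  have e1 : ∀ q, (h q ^ (1 / 2 : ℝ)) ^ (2 : ℝ) = h q := fun q => by
    rw [← ENNReal.rpow_mul]; norm_num
  have e2 : ∀ q, (h q ^ (1 / 2 : ℝ) * G q) ^ (2 : ℝ) = h q * G q ^ 2 := fun q => by
    rw [ENNReal.mul_rpow_of_nonneg _ _ (by norm_num), e1, ENNReal.rpow_two]
  simp only [Pi.mul_apply, ← e, e1, e2] at h1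
  calc (∫⁻ q, h q * G q) ^ 2 ≤ ((∫⁻ q, h q) ^ (1 / 2 : ℝ) * (∫⁻ q, h q * G q ^ 2) ^ (1 / 2 : ℝ)) ^ 2 := by
        gcongr
    _ = _ := by
        rw [mul_pow, ← ENNReal.rpow_two, ← ENNReal.rpow_two, ← ENNReal.rpow_mul, ← ENNReal.rpow_mul]
        norm_num

/-- Young's inequality for the convolution |H| * |f̂|, proved by the weighted Cauchy–Schwarz
inequality and Tonelli, together with Plancherel. -/
theorem norm_le_of_isFourierKernel {K : BOp} {Khat : E3 → E3 → SOp} {H : E3 → ℝ}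
    (hK : IsFourierKernel K Khat) (hH : ∀ᵐ z : E3 × E3, ‖Khat z.1 z.2‖ ≤ H (z.1 - z.2))
    (hH1 : MemLp H 1 volume) : ‖K‖ ≤ (eLpNorm H 1 volume).toReal := by
  -- A measurable representative, needed for Tonelli. It agrees with H almost everywhere along q ↦ p
  -- - q because this map preserves null sets.
  set H' := hH1.1.mk H
  set h : E3 → ENNReal := fun x => ‖H' x‖ₑ
  have hh : Measurable h := hH1.1.stronglyMeasurable_mk.enorm
  have hnorm : eLpNorm H 1 volume = ∫⁻ x, h x := by
    rw [eLpNorm_one_eq_lintegral_enorm]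
    refine lintegral_congr_ae ?_
    filter_upwards [hH1.1.ae_eq_mk] with x hx
    rw [hx]
  refine ContinuousLinearMap.opNorm_le_bound _ ENNReal.toReal_nonneg fun f => ?_
  set G : E3 → ENNReal := fun q => ‖momentumRep f q‖ₑ
  have hG : Measurable G := (stronglyMeasurable_momentumRep f).enorm
  have hbound : ∀ᵐ p, ‖momentumRep (K f) p‖ₑ ≤ ∫⁻ q, h (p - q) * G q := by
    have h1 := Measure.ae_ae_of_ae_prod hH
    filter_upwards [hK.2 f, h1] with p hp hp2
    rw [hp.2]
    refine (enorm_integral_le_lintegral_enorm _).trans (lintegral_mono_ae ?_)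
    have h3 : ∀ᵐ q, H (p - q) = H' (p - q) :=
      (Measure.measurePreserving_sub_left volume p).quasiMeasurePreserving.ae hH1.1.ae_eq_mk
    filter_upwards [hp2, h3] with q h4 h5
    refine (ContinuousLinearMap.le_opENorm _ _).trans ?_
    gcongr
    refine enorm_le_iff_norm_le.2 ?_
    rw [← h5]
    exact h4.trans (le_abs_self _)
  have hmain : ENNReal.ofReal (‖K f‖ ^ 2) ≤ (∫⁻ x, h x) ^ 2 * ENNReal.ofReal (‖f‖ ^ 2) := by
    rw [← lintegral_momentumRep_sq, ← lintegral_momentumRep_sq]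
    calc ∫⁻ p, ‖momentumRep (K f) p‖ₑ ^ 2
        ≤ ∫⁻ p, (∫⁻ x, h x) * ∫⁻ q, h (p - q) * G q ^ 2 := by
          refine lintegral_mono_ae ?_
          filter_upwards [hbound] with p hp
          refine (pow_le_pow_left' hp 2).trans ((sq_lintegral_mul_le (by fun_prop) hG).trans ?_)
          rw [lintegral_sub_left_eq_self h p]
      _ = (∫⁻ x, h x) * ∫⁻ p, ∫⁻ q, h (p - q) * G q ^ 2 :=
          lintegral_const_mul _ (Measurable.lintegral_prod_right' (f := fun z : E3 × E3 =>
            h (z.1 - z.2) * G z.2 ^ 2) (by fun_prop))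
      _ = (∫⁻ x, h x) * ∫⁻ q, (∫⁻ x, h x) * G q ^ 2 := by
          -- After the exchange the p-integral of h(p - q) equals the integral of h, by translation
          -- invariance.
          rw [lintegral_lintegral_swap (by fun_prop)]
          congr 1
          refine lintegral_congr fun q => ?_
          rw [lintegral_mul_const _ (by fun_prop), lintegral_sub_right_eq_self h q]
      _ = _ := by
          rw [lintegral_const_mul _ (by fun_prop), ← mul_assoc, sq]
  have hfin : ∫⁻ x, h x ≠ ⊤ := by rw [← hnorm]; exact hH1.2.ne
  rw [hnorm]
  have h6 := ENNReal.toReal_mono (ENNReal.mul_ne_top (ENNReal.pow_ne_top hfin) ENNReal.ofReal_ne_top)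
    hmain
  rw [ENNReal.toReal_mul, ENNReal.toReal_pow, ENNReal.toReal_ofReal (by positivity),
    ENNReal.toReal_ofReal (by positivity), ← mul_pow] at h6
  exact (abs_le_of_sq_le_sq' h6 (by positivity)).2

end

end DiracEntropy

end

open DiracEntropy in
theorem mainTheorem7 (m β ε : ℝ) (hm : 0 < m) (hβ : 0 < β) (hε : 0 < ε)
    (A : ℝ → DiracEntropy.E3 → Fin 4 → ℝ) (hA : DiracEntropy.IsSwitchedPotential ε A)
    (K : DiracEntropy.BOp) (hK : K = DiracEntropy.interaction m ε A) :
    -- the Dyson series and the integrals that define `𝒦` converge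
    ((∀ (n : ℕ) (t : ℝ), DiracEntropy.HasStrongIntegral (MeasureTheory.volume.restrict (Set.Iio t))
        (fun s => Complex.I • (DiracEntropy.dyson m A n s * DiracEntropy.slashInt m A s))
        (DiracEntropy.dyson m A (n + 1) t)) ∧
      (∀ t : ℝ, Summable fun n : ℕ => ‖DiracEntropy.dyson m A n t‖) ∧
      DiracEntropy.HasStrongIntegral (MeasureTheory.volume.restrict (Set.Ioo (-ε) 0))
        (DiracEntropy.interactionIntegrand m A) K) ∧
    -- if `‖𝒦‖ < 1/β`, then `𝔖` is a well-defined bounded operator, with the norm bound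
    (‖K‖ < β⁻¹ →
      (∀ ub ∈ Set.Icc 0 β,
        (∀ n : ℕ, DiracEntropy.HasStrongIntegral (DiracEntropy.cubeMeasure (n + 1) ub)
          (DiracEntropy.TIntegrand m β K n) (DiracEntropy.TIntegral m β K n ub)) ∧
        Summable fun n : ℕ => ‖DiracEntropy.TIntegral m β K n ub‖) ∧
      (∀ u ∈ Set.Ioo (0 : ℝ) 1, ∃! Y : DiracEntropy.BOp,
        DiracEntropy.IsConj m (β * (1 - u))
          (DiracEntropy.TOp m β K (β * u) - DiracEntropy.TOp m β K 0) Y) ∧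
      DiracEntropy.HasStrongIntegral (MeasureTheory.volume.restrict (Set.Ioo 0 1))
        (DiracEntropy.BIntegrand m β K) (DiracEntropy.Bop m β K) ∧
      ‖DiracEntropy.entropyOp m β K‖ ≤ β ^ 2 * ‖K‖ ^ 2 / (1 - β * ‖K‖)) ∧
    -- under the kernel bound, `𝔖` is trace class and its trace is finite
    (∀ (Khat : DiracEntropy.E3 → DiracEntropy.E3 →
          (DiracEntropy.Spinor →L[ℂ] DiracEntropy.Spinor)) (H : DiracEntropy.E3 → ℝ),
      DiracEntropy.IsFourierKernel K Khat →
      (∀ᵐ z : DiracEntropy.E3 × DiracEntropy.E3, ‖Khat z.1 z.2‖ ≤ H (z.1 - z.2)) →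
      MeasureTheory.MemLp H 1 MeasureTheory.volume →
      MeasureTheory.MemLp H 2 MeasureTheory.volume →
      MeasureTheory.eLpNorm H 1 MeasureTheory.volume < ENNReal.ofReal β⁻¹ →
      MeasureTheory.eLpNorm H 2 MeasureTheory.volume < ENNReal.ofReal β⁻¹ →
      ‖K‖ < β⁻¹ ∧
      DiracEntropy.IsTraceClass (DiracEntropy.entropyOp m β K) ∧
      ∀ (ι : Type) (e : HilbertBasis ι ℂ DiracEntropy.HSp),
        HasSum (fun i => inner ℂ (e i) (DiracEntropy.entropyOp m β K (e i)))
          (DiracEntropy.relativeEntropy m β K)) := by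
  have ha := hA.isSwitchedCurve
  have hq : ‖K‖ < β⁻¹ → β * ‖K‖ < 1 := fun h => by
    have := mul_lt_mul_of_pos_left h hβ
    rwa [mul_inv_cancel₀ hβ.ne'] at this
  refine ⟨⟨fun n t => ?_, fun t => summable_norm_dyson hm ha t, ?_⟩, fun h => ⟨fun ub hub =>
    ⟨fun n => ?_, ?_⟩, fun u hu => ?_, hasStrongIntegral_Bop hm hβ (hq h),
    norm_entropyOp_le hm hβ (hq h)⟩, fun Khat H hKhat hH hH1 _ hlt _ => ?_⟩
  · rw [(dyson_eq_and_hasStrongIntegral hm ha (n + 1)).1 t]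
    exact (dyson_eq_and_hasStrongIntegral hm ha n).2 t
  · rw [hK, interaction_eq hm hA]
    exact hasStrongIntegral_interaction hm hA
  · rw [TIntegral_eq hm hβ K n hub.2]
    exact hasStrongIntegral_TIntegrand hm hβ K n hub.2
  · simp only [TIntegral_eq hm hβ K _ hub.2]
    exact summable_norm_shiftedIntegral hm hβ (hq h) 0 hub
  · refine ⟨_, isConj_shiftedSeries hm hβ (hq h) (mul_nonneg hβ.le (by linarith [hu.2]))
      (mul_nonneg hβ.le hu.1.le) (by nlinarith), fun Y hY => hY.unique hm
      (isConj_shiftedSeries hm hβ (hq h) (mul_nonneg hβ.le (by linarith [hu.2]))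
      (mul_nonneg hβ.le hu.1.le) (by nlinarith))⟩
  · have h : ‖K‖ < β⁻¹ := by
      refine (norm_le_of_isFourierKernel hKhat hH hH1).trans_lt ?_
      rw [← ENNReal.toReal_ofReal (inv_pos.2 hβ).le]
      exact (ENNReal.toReal_lt_toReal hH1.2.ne ENNReal.ofReal_ne_top).2 hlt
    obtain ⟨C, hC⟩ := exists_isTameInteraction hm hA
    rw [← hK] at hC
    obtain ⟨D, hD⟩ := exists_traceNormLe_entropyOp hm hβ hC (hq h)
    exact ⟨h, hD.isTraceClass, fun ι e => hD.hasSum_opTrace ι e⟩
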